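/- For $u\in L^2(\mathbb R^2)$ let $\widehat u(\xi,\eta)$ be its Fourier transform, and for $s\in\mathbb R$ put $$\|u\|_{H^s_{-1}}=\big\|(1+|\xi|^{-1})\,\langle|\xi|+|\eta|\rangle^{s}\,\widehat u(\xi,\eta)\big\|_{L^2_{\xi\eta}},\qquad \langle r\rangle=(1+r^2)^{1/2}.$$ Let $H^\infty_{-1}=\bigcap_{s} H^s_{-1}(\mathbb R^2)$, with the topology defined by all these norms. Let $J_x^s=(1-\partial_x^2)^{s/2}$ be the Fourier multiplier with symbol $(1+\xi^2)^{s/2}$, and let $\partial_x^{-1}$ be the one with symbol $(i\xi)^{-1}$. **Proposition.** For every $\varepsilon>0$ there exists a constant $C_\varepsilon$, depending only on $\varepsilon$, such that the following holds. Let $T\ge 0$, let $F:[0,T]\to L^2(\mathbb R^2)$ be measurable, and let $v\in C([0,T];H^\infty_{-1}(\mathbb R^2))$ be a (real- or complex-valued) solution, in the sense of distributions, of $$v_t+v_{xxx}-\partial_x^{-1}v_{yy}=F_x\quad\text{on }[0,T]\times\mathbb R^2 .$$ Here this means that, for every Schwartz function $\varphi$ on $\mathbb R^2$, the function $s\mapsto\int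 F(s)\,\varphi_x$ is integrable on $[0,T]$ and, for all $t\in[0,T]$, $$\int_{\mathbb R^2} v(t)\varphi-\int_{\mathbb R^2} v(0)\varphi=\int_0^t\Big(\int_{\mathbb R^2} v(s)\,\varphi_{xxx}+\int_{\mathbb R^2}\big(\partial_x^{-1}v_{yy}(s)\big)\varphi-\int_{\mathbb R^2}F(s)\,\varphi_x\Big)\,ds .$$ Then $$\|v\|_{L^1_TL^\infty_{xy}}\le C_\varepsilon(1+T)\,\|J_x^{1/2+\varepsilon}v\|_{L^\infty_TL^2_{xy}}+C_\varepsilon\,\|J_x^{1/2+\varepsilon}F\|_{L^1_TL^2_{xy}},$$ where $L^p_T$ denotes $L^p([0,T])$ and the last norm may be $+\infty$. -/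

import Mathlib

open MeasureTheory Set Filter Topology
open scoped ENNReal NNReal FourierTransform LineDeriv SchwartzMap

/-- The plane `ℝ²`; the coordinates of `z` are `x = z 0` and `y = z 1`. -/
abbrev Plane : Type := EuclideanSpace ℝ (Fin 2)

/-- The space `L²(ℝ²)` of complex-valued functions modulo a.e. equality. -/
abbrev L2Plane : Type := Lp ℂ 2 (volume : Measure Plane)

namespace KP

noncomputable section

/-- The unit vector in the direction of `x`. -/
def ex : Plane := EuclideanSpace.single 0 1

/-- The angular frequency dual to `x`. Mathlib's Fourier transform uses the kernel
`exp (-2πi ⟨z, ζ⟩)`, so `∂_x` has the symbol `i ξ` with `ξ = 2π ζ 0`. -/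
def xi (ζ : Plane) : ℝ := 2 * Real.pi * ζ 0

/-- The angular frequency dual to `y`: `∂_y` has the symbol `i η` with `η = 2π ζ 1`. -/
def eta (ζ : Plane) : ℝ := 2 * Real.pi * ζ 1

/-- `‖m(D) u‖_{L²} = ‖m û‖_{L²} ∈ [0, ∞]` for the Fourier multiplier with symbol `m`
(`∞` when `u` is outside the `L²` domain of `m(D)`). -/
def multNorm (m : Plane → ℂ) (u : L2Plane) : ℝ≥0∞ :=
  eLpNorm (fun ζ => m ζ * (𝓕 u : L2Plane) ζ) 2 volume

open Classical in
/-- The Fourier multiplier operator `m(D)`, `u ↦ 𝓕⁻¹ (m û)`, on its natural domain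
`{u ∈ L² : m û ∈ L²}` (and `0` off this domain). -/
def mult (m : Plane → ℂ) (u : L2Plane) : L2Plane :=
  if h : MemLp (fun ζ => m ζ * (𝓕 u : L2Plane) ζ) 2 volume then 𝓕⁻ (h.toLp _) else 0

/-- The norm of `H^s_{-1}(ℝ²)`:
`‖u‖ = ‖(1 + |ξ|⁻¹) ⟨|ξ| + |η|⟩^s û‖_{L²}`, with `⟨r⟩ = (1 + r²)^{1/2}`. -/
def HNorm (s : ℝ) (u : L2Plane) : ℝ≥0∞ :=
  multNorm (fun ζ =>
    (((1 + |xi ζ|⁻¹) * (1 + (|xi ζ| + |eta ζ|) ^ 2) ^ (s / 2) : ℝ) : ℂ)) u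

/-- `u ∈ H^∞_{-1}(ℝ²) = ⋂ₛ H^s_{-1}(ℝ²)`. -/
def MemHInfty (u : L2Plane) : Prop := ∀ s : ℝ, HNorm s u < ∞

/-- `v ∈ C([0,T]; H^∞_{-1}(ℝ²))`, where `H^∞_{-1}` carries the topology of all the norms
of the `H^s_{-1}`. -/
def ContHInfty (T : ℝ) (v : ℝ → L2Plane) : Prop :=
  (∀ t ∈ Icc 0 T, MemHInfty (v t)) ∧
    ∀ s : ℝ, ∀ t₀ ∈ Icc 0 T,
      Tendsto (fun t => HNorm s (v t - v t₀)) (𝓝[Icc 0 T] t₀) (𝓝 0)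

/-- `‖J_x^s u‖_{L²} ∈ [0, ∞]`, where `J_x^s = (1 - ∂_x²)^{s/2}` has the symbol
`(1 + ξ²)^{s/2}`. -/
def JxNorm (s : ℝ) (u : L2Plane) : ℝ≥0∞ :=
  multNorm (fun ζ => (((1 + xi ζ ^ 2) ^ (s / 2) : ℝ) : ℂ)) u

/-- `∂_x⁻¹ ∂_y² u`, the Fourier multiplier with symbol `(i η)² / (i ξ)`. -/
def dxInvDyy (u : L2Plane) : L2Plane :=
  mult (fun ζ => (Complex.I * (eta ζ : ℂ)) ^ 2 / (Complex.I * (xi ζ : ℂ))) u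

/-- `v` solves `v_t + v_xxx - ∂_x⁻¹ v_yy = F_x` on `[0,T] × ℝ²` in the sense of distributions:
after pairing with any test function `φ` of `(x, y)`, the equation holds integrated in time. -/
def IsSolution (T : ℝ) (v F : ℝ → L2Plane) : Prop :=
  ∀ φ : 𝓢(Plane, ℂ),
    IntervalIntegrable (fun s => ∫ z, F s z * (∂_{ex} φ) z) volume 0 T ∧
    ∀ t ∈ Icc 0 T,
      (∫ z, v t z * φ z) - (∫ z, v 0 z * φ z) =
        ∫ s in (0 : ℝ)..t,
          ((∫ z, v s z * (∂_{ex} (∂_{ex} (∂_{ex} φ))) z)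
            + (∫ z, dxInvDyy (v s) z * φ z)
            - ∫ z, F s z * (∂_{ex} φ) z)

/-- `‖u‖_{L¹_T L^∞_{xy}}`. -/
def normL1Linfty (T : ℝ) (u : ℝ → L2Plane) : ℝ≥0∞ :=
  ∫⁻ t in Icc 0 T, eLpNorm (u t) ∞ volume

/-- `‖J_x^s u‖_{L^∞_T L²_{xy}}`. -/
def normJxLinftyL2 (s T : ℝ) (u : ℝ → L2Plane) : ℝ≥0∞ :=
  essSup (fun t => JxNorm s (u t)) (volume.restrict (Icc 0 T))

/-- `‖J_x^s u‖_{L¹_T L²_{xy}}`. -/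
def normJxL1L2 (s T : ℝ) (u : ℝ → L2Plane) : ℝ≥0∞ :=
  ∫⁻ t in Icc 0 T, JxNorm s (u t)

end

end KP

/-! On the Fourier side the free evolution multiplies by `exp (i t ω)` with `ω = ξ³ + η²/ξ`.
Localize `|ζ 0|` to a dyadic range of size `2 ^ k`. Integrating out `η` is a Gaussian integral: it
yields `√ξ |t|^(-1/2)` and changes the remaining phase only by a term linear in `ξ`. The second
derivative test in `ξ` yields another `|t|^(-1/2)`, and the growth of `√ξ` is compensated by that of
the second derivative, which is of size `|t| ξ`. The localized kernel is thus `O(|t|⁻¹)` uniformly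
in `k`. Interpolation with the trivial bound gives `2^(3kθ/2) |t|^(-1+θ/2)`, which is integrable in
time (`norm_kernel_le`).

The supremum in space is linearized by a measurable path `z(t)`. Then `v(t, z(t))` is a limit of
inner products of a test curve (`wave`) with the profile `exp (-i t ω) v̂(t)`, and the Gram matrix
of the curve is the kernel above. By Duhamel's formula (`duhamel`) the profile is its initial value
plus the integral of the forcing, which is `F` times `ξ`. A TT* argument with the forcing included
(`integral_norm_inner_le`) bounds the `L¹` norm in time on an interval of length at most `2^(-k)`,
with gain `2^(k(θ-1)/2)`.

About `(1 + T) 2^k` such intervals cover `[0,T]`. The data terms lose `2^k` from the number of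
intervals, the forcing terms lose `2^k` from the derivative on `F`: the length `2^(-k)` balances the
two. With `s = 1/2 + ε` the total power is `2^(k(θ/2 - ε))`, summable over `k` when `θ ≤ ε`.

Two regularizations put the argument inside `L²`: a Gaussian factor in `η`, which makes the test
curve square integrable, and a cutoff to bounded `ω`, which makes the evolution differentiable in
operator norm. All bounds are uniform in both, and Fatou's lemma removes them. -/

namespace KP

/-! ### One-dimensional oscillatory integrals. -/

/-- The first derivative test for oscillatory integrals. -/
theorem norm_integral_mul_cexp_le_of_le_deriv {a b l M D : ℝ} (hab : a ≤ b) (hl : 0 < l)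
    {φ φ' φ'' ψ ψ' : ℝ → ℝ}
    (hφ : ∀ x ∈ Icc a b, HasDerivAt φ (φ' x) x) (hφ' : ∀ x ∈ Icc a b, HasDerivAt φ' (φ'' x) x)
    (hψ : ∀ x ∈ Icc a b, HasDerivAt ψ (ψ' x) x) (hcφ : ContinuousOn φ'' (Icc a b))
    (hcψ : ContinuousOn ψ' (Icc a b)) (hpos : ∀ x ∈ Icc a b, 0 ≤ φ'' x)
    (hlow : ∀ x ∈ Icc a b, l ≤ |φ' x|) (hM : ∀ x ∈ Icc a b, |ψ x| ≤ M)
    (hD : ∀ x ∈ Icc a b, |ψ' x| ≤ D) :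
    ‖∫ x in a..b, (ψ x : ℂ) * Complex.exp (Complex.I * φ x)‖ ≤ (4 * M + D * (b - a)) / l := by
  have hM0 : 0 ≤ M := (abs_nonneg _).trans (hM a ⟨le_rfl, hab⟩)
  have hD0 : 0 ≤ D := (abs_nonneg _).trans (hD a ⟨le_rfl, hab⟩)
  have hne : ∀ x ∈ Icc a b, φ' x ≠ 0 := fun x hx h => by
    have := hlow x hx; rw [h, abs_zero] at this; linarith
  have hneC : ∀ x ∈ Icc a b, (φ' x : ℂ) ≠ 0 := fun x hx => by exact_mod_cast hne x hx
  have cφ : ContinuousOn φ (Icc a b) := fun x hx => (hφ x hx).continuousAt.continuousWithinAt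
  have cφ' : ContinuousOn φ' (Icc a b) := fun x hx => (hφ' x hx).continuousAt.continuousWithinAt
  have cψ : ContinuousOn ψ (Icc a b) := fun x hx => (hψ x hx).continuousAt.continuousWithinAt
  set e : ℝ → ℂ := fun x => Complex.exp (Complex.I * φ x) with he
  have hnorm : ∀ x, ‖e x‖ = 1 := fun x => by
    rw [he]; simp only; rw [mul_comm]; exact Complex.norm_exp_ofReal_mul_I _
  have ce : ContinuousOn e (Icc a b) := by
    apply Complex.continuous_exp.comp_continuousOn
    exact continuousOn_const.mul (Complex.continuous_ofReal.comp_continuousOn cφ)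
  -- Integration by parts: the derivative of `ψ e / (i φ')` reproduces the integrand up to two error
  -- terms.
  have key : ∀ x ∈ Icc a b, HasDerivAt (fun x => (ψ x : ℂ) * e x / (Complex.I * φ' x))
      ((ψ x : ℂ) * e x + (e x * ((ψ' x : ℂ) / (Complex.I * φ' x))
        - e x * ((ψ x : ℂ) * φ'' x / (Complex.I * (φ' x) ^ 2)))) x := by
    intro x hx
    have h1 : HasDerivAt e (e x * (Complex.I * φ' x)) x :=
      (((hφ x hx).ofReal_comp).const_mul Complex.I).cexp
    have h2 := (((hψ x hx).ofReal_comp).mul h1).div (((hφ' x hx).ofReal_comp).const_mul Complex.I)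
      (mul_ne_zero Complex.I_ne_zero (hneC x hx))
    refine h2.congr_deriv ?_
    have := hneC x hx
    have hI := Complex.I_ne_zero
    simp only [Pi.mul_apply]
    field_simp
    ring
  have c1 : ContinuousOn (fun x => (ψ x : ℂ) * e x) (Icc a b) :=
    (Complex.continuous_ofReal.comp_continuousOn cψ).mul ce
  have c2 : ContinuousOn (fun x => e x * ((ψ' x : ℂ) / (Complex.I * φ' x))) (Icc a b) := by
    refine ce.mul (ContinuousOn.div (Complex.continuous_ofReal.comp_continuousOn hcψ)
      (continuousOn_const.mul (Complex.continuous_ofReal.comp_continuousOn cφ')) ?_)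
    exact fun x hx => mul_ne_zero Complex.I_ne_zero (hneC x hx)
  have c3 : ContinuousOn (fun x => e x * ((ψ x : ℂ) * φ'' x / (Complex.I * (φ' x) ^ 2)))
      (Icc a b) := by
    refine ce.mul (ContinuousOn.div ((Complex.continuous_ofReal.comp_continuousOn cψ).mul
      (Complex.continuous_ofReal.comp_continuousOn hcφ))
      (continuousOn_const.mul ((Complex.continuous_ofReal.comp_continuousOn cφ').pow 2)) ?_)
    exact fun x hx => mul_ne_zero Complex.I_ne_zero (pow_ne_zero _ (hneC x hx))
  rw [← uIcc_of_le hab] at c1 c2 c3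
  have i1 := c1.intervalIntegrable (μ := volume)
  have i2 := c2.intervalIntegrable (μ := volume)
  have i3 := c3.intervalIntegrable (μ := volume)
  have ftc := intervalIntegral.integral_eq_sub_of_hasDerivAt
    (fun x hx => key x (by rwa [uIcc_of_le hab] at hx)) (i1.add (i2.sub i3))
  rw [intervalIntegral.integral_add i1 (i2.sub i3), intervalIntegral.integral_sub i2 i3] at ftc
  have hbd : ∀ x ∈ Icc a b, ‖(ψ x : ℂ) * e x / (Complex.I * φ' x)‖ ≤ M / l := by
    intro x hx
    rw [norm_div, norm_mul, norm_mul, hnorm, Complex.norm_I, one_mul, mul_one,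
      Complex.norm_real, Complex.norm_real]
    exact div_le_div₀ hM0 (hM x hx) hl (hlow x hx)
  have b2 : ‖∫ x in a..b, e x * ((ψ' x : ℂ) / (Complex.I * φ' x))‖ ≤ D / l * (b - a) := by
    have := intervalIntegral.norm_integral_le_of_norm_le_const (a := a) (b := b) (C := D / l)
      (f := fun x => e x * ((ψ' x : ℂ) / (Complex.I * φ' x))) ?_
    · rwa [abs_of_nonneg (sub_nonneg.2 hab)] at this
    · intro x hx
      rw [uIoc_of_le hab] at hx
      have hx' := Ioc_subset_Icc_self hx
      rw [norm_mul, hnorm, one_mul, norm_div, norm_mul, Complex.norm_I, one_mul,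
        Complex.norm_real, Complex.norm_real]
      exact div_le_div₀ hD0 (hD x hx') hl (hlow x hx')
  -- Since `φ'' ≥ 0`, the absolute value of `φ'' / φ'²` is the exact derivative of `-1/φ'`, so its
  -- integral is at most `2 / l` whatever the length of the interval.
  have b3 : ‖∫ x in a..b, e x * ((ψ x : ℂ) * φ'' x / (Complex.I * (φ' x) ^ 2))‖ ≤ 2 * M / l := by
    have c4 : ContinuousOn (fun x => φ'' x / (φ' x) ^ 2) (uIcc a b) := by
      rw [uIcc_of_le hab]
      exact hcφ.div (cφ'.pow 2) fun x hx => pow_ne_zero _ (hne x hx)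
    have i4 := c4.intervalIntegrable (μ := volume)
    have ftc2 : ∫ x in a..b, φ'' x / (φ' x) ^ 2 = -(φ' b)⁻¹ - -(φ' a)⁻¹ := by
      refine intervalIntegral.integral_eq_sub_of_hasDerivAt (f := fun x => -(φ' x)⁻¹)
        (fun x hx => ?_) i4
      rw [uIcc_of_le hab] at hx
      refine ((hφ' x hx).inv (hne x hx)).neg.congr_deriv ?_
      ring
    calc _ ≤ ∫ x in a..b, M * (φ'' x / (φ' x) ^ 2) := by
          refine intervalIntegral.norm_integral_le_of_norm_le hab ?_ (i4.const_mul _)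
          refine Eventually.of_forall fun x hx => ?_
          have hx' := Ioc_subset_Icc_self hx
          rw [norm_mul, hnorm, one_mul, norm_div, norm_mul, norm_mul, Complex.norm_I, one_mul,
            Complex.norm_real, Complex.norm_real, norm_pow, Complex.norm_real, mul_div_assoc,
            Real.norm_of_nonneg (hpos x hx'), Real.norm_eq_abs (φ' x), sq_abs]
          exact mul_le_mul_of_nonneg_right (hM x hx') (div_nonneg (hpos x hx') (sq_nonneg _))
      _ = M * (-(φ' b)⁻¹ - -(φ' a)⁻¹) := by rw [intervalIntegral.integral_const_mul, ftc2]
      _ ≤ M * (1 / l + 1 / l) := by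
          refine mul_le_mul_of_nonneg_left ?_ hM0
          have hh : ∀ x ∈ Icc a b, |(φ' x)⁻¹| ≤ 1 / l := fun x hx => by
            rw [abs_inv, ← one_div]; exact one_div_le_one_div_of_le hl (hlow x hx)
          have h1 := neg_le_of_abs_le (hh b ⟨hab, le_rfl⟩)
          have h2 := le_of_abs_le (hh a ⟨le_rfl, hab⟩)
          linarith
      _ = 2 * M / l := by ring
  have hfin : (∫ x in a..b, (ψ x : ℂ) * e x) = ((ψ b : ℂ) * e b / (Complex.I * φ' b) -
      (ψ a : ℂ) * e a / (Complex.I * φ' a)) - (∫ x in a..b, e x * ((ψ' x : ℂ) / (Complex.I * φ' x)))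
      + ∫ x in a..b, e x * ((ψ x : ℂ) * φ'' x / (Complex.I * (φ' x) ^ 2)) := by
    rw [← ftc]; ring
  rw [hfin]
  refine (norm_add_le _ _).trans ?_
  have t1 := norm_sub_le ((ψ b : ℂ) * e b / (Complex.I * φ' b) -
      (ψ a : ℂ) * e a / (Complex.I * φ' a)) (∫ x in a..b, e x * ((ψ' x : ℂ) / (Complex.I * φ' x)))
  have t2 := norm_sub_le ((ψ b : ℂ) * e b / (Complex.I * φ' b))
    ((ψ a : ℂ) * e a / (Complex.I * φ' a))
  have h1 := hbd b ⟨hab, le_rfl⟩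
  have h2 := hbd a ⟨le_rfl, hab⟩
  have : (4 * M + D * (b - a)) / l = M / l + M / l + D / l * (b - a) + 2 * M / l := by ring
  rw [this]
  linarith

/-- The second derivative test for the phase `X x + Y x³` on a positive interval. -/
theorem norm_integral_mul_cexp_cubic_le {α β X Y M D : ℝ} (hα : 0 < α) (hαβ : α ≤ β) (hY : 0 < Y)
    {ψ ψ' : ℝ → ℝ} (hψ : ∀ x ∈ Icc α β, HasDerivAt ψ (ψ' x) x) (hcψ : ContinuousOn ψ' (Icc α β))
    (hM : ∀ x ∈ Icc α β, |ψ x| ≤ M) (hD : ∀ x ∈ Icc α β, |ψ' x| ≤ D) :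
    ‖∫ x in α..β, (ψ x : ℂ) * Complex.exp (Complex.I * ((X * x + Y * x ^ 3 : ℝ) : ℂ))‖ ≤
      (10 * M + 2 * D * (β - α)) / √(3 * Y * α) := by
  set μ := 3 * Y * α with hμ
  have hμ0 : 0 < μ := by positivity
  set s := √μ with hs
  have hs0 : 0 < s := Real.sqrt_pos.2 hμ0
  have hss : s * s = μ := Real.mul_self_sqrt hμ0.le
  -- The radius of the window removed around the stationary point: outside it `|φ'| ≥ 3Y · r · α =
  -- s`, and inside the trivial bound `2 r M` has the same order `M / s`.
  set r := 1 / s with hr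
  have hr0 : 0 < r := by positivity
  have hμr : μ * r = s := by rw [hr, ← hss]; field_simp
  have hM0 : 0 ≤ M := (abs_nonneg _).trans (hM α ⟨le_rfl, hαβ⟩)
  have hD0 : 0 ≤ D := (abs_nonneg _).trans (hD α ⟨le_rfl, hαβ⟩)
  -- The stationary point. For `X ≥ 0` the square root is `0` by convention, and the lower bound on
  -- the derivative to the right of `x₀ + r` still holds.
  set x₀ := √(-X / (3 * Y)) with hx₀
  have hx₀0 : 0 ≤ x₀ := Real.sqrt_nonneg _
  have hup : ∀ x, α ≤ x → x₀ + r ≤ x → s ≤ X + Y * (3 * x ^ 2) := by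
    intro x hx hxr
    have h1 : -X / (3 * Y) ≤ x₀ ^ 2 := by
      rcases le_total 0 (-X / (3 * Y)) with h | h
      · rw [hx₀, Real.sq_sqrt h]
      · exact h.trans (sq_nonneg _)
    rw [div_le_iff₀ (by positivity)] at h1
    have h2 : r * α ≤ (x - x₀) * (x + x₀) :=
      mul_le_mul (by linarith) (by linarith) hα.le (by linarith)
    have h3 : 3 * Y * (r * α) ≤ 3 * Y * ((x - x₀) * (x + x₀)) :=
      mul_le_mul_of_nonneg_left h2 (by positivity)
    have h4 : 3 * Y * (r * α) = s := by rw [← hμr, hμ]; ring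
    nlinarith
  have hdown : ∀ x, α ≤ x → x ≤ x₀ - r → X + Y * (3 * x ^ 2) ≤ -s := by
    intro x hx hxr
    have hx₀pos : 0 < x₀ := by linarith
    have h1 : x₀ ^ 2 = -X / (3 * Y) := by
      rw [hx₀, Real.sq_sqrt (Real.sqrt_pos.1 hx₀pos).le]
    rw [eq_div_iff (by positivity)] at h1
    have h2 : r * α ≤ (x₀ - x) * (x₀ + x) :=
      mul_le_mul (by linarith) (by linarith) hα.le (by linarith)
    have h3 : 3 * Y * (r * α) ≤ 3 * Y * ((x₀ - x) * (x₀ + x)) :=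
      mul_le_mul_of_nonneg_left h2 (by positivity)
    have h4 : 3 * Y * (r * α) = s := by rw [← hμr, hμ]; ring
    nlinarith
  have outer : ∀ c d, α ≤ c → c ≤ d → d ≤ β →
      (∀ x ∈ Icc c d, s ≤ |X + Y * (3 * x ^ 2)|) →
      ‖∫ x in c..d, (ψ x : ℂ) * Complex.exp (Complex.I * ((X * x + Y * x ^ 3 : ℝ) : ℂ))‖ ≤
        (4 * M + D * (β - α)) / s := by
    intro c d hc hcd hd hlow
    have hsub : Icc c d ⊆ Icc α β := Icc_subset_Icc hc hd
    refine (norm_integral_mul_cexp_le_of_le_deriv hcd hs0 (φ := fun x => X * x + Y * x ^ 3)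
      (φ' := fun x => X + Y * (3 * x ^ 2)) (φ'' := fun x => Y * (3 * (2 * x)))
      (fun x _ => ?_) (fun x _ => ?_) (fun x hx => hψ x (hsub hx)) (by fun_prop)
      (hcψ.mono hsub) (fun x hx => ?_) hlow (fun x hx => hM x (hsub hx))
      (fun x hx => hD x (hsub hx))).trans ?_
    · have := ((hasDerivAt_id x).const_mul X).add ((hasDerivAt_pow 3 x).const_mul Y)
      refine this.congr_deriv ?_
      norm_num
    · have := (((hasDerivAt_pow 2 x).const_mul 3).const_mul Y).const_add X
      refine this.congr_deriv ?_
      norm_num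
    · have : 0 ≤ x := hα.le.trans (hc.trans hx.1)
      positivity
    · gcongr
  -- Clamping the ends of the window to `[α, β]` covers every position of `x₀`; an outer piece may
  -- be empty.
  set c := max α (min β (x₀ - r)) with hc
  set d := max α (min β (x₀ + r)) with hd
  have hcα : α ≤ c := le_max_left _ _
  have hcd : c ≤ d := max_le_max_left _ (min_le_min_left _ (by linarith))
  have hdβ : d ≤ β := max_le hαβ (min_le_left _ _)
  have hdc : d - c ≤ 2 * r := by
    have h1 : d ≤ max α (min β (x₀ - r) + 2 * r) := by
      refine max_le_max_left _ ?_
      rcases min_cases β (x₀ - r) with h | h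
      · rw [h.1]; exact (min_le_left _ _).trans (by linarith)
      · rw [h.1]; exact (min_le_right _ _).trans (by linarith)
    have h2 : max α (min β (x₀ - r) + 2 * r) ≤ c + 2 * r :=
      max_le (by linarith) (by linarith [le_max_right α (min β (x₀ - r))])
    linarith
  set f : ℝ → ℂ := fun x => (ψ x : ℂ) * Complex.exp (Complex.I * ((X * x + Y * x ^ 3 : ℝ) : ℂ))
  have cf : ContinuousOn f (Icc α β) := by
    have cψ : ContinuousOn ψ (Icc α β) := fun x hx => (hψ x hx).continuousAt.continuousWithinAt
    refine (Complex.continuous_ofReal.comp_continuousOn cψ).mul (Continuous.continuousOn ?_)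
    fun_prop
  have int : ∀ u v, α ≤ u → u ≤ v → v ≤ β → IntervalIntegrable f volume u v := fun u v hu huv hv =>
    (cf.mono (by rw [uIcc_of_le huv]; exact Icc_subset_Icc hu hv)).intervalIntegrable
  have hsplit : ∫ x in α..β, f x = (∫ x in α..c, f x) + (∫ x in c..d, f x) + ∫ x in d..β, f x := by
    rw [intervalIntegral.integral_add_adjacent_intervals (int _ _ le_rfl hcα (hcd.trans hdβ))
      (int _ _ hcα hcd hdβ), intervalIntegral.integral_add_adjacent_intervals
      (int _ _ le_rfl (hcα.trans hcd) hdβ) (int _ _ (hcα.trans hcd) hdβ le_rfl)]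
  have b1 : ‖∫ x in α..c, f x‖ ≤ (4 * M + D * (β - α)) / s := by
    rcases hcα.eq_or_lt with h | h
    · rw [← h, intervalIntegral.integral_same, norm_zero]
      exact div_nonneg (by nlinarith) hs0.le
    · refine outer _ _ le_rfl hcα (hcd.trans hdβ) fun x hx => ?_
      have hx2 : x ≤ x₀ - r := by
        have : α < min β (x₀ - r) := by
          by_contra hh
          exact absurd (max_eq_left (not_lt.1 hh)) h.ne'
        refine hx.2.trans ?_
        rw [hc, max_eq_right this.le]
        exact min_le_right _ _
      have := hdown x hx.1 hx2
      rw [abs_of_neg (by linarith)]; linarith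
  have b3 : ‖∫ x in d..β, f x‖ ≤ (4 * M + D * (β - α)) / s := by
    rcases hdβ.eq_or_lt with h | h
    · rw [h, intervalIntegral.integral_same, norm_zero]
      exact div_nonneg (by nlinarith) hs0.le
    · refine outer _ _ (hcα.trans hcd) hdβ le_rfl fun x hx => ?_
      have hx2 : x₀ + r ≤ x := by
        refine le_trans ?_ hx.1
        have : x₀ + r < β := by
          by_contra hh
          rw [not_lt] at hh
          rw [hd, min_eq_left hh, max_eq_right hαβ] at h
          exact lt_irrefl _ h
        rw [hd, min_eq_right this.le]
        exact le_max_right _ _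
      have := hup x (hcα.trans (hcd.trans hx.1)) hx2
      exact this.trans (le_abs_self _)
  have b2 : ‖∫ x in c..d, f x‖ ≤ M * (2 * r) := by
    refine (intervalIntegral.norm_integral_le_of_norm_le_const (C := M) fun x hx => ?_).trans ?_
    · rw [uIoc_of_le hcd] at hx
      have hx' : x ∈ Icc α β := ⟨hcα.trans hx.1.le, hx.2.trans hdβ⟩
      rw [norm_mul, mul_comm Complex.I, Complex.norm_exp_ofReal_mul_I, mul_one, Complex.norm_real]
      exact hM x hx'
    · rw [abs_of_nonneg (sub_nonneg.2 hcd)]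
      exact mul_le_mul_of_nonneg_left hdc hM0
  rw [hsplit]
  have t1 := norm_add_le ((∫ x in α..c, f x) + (∫ x in c..d, f x)) (∫ x in d..β, f x)
  have t2 := norm_add_le (∫ x in α..c, f x) (∫ x in c..d, f x)
  have : (10 * M + 2 * D * (β - α)) / s =
      (4 * M + D * (β - α)) / s + M * (2 * r) + (4 * M + D * (β - α)) / s := by
    rw [hr]; ring
  rw [this]
  linarith

/-! ### The dispersive estimate for one dyadic range of frequencies. -/

/-- The dispersion relation `ξ³ + η² / ξ`. -/
noncomputable def omega (ζ : Plane) : ℝ := xi ζ ^ 3 + eta ζ ^ 2 / xi ζ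

/-- The lower end of the `k`-th dyadic range of frequencies. -/
noncomputable def dyadicLow (k : ℕ) : ℝ := if k = 0 then 0 else 2 ^ k / 2

/-- The `k`-th dyadic range of frequencies in `x`. -/
def piece (k : ℕ) : Set Plane := {ζ | 0 < |ζ 0| ∧ dyadicLow k ≤ |ζ 0| ∧ |ζ 0| < 2 ^ k}

open Classical in
/-- A dyadic cutoff in `ξ` with a Gaussian factor in `η`. -/
noncomputable def weight (δ : ℝ) (k : ℕ) (ζ : Plane) : ℝ :=
  if ζ ∈ piece k then Real.exp (-(Real.pi * δ * ζ 1 ^ 2 / |ζ 0|)) else 0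

theorem dyadicLow_nonneg (k : ℕ) : 0 ≤ dyadicLow k := by
  unfold dyadicLow; split_ifs <;> positivity

theorem dyadicLow_le (k : ℕ) : dyadicLow k ≤ 2 ^ k := by
  unfold dyadicLow; split_ifs
  · positivity
  · have : (0 : ℝ) < 2 ^ k := by positivity
    linarith

/-- Both the Gaussian factor and the phase are quadratic in `y` with coefficient proportional to
`1/x`, so they merge into one complex Gaussian with parameter `b = 2π(δ - i t)/x`. As `1/b` is
linear in `x`, the result is `√x` times an exponential linear in `x`. This is the reason for
dividing by `|ζ 0|` in `weight`: the cubic phase keeps its shape. -/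
theorem integral_gaussian_slice {x δ : ℝ} (hx : 0 < x) (hδ : 0 < δ) (t p : ℝ) :
    ∫ y : ℝ, (Real.exp (-(2 * Real.pi * δ * y ^ 2 / x)) : ℂ) *
        Complex.exp (Complex.I * ((2 * Real.pi * p * y
          + t * ((2 * Real.pi * y) ^ 2 / (2 * Real.pi * x)) : ℝ) : ℂ)) =
      (√x : ℂ) * (1 / (2 * ((δ : ℂ) - Complex.I * t))) ^ (1 / 2 : ℂ) *
        ((Real.exp (-(Real.pi * p ^ 2 * δ / (2 * (δ ^ 2 + t ^ 2)) * x)) : ℂ) *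
        Complex.exp (Complex.I * ((-(Real.pi * p ^ 2 * t / (2 * (δ ^ 2 + t ^ 2)) * x) : ℝ) : ℂ))) := by
  have hπ := Real.pi_pos
  have hxC : (x : ℂ) ≠ 0 := by exact_mod_cast hx.ne'
  have hπC : (Real.pi : ℂ) ≠ 0 := by exact_mod_cast hπ.ne'
  have hd : (δ : ℂ) - Complex.I * t ≠ 0 := by
    intro h
    have := congrArg Complex.re h
    simp at this
    exact hδ.ne' this
  have hsum : δ ^ 2 + t ^ 2 ≠ 0 := by positivity
  have hsumC : (δ : ℂ) ^ 2 + (t : ℂ) ^ 2 ≠ 0 := by exact_mod_cast hsum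
  have hprod : ((δ : ℂ) - Complex.I * t) * (δ + Complex.I * t) = δ ^ 2 + t ^ 2 := by
    ring_nf; rw [Complex.I_sq]; ring
  set b : ℂ := 2 * Real.pi * (δ - Complex.I * t) / x with hb
  have hbre : 0 < b.re := by
    have : b = ((2 * Real.pi * δ / x : ℝ) : ℂ) + ((-(2 * Real.pi * t / x) : ℝ) : ℂ) * Complex.I := by
      rw [hb]; push_cast; field_simp; ring
    rw [this]
    simp only [Complex.add_re, Complex.ofReal_re, Complex.re_ofReal_mul, Complex.I_re, mul_zero,
      add_zero]
    positivity
  have h1 := fourierIntegral_gaussian hbre (2 * Real.pi * p)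
  have e1 : (∫ y : ℝ, (Real.exp (-(2 * Real.pi * δ * y ^ 2 / x)) : ℂ) *
        Complex.exp (Complex.I * ((2 * Real.pi * p * y
          + t * ((2 * Real.pi * y) ^ 2 / (2 * Real.pi * x)) : ℝ) : ℂ))) =
      ∫ y : ℝ, Complex.exp (Complex.I * (2 * Real.pi * p) * y) * Complex.exp (-b * y ^ 2) := by
    congr 1; funext y
    rw [Complex.ofReal_exp, ← Complex.exp_add, ← Complex.exp_add]
    congr 1
    rw [hb]; push_cast; field_simp; ring
  rw [e1, h1]
  congr 1
  · have : (Real.pi : ℂ) / b = (x : ℝ) * (1 / (2 * ((δ : ℂ) - Complex.I * t))) := by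
      rw [hb]; field_simp
    have hne : (1 / (2 * ((δ : ℂ) - Complex.I * t))) ≠ 0 := by
      apply one_div_ne_zero; exact mul_ne_zero two_ne_zero hd
    rw [this, Complex.cpow_def_of_ne_zero (mul_ne_zero hxC hne), Complex.log_ofReal_mul hx hne,
      add_mul, Complex.exp_add, ← Complex.cpow_def_of_ne_zero hne, Real.sqrt_eq_rpow,
      Complex.ofReal_cpow hx.le, Complex.cpow_def_of_ne_zero hxC, Complex.ofReal_log hx.le]
    norm_num
  · rw [Complex.ofReal_exp, ← Complex.exp_add]
    congr 1
    rw [hb]; push_cast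
    have : (4 * (2 * (Real.pi : ℂ) * (δ - Complex.I * t) / x)) ≠ 0 := by
      apply mul_ne_zero (by norm_num); apply div_ne_zero _ hxC
      exact mul_ne_zero (mul_ne_zero two_ne_zero hπC) hd
    rw [div_eq_iff this]
    field_simp
    linear_combination (4 * (p : ℂ) ^ 2) * hprod

/-- Bounds for the one-dimensional oscillatory integral with amplitude `√x exp (-P x)`. -/
theorem norm_integral_sqrt_le (k : ℕ) {P X Y : ℝ} (hP : 0 ≤ P) :
    ‖∫ x in (dyadicLow k)..(2 ^ k), ((√x * Real.exp (-(P * x)) : ℝ) : ℂ) *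
      Complex.exp (Complex.I * ((X * x + Y * x ^ 3 : ℝ) : ℂ))‖ ≤ 2 ^ k * √(2 ^ k) := by
  have h0 := dyadicLow_nonneg k
  refine (intervalIntegral.norm_integral_le_of_norm_le_const (C := √(2 ^ k)) fun x hx => ?_).trans ?_
  · rw [uIoc_of_le (dyadicLow_le k)] at hx
    have hx0 : 0 ≤ x := h0.trans hx.1.le
    rw [norm_mul, mul_comm Complex.I, Complex.norm_exp_ofReal_mul_I, mul_one, Complex.norm_real,
      Real.norm_of_nonneg (by positivity)]
    calc √x * Real.exp (-(P * x)) ≤ √(2 ^ k) * 1 := by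
          refine mul_le_mul (Real.sqrt_le_sqrt hx.2) ?_ (Real.exp_pos _).le (Real.sqrt_nonneg _)
          exact Real.exp_le_one_iff.2 (by have := mul_nonneg hP hx0; linarith)
      _ = _ := mul_one _
  · rw [abs_of_nonneg (sub_nonneg.2 (dyadicLow_le k)), mul_comm]
    gcongr
    linarith

/-- On `[β/2, β]` the amplitude is at most `√β` and its derivative `(1/2 - P x) exp (-P x) / √x` is
at most `(3/2) / √(β/2)`, uniformly in `P` because `u exp (-u) ≤ 1`. The second derivative test
divides by `√(3 Y β/2)`, so all powers of `β` cancel. -/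
theorem norm_integral_sqrt_le' {k : ℕ} (hk : k ≠ 0) {P X Y : ℝ} (hP : 0 ≤ P) (hY : 0 < Y) :
    ‖∫ x in (dyadicLow k)..(2 ^ k), ((√x * Real.exp (-(P * x)) : ℝ) : ℂ) *
      Complex.exp (Complex.I * ((X * x + Y * x ^ 3 : ℝ) : ℂ))‖ ≤ 13 / √Y := by
  set β : ℝ := 2 ^ k with hβ
  have hβ0 : 0 < β := by positivity
  have hlow : dyadicLow k = β / 2 := by simp [dyadicLow, hk, hβ]
  rw [hlow]
  have h2 : 0 < β / 2 := by positivity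
  have hsq : ∀ x ∈ Icc (β / 2) β, √(β / 2) ≤ √x := fun x hx => Real.sqrt_le_sqrt hx.1
  have hs0 : 0 < √(β / 2) := Real.sqrt_pos.2 h2
  have hE : ∀ x, β / 2 ≤ x → P * x * Real.exp (-(P * x)) ≤ 1 := fun x hx => by
    have h3 := Real.add_one_le_exp (P * x)
    rw [Real.exp_neg, ← div_eq_mul_inv, div_le_one (Real.exp_pos _)]
    linarith
  have hE1 : ∀ x, β / 2 ≤ x → Real.exp (-(P * x)) ≤ 1 := fun x hx =>
    Real.exp_le_one_iff.2 (by have := mul_nonneg hP (h2.le.trans hx); linarith)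
  have main := norm_integral_mul_cexp_cubic_le (X := X) (M := √β) (D := 3 / 2 / √(β / 2))
    h2 (by linarith : β / 2 ≤ β) hY (ψ := fun x => √x * Real.exp (-(P * x)))
    (ψ' := fun x => 1 / (2 * √x) * Real.exp (-(P * x)) + √x * (Real.exp (-(P * x)) * (-P)))
    (fun x hx => ?_) ?_ (fun x hx => ?_) (fun x hx => ?_)
  · refine main.trans ?_
    have hβs : √β = √2 * √(β / 2) := by
      rw [← Real.sqrt_mul (by norm_num)]; congr 1; ring
    have hss : √(β / 2) * √(β / 2) = β / 2 := Real.mul_self_sqrt h2.le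
    have h22 : √2 ≤ 3 / 2 := by
      rw [Real.sqrt_le_left (by norm_num)]; norm_num
    have hnum : 10 * √β + 2 * (3 / 2 / √(β / 2)) * (β - β / 2) ≤ 18 * √(β / 2) := by
      have : 2 * (3 / 2 / √(β / 2)) * (β - β / 2) = 3 * √(β / 2) := by
        have : β - β / 2 = √(β / 2) * √(β / 2) := by rw [hss]; ring
        rw [this]; field_simp
      rw [this, hβs]
      nlinarith
    have h3 : 1.5 ≤ √3 := Real.le_sqrt_of_sq_le (by norm_num)
    rw [Real.sqrt_mul (by positivity), Real.sqrt_mul (by norm_num)]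
    have hYs : 0 < √Y := Real.sqrt_pos.2 hY
    rw [div_le_div_iff₀ (by positivity) hYs]
    calc _ ≤ 18 * √(β / 2) * √Y := by gcongr
      _ ≤ 13 * (√3 * √Y * √(β / 2)) := by
        have : 0 < √(β / 2) * √Y := by positivity
        nlinarith
  · have hx0 : 0 < x := h2.trans_le hx.1
    have h4 := (((hasDerivAt_id x).const_mul P).neg).exp
    refine ((Real.hasDerivAt_sqrt hx0.ne').mul h4).congr_deriv ?_
    simp
  · have hx0 : ∀ x ∈ Icc (β / 2) β, 2 * √x ≠ 0 := fun x hx => by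
      have := hs0.trans_le (hsq x hx); positivity
    have : ContinuousOn (fun x => 1 / (2 * √x)) (Icc (β / 2) β) :=
      continuousOn_const.div (by fun_prop) hx0
    exact (this.mul (by fun_prop)).add (by fun_prop)
  · have hx0 : 0 < x := h2.trans_le hx.1
    rw [abs_of_nonneg (by positivity)]
    calc √x * Real.exp (-(P * x)) ≤ √β * 1 :=
          mul_le_mul (Real.sqrt_le_sqrt hx.2) (hE1 x hx.1) (Real.exp_pos _).le (Real.sqrt_nonneg _)
      _ = _ := mul_one _
  · have hx0 : 0 < x := h2.trans_le hx.1
    have hsx : 0 < √x := Real.sqrt_pos.2 hx0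
    have hxx : √x * √x = x := Real.mul_self_sqrt hx0.le
    have e1 : 1 / (2 * √x) * Real.exp (-(P * x)) + √x * (Real.exp (-(P * x)) * (-P)) =
        (1 / 2 * Real.exp (-(P * x)) - P * x * Real.exp (-(P * x))) / √x := by
      rw [eq_div_iff hsx.ne']
      field_simp
      nlinarith [hxx]
    rw [e1, abs_div, abs_of_pos hsx]
    refine div_le_div₀ (by norm_num) ?_ hs0 (hsq x hx)
    have h5 := hE x hx.1
    have h6 := hE1 x hx.1
    have h7 : 0 ≤ P * x * Real.exp (-(P * x)) := by positivity
    have h8 := (Real.exp_pos (-(P * x))).le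
    rw [abs_le]; constructor <;> linarith

/-- Complex conjugation reverses the signs of `X` and `Y`, which reduces negative `Y` to positive
`Y`. -/
theorem norm_integral_sqrt_le_of_ne_zero {k : ℕ} (hk : k ≠ 0) {P X Y : ℝ} (hP : 0 ≤ P)
    (hY : Y ≠ 0) :
    ‖∫ x in (dyadicLow k)..(2 ^ k), ((√x * Real.exp (-(P * x)) : ℝ) : ℂ) *
      Complex.exp (Complex.I * ((X * x + Y * x ^ 3 : ℝ) : ℂ))‖ ≤ 13 / √|Y| := by
  rcases hY.lt_or_gt with h | h
  · have := norm_integral_sqrt_le' hk (X := -X) hP (neg_pos.2 h)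
    rw [abs_of_neg h]
    rw [← Complex.norm_conj] at this
    convert this using 2
    rw [intervalIntegral.integral_of_le (dyadicLow_le k),
      intervalIntegral.integral_of_le (dyadicLow_le k), ← integral_conj]
    congr 1; funext x
    rw [map_mul, Complex.conj_ofReal, ← Complex.exp_conj, map_mul, Complex.conj_I,
      Complex.conj_ofReal]
    congr 2
    push_cast; ring
  · rw [abs_of_pos h]; exact norm_integral_sqrt_le' hk hP h

theorem le_rpow_mul_rpow {x a b θ : ℝ} (hx : 0 ≤ x) (ha : x ≤ a) (hb : x ≤ b) (h0 : 0 ≤ θ)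
    (h1 : θ ≤ 1) : x ≤ a ^ θ * b ^ (1 - θ) := by
  rcases hx.eq_or_lt with h | h
  · rw [← h]; have := h.trans_le ha; have := h.trans_le hb; positivity
  · calc x = x ^ θ * x ^ (1 - θ) := by rw [← Real.rpow_add h]; simp
      _ ≤ _ := mul_le_mul (Real.rpow_le_rpow hx ha h0) (Real.rpow_le_rpow hx hb (by linarith))
        (by positivity) (Real.rpow_nonneg (hx.trans ha) _)

/-- The dispersive estimate on one half of a dyadic range, after integrating out `η`. -/
theorem norm_integral_slice_le (k : ℕ) {δ t θ : ℝ} (hδ : 0 < δ) (ht : t ≠ 0) (ht1 : |t| ≤ 1)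
    (h0 : 0 ≤ θ) (h1 : θ ≤ 1) (p q : ℝ) :
    ‖∫ x in (dyadicLow k)..(2 ^ k),
        Complex.exp (Complex.I * ((2 * Real.pi * p * x + t * (2 * Real.pi * x) ^ 3 : ℝ) : ℂ)) *
        ∫ y : ℝ, (Real.exp (-(2 * Real.pi * δ * y ^ 2 / x)) : ℂ) *
        Complex.exp (Complex.I * ((2 * Real.pi * q * y
          + t * ((2 * Real.pi * y) ^ 2 / (2 * Real.pi * x)) : ℝ) : ℂ))‖ ≤
      ((2 : ℝ) ^ k) ^ (3 * θ / 2) * |t| ^ (-1 + θ / 2) := by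
  set P := Real.pi * q ^ 2 * δ / (2 * (δ ^ 2 + t ^ 2)) with hP
  set Q := Real.pi * q ^ 2 * t / (2 * (δ ^ 2 + t ^ 2)) with hQ
  set A : ℂ := (1 / (2 * ((δ : ℂ) - Complex.I * t))) ^ (1 / 2 : ℂ) with hA
  have hπ := Real.pi_pos
  have hP0 : 0 ≤ P := by positivity
  have htp : 0 < |t| := abs_pos.2 ht
  set X := 2 * Real.pi * p - Q with hX
  set Y := t * (2 * Real.pi) ^ 3 with hY
  have hYne : Y ≠ 0 := mul_ne_zero ht (by positivity)
  have e1 : (∫ x in (dyadicLow k)..(2 ^ k),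
        Complex.exp (Complex.I * ((2 * Real.pi * p * x + t * (2 * Real.pi * x) ^ 3 : ℝ) : ℂ)) *
        ∫ y : ℝ, (Real.exp (-(2 * Real.pi * δ * y ^ 2 / x)) : ℂ) *
        Complex.exp (Complex.I * ((2 * Real.pi * q * y
          + t * ((2 * Real.pi * y) ^ 2 / (2 * Real.pi * x)) : ℝ) : ℂ))) =
      A * ∫ x in (dyadicLow k)..(2 ^ k), ((√x * Real.exp (-(P * x)) : ℝ) : ℂ) *
      Complex.exp (Complex.I * ((X * x + Y * x ^ 3 : ℝ) : ℂ)) := by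
    rw [← intervalIntegral.integral_const_mul]
    refine intervalIntegral.integral_congr_ae (Eventually.of_forall fun x hx => ?_)
    rw [uIoc_of_le (dyadicLow_le k)] at hx
    have hx0 : 0 < x := (dyadicLow_nonneg k).trans_lt hx.1
    rw [integral_gaussian_slice hx0 hδ]
    rw [← hP, ← hQ, ← hA]
    have : Complex.exp (Complex.I * ((X * x + Y * x ^ 3 : ℝ) : ℂ)) =
        Complex.exp (Complex.I * ((2 * Real.pi * p * x + t * (2 * Real.pi * x) ^ 3 : ℝ) : ℂ)) *
        Complex.exp (Complex.I * ((-(Q * x) : ℝ) : ℂ)) := by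
      rw [← Complex.exp_add]; congr 1; rw [hX, hY]; push_cast; ring
    rw [this]; push_cast; ring
  have hAn : ‖A‖ ≤ (2 * |t|) ^ (-(1 / 2) : ℝ) := by
    have hc : (1 / 2 : ℂ) = ((1 / 2 : ℝ) : ℂ) := by push_cast; rfl
    rw [hA, hc, Complex.norm_cpow_real, norm_div, norm_one, norm_mul, Complex.norm_ofNat, one_div,
      Real.inv_rpow (by positivity), Real.rpow_neg (by positivity)]
    have : |t| ≤ ‖(δ : ℂ) - Complex.I * t‖ := by
      have := Complex.abs_im_le_norm ((δ : ℂ) - Complex.I * t)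
      simpa using this
    gcongr
  set J := ‖∫ x in (dyadicLow k)..(2 ^ k), ((√x * Real.exp (-(P * x)) : ℝ) : ℂ) *
      Complex.exp (Complex.I * ((X * x + Y * x ^ 3 : ℝ) : ℂ))‖ with hJ
  rw [e1, norm_mul, ← hJ]
  have hJ0 : 0 ≤ J := norm_nonneg _
  have hβ : (1 : ℝ) ≤ 2 ^ k := one_le_pow₀ (by norm_num)
  have hA2 : (2 * |t|) ^ (-(1 / 2) : ℝ) ≤ |t| ^ (-(1 / 2) : ℝ) :=
    Real.rpow_le_rpow_of_nonpos htp (by linarith) (by norm_num)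
  have b1 : ‖A‖ * J ≤ ((2 : ℝ) ^ k) ^ (3 / 2 : ℝ) * |t| ^ (-(1 / 2) : ℝ) := by
    rw [mul_comm]
    refine mul_le_mul ?_ (hAn.trans hA2) (norm_nonneg _) (by positivity)
    refine (norm_integral_sqrt_le k hP0).trans (le_of_eq ?_)
    rw [Real.sqrt_eq_rpow, show (3 / 2 : ℝ) = 1 + 1 / 2 by norm_num,
      Real.rpow_add (by positivity), Real.rpow_one]
  -- For `k = 0` the range reaches `ξ = 0`, where the second derivative vanishes; there the trivial
  -- bound `|t|^(-1/2)` suffices because `|t| ≤ 1`.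
  have b2 : ‖A‖ * J ≤ |t| ^ (-1 : ℝ) := by
    by_cases hk : k = 0
    · refine b1.trans ?_
      rw [hk, pow_zero, Real.one_rpow, one_mul]
      exact Real.rpow_le_rpow_of_exponent_ge htp ht1 (by norm_num)
    · have hj := norm_integral_sqrt_le_of_ne_zero hk (X := X) hP0 hYne
      rw [← hJ] at hj
      -- `196 = 14²`, so `(2π)³` absorbs the constant `13` of the oscillatory bound.
      have hq : (196 : ℝ) * |t| ≤ |Y| := by
        rw [hY, abs_mul, abs_of_pos (by positivity : 0 < (2 * Real.pi) ^ 3), mul_comm]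
        have : (196 : ℝ) ≤ (2 * Real.pi) ^ 3 := by
          calc (196 : ℝ) ≤ 6 ^ 3 := by norm_num
            _ ≤ _ := by gcongr; linarith [Real.pi_gt_three]
        gcongr
      have hs : 14 * √|t| ≤ √|Y| := by
        have : √(196 * |t|) = 14 * √|t| := by
          rw [Real.sqrt_mul (by norm_num), show (196 : ℝ) = 14 ^ 2 by norm_num,
            Real.sqrt_sq (by norm_num)]
        rw [← this]; exact Real.sqrt_le_sqrt hq
      have hst : 0 < √|t| := Real.sqrt_pos.2 htp
      have hj2 : J ≤ |t| ^ (-(1 / 2) : ℝ) := by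
        refine hj.trans ?_
        rw [Real.rpow_neg htp.le, ← Real.sqrt_eq_rpow, ← one_div]
        rw [div_le_div_iff₀ (by linarith) hst]
        linarith
      calc ‖A‖ * J ≤ |t| ^ (-(1 / 2) : ℝ) * |t| ^ (-(1 / 2) : ℝ) :=
            mul_le_mul (hAn.trans hA2) hj2 hJ0 (by positivity)
        _ = _ := by rw [← Real.rpow_add htp]; norm_num
  -- Interpolation with weight `θ` on the trivial bound; any `θ > 0` makes the power of `|t|`
  -- integrable at `0`.
  refine (le_rpow_mul_rpow (by positivity) b1 b2 h0 h1).trans (le_of_eq ?_)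
  rw [Real.mul_rpow (by positivity) (by positivity), ← Real.rpow_mul (by positivity),
    ← Real.rpow_mul htp.le, ← Real.rpow_mul htp.le, mul_assoc, ← Real.rpow_add htp]
  congr 2 <;> ring

/-- The measurable equivalence `ζ ↦ (ζ 0, ζ 1)`. -/
noncomputable def coords : Plane ≃ᵐ ℝ × ℝ :=
  (MeasurableEquiv.toLp 2 (Fin 2 → ℝ)).symm.trans MeasurableEquiv.finTwoArrow

theorem coords_apply (ζ : Plane) : coords ζ = (ζ 0, ζ 1) := rfl

theorem measurePreserving_coords : MeasurePreserving coords volume volume :=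
  (EuclideanSpace.volume_preserving_symm_measurableEquiv_toLp (Fin 2)).trans
    (volume_preserving_finTwoArrow ℝ)

/-- The dyadic range of `x`-frequencies, as a set of real numbers. -/
def range1 (k : ℕ) : Set ℝ := {x | 0 < |x| ∧ dyadicLow k ≤ |x| ∧ |x| < 2 ^ k}

theorem measurableSet_range1 (k : ℕ) : MeasurableSet (range1 k) := by
  have h : Measurable fun x : ℝ => |x| := continuous_abs.measurable
  exact (measurableSet_lt measurable_const h).inter
    ((measurableSet_le measurable_const h).inter (measurableSet_lt h measurable_const))

theorem mem_piece_iff (k : ℕ) (ζ : Plane) : ζ ∈ piece k ↔ ζ 0 ∈ range1 k := Iff.rfl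

theorem measurableSet_piece (k : ℕ) : MeasurableSet (piece k) :=
  (measurableSet_range1 k).preimage (by fun_prop : Measurable fun ζ : Plane => ζ 0)

@[fun_prop]
theorem measurable_xi : Measurable xi := by unfold xi; fun_prop

@[fun_prop]
theorem measurable_eta : Measurable eta := by unfold eta; fun_prop

@[fun_prop]
theorem measurable_omega : Measurable omega := by unfold omega; fun_prop

@[fun_prop]
theorem measurable_weight (δ : ℝ) (k : ℕ) : Measurable (weight δ k) := by
  classical
  unfold weight
  exact Measurable.ite (measurableSet_piece k) (by fun_prop) measurable_const

theorem integrable_planar {k : ℕ} {c : ℝ} (hc : 0 < c) :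
    Integrable (fun z : ℝ × ℝ => (range1 k).indicator (fun _ => (1 : ℝ)) z.1 *
      Real.exp (-c * z.2 ^ 2)) (volume.prod volume) := by
  refine Integrable.mul_prod (f := (range1 k).indicator (fun _ => (1 : ℝ)))
    (g := fun y => Real.exp (-c * y ^ 2)) ?_ (integrable_exp_neg_mul_sq hc)
  rw [integrable_indicator_iff (measurableSet_range1 k)]
  refine integrableOn_const (ne_of_lt ?_)
  refine (measure_mono (t := Icc (-2 ^ k) (2 ^ k)) fun x hx => ?_).trans_lt measure_Icc_lt_top
  exact abs_le.1 hx.2.2.le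

/-- The oscillatory integrand on one vertical line. -/
noncomputable def sliceFun (k : ℕ) (δ t p q x y : ℝ) : ℂ :=
  (range1 k).indicator (fun x => (Real.exp (-(2 * Real.pi * δ * y ^ 2 / |x|)) : ℂ)) x *
    Complex.exp (Complex.I * ((2 * Real.pi * (p * x + q * y) + t * ((2 * Real.pi * x) ^ 3 +
      (2 * Real.pi * y) ^ 2 / (2 * Real.pi * x)) : ℝ) : ℂ))

/-- As `|x| < 2 ^ k` on the range, the Gaussian in `y` is dominated by one whose width does not
depend on `x`. -/
theorem integrable_sliceFun (k : ℕ) {δ : ℝ} (hδ : 0 < δ) (t p q : ℝ) :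
    Integrable (fun z : ℝ × ℝ => sliceFun k δ t p q z.1 z.2) (volume.prod volume) := by
  have hπ := Real.pi_pos
  have hc : 0 < 2 * Real.pi * δ / 2 ^ k := by positivity
  refine (integrable_planar (k := k) hc).mono' ?_ (Eventually.of_forall fun z => ?_)
  · refine Measurable.aestronglyMeasurable ?_
    unfold sliceFun
    refine Measurable.mul ?_ (by fun_prop)
    have : (fun z : ℝ × ℝ => (range1 k).indicator
        (fun x => (Real.exp (-(2 * Real.pi * δ * z.2 ^ 2 / |x|)) : ℂ)) z.1) =
        (Prod.fst ⁻¹' range1 k).indicator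
        fun z : ℝ × ℝ => (Real.exp (-(2 * Real.pi * δ * z.2 ^ 2 / |z.1|)) : ℂ) := by
      funext z; rfl
    rw [this]
    refine Measurable.indicator ?_ ((measurableSet_range1 k).preimage measurable_fst)
    have : Measurable fun x : ℝ => |x| := continuous_abs.measurable
    have h2 : Measurable fun z : ℝ × ℝ => |z.1| := this.comp measurable_fst
    fun_prop
  · unfold sliceFun
    rw [norm_mul, mul_comm Complex.I, Complex.norm_exp_ofReal_mul_I, mul_one]
    by_cases h : z.1 ∈ range1 k
    · rw [indicator_of_mem h, indicator_of_mem h, one_mul, Complex.norm_real,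
        Real.norm_of_nonneg (Real.exp_pos _).le, Real.exp_le_exp]
      have : 2 * Real.pi * δ * z.2 ^ 2 / 2 ^ k ≤ 2 * Real.pi * δ * z.2 ^ 2 / |z.1| :=
        div_le_div_of_nonneg_left (by positivity) h.1 h.2.2.le
      have e : -(2 * Real.pi * δ / 2 ^ k) * z.2 ^ 2 = -(2 * Real.pi * δ * z.2 ^ 2 / 2 ^ k) := by ring
      rw [e]; linarith
    · rw [indicator_of_notMem h, indicator_of_notMem h]; simp

theorem norm_integral_Ioi_slice_le (k : ℕ) {δ t θ : ℝ} (hδ : 0 < δ) (ht : t ≠ 0) (ht1 : |t| ≤ 1)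
    (h0 : 0 ≤ θ) (h1 : θ ≤ 1) (p q : ℝ) :
    ‖∫ x in Ioi (0 : ℝ), ∫ y, sliceFun k δ t p q x y‖ ≤
      ((2 : ℝ) ^ k) ^ (3 * θ / 2) * |t| ^ (-1 + θ / 2) := by
  refine le_trans (le_of_eq ?_) (norm_integral_slice_le k hδ ht ht1 h0 h1 p q)
  congr 1
  rw [intervalIntegral.integral_of_le (dyadicLow_le k)]
  set G : ℝ → ℂ := fun x =>
    Complex.exp (Complex.I * ((2 * Real.pi * p * x + t * (2 * Real.pi * x) ^ 3 : ℝ) : ℂ)) *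
        ∫ y : ℝ, (Real.exp (-(2 * Real.pi * δ * y ^ 2 / x)) : ℂ) *
        Complex.exp (Complex.I * ((2 * Real.pi * q * y
          + t * ((2 * Real.pi * y) ^ 2 / (2 * Real.pi * x)) : ℝ) : ℂ)) with hG
  have e1 : ∫ x in Ioi (0 : ℝ), ∫ y, sliceFun k δ t p q x y =
      ∫ x in Ioi (0 : ℝ), (Ico (dyadicLow k) (2 ^ k)).indicator G x := by
    refine setIntegral_congr_fun measurableSet_Ioi fun x hx => ?_
    have hx0 : 0 < x := hx
    by_cases h : x ∈ Ico (dyadicLow k) (2 ^ k)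
    · have h' : x ∈ range1 k := by
        refine ⟨abs_pos.2 hx0.ne', ?_⟩; rw [abs_of_pos hx0]; exact h
      rw [indicator_of_mem h, hG]
      simp only
      rw [← integral_const_mul]
      congr 1; funext y
      unfold sliceFun
      rw [indicator_of_mem h', abs_of_pos hx0]
      have : ∀ a b c : ℂ, a * (b * c) = b * (a * c) := fun a b c => by ring
      rw [this, ← Complex.exp_add]
      congr 2
      push_cast; ring
    · have h' : x ∉ range1 k := by
        intro h'; apply h; have := h'.2; rwa [abs_of_pos hx0] at this
      rw [indicator_of_notMem h]
      unfold sliceFun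
      simp [indicator_of_notMem h']
  rw [e1, setIntegral_indicator measurableSet_Ico]
  refine setIntegral_congr_set ?_
  have : Ioi (0 : ℝ) ∩ Ioc (dyadicLow k) (2 ^ k) = Ioc (dyadicLow k) (2 ^ k) :=
    inter_eq_right.2 fun x hx => (dyadicLow_nonneg k).trans_lt hx.1
  rw [← this]
  exact (ae_eq_refl (Ioi (0 : ℝ))).inter Ico_ae_eq_Ioc

/-- The dispersive estimate for the frequency-localized propagator. -/
theorem norm_kernel_le (k : ℕ) {δ t θ : ℝ} (hδ : 0 < δ) (ht : t ≠ 0) (ht1 : |t| ≤ 1)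
    (h0 : 0 ≤ θ) (h1 : θ ≤ 1) (z : Plane) :
    ‖∫ ζ : Plane, ((weight δ k ζ ^ 2 : ℝ) : ℂ) *
        Complex.exp (Complex.I * ((2 * Real.pi * (z 0 * ζ 0 + z 1 * ζ 1) + t * omega ζ : ℝ) : ℂ))‖ ≤
      2 * (((2 : ℝ) ^ k) ^ (3 * θ / 2) * |t| ^ (-1 + θ / 2)) := by
  have e1 : (∫ ζ : Plane, ((weight δ k ζ ^ 2 : ℝ) : ℂ) *
        Complex.exp (Complex.I * ((2 * Real.pi * (z 0 * ζ 0 + z 1 * ζ 1) + t * omega ζ : ℝ) : ℂ))) =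
      ∫ x, ∫ y, sliceFun k δ t (z 0) (z 1) x y := by
    rw [← integral_prod _ (integrable_sliceFun k hδ t (z 0) (z 1))]
    rw [← Measure.volume_eq_prod, ← measurePreserving_coords.integral_comp']
    congr 1; funext ζ
    rw [coords_apply]
    unfold sliceFun weight
    congr 1
    by_cases h : ζ ∈ piece k
    · rw [if_pos h, indicator_of_mem ((mem_piece_iff k ζ).1 h), ← Real.exp_nat_mul]
      congr 2; push_cast; ring
    · rw [if_neg h, indicator_of_notMem (fun h' => h ((mem_piece_iff k ζ).2 h'))]; simp
  have int := (integrable_sliceFun k hδ t (z 0) (z 1)).integral_prod_left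
  rw [e1, ← integral_add_compl measurableSet_Ioi int, compl_Ioi]
  -- `ω` is odd in `ξ`, so reflecting `x` amounts to changing the signs of `t` and `z 0`.
  have e2 : ∫ x in Iic (0 : ℝ), ∫ y, sliceFun k δ t (z 0) (z 1) x y =
      ∫ x in Ioi (0 : ℝ), ∫ y, sliceFun k δ (-t) (-z 0) (z 1) x y := by
    have := integral_comp_neg_Iic 0 fun x => ∫ y, sliceFun k δ (-t) (-z 0) (z 1) x y
    rw [neg_zero] at this
    rw [← this]
    congr 1; funext x; congr 1; funext y
    unfold sliceFun
    have h3 : (-x ∈ range1 k) = (x ∈ range1 k) := by simp [range1]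
    congr 1
    · by_cases h : x ∈ range1 k
      · rw [indicator_of_mem h, indicator_of_mem (h3 ▸ h), abs_neg]
      · rw [indicator_of_notMem h, indicator_of_notMem (h3 ▸ h)]
    · congr 3
      rw [mul_neg (2 * Real.pi) x, div_neg]
      ring
  rw [e2]
  refine (norm_add_le _ _).trans ?_
  have b1 := norm_integral_Ioi_slice_le k hδ ht ht1 h0 h1 (z 0) (z 1)
  have b2 := norm_integral_Ioi_slice_le k hδ (neg_ne_zero.2 ht) (by rwa [abs_neg]) h0 h1
    (-z 0) (z 1)
  rw [abs_neg] at b2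
  linarith

theorem integrable_weight_sq (k : ℕ) {δ : ℝ} (hδ : 0 < δ) :
    Integrable (fun ζ : Plane => weight δ k ζ ^ 2) := by
  have hπ := Real.pi_pos
  have h := (integrable_sliceFun k hδ 0 0 0).norm
  rw [← Measure.volume_eq_prod] at h
  rw [← measurePreserving_coords.integrable_comp_emb coords.measurableEmbedding] at h
  refine h.congr (Eventually.of_forall fun ζ => ?_)
  simp only [Function.comp]
  rw [coords_apply]
  unfold sliceFun weight
  rw [norm_mul, mul_comm Complex.I, Complex.norm_exp_ofReal_mul_I, mul_one]
  by_cases h : ζ ∈ piece k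
  · rw [if_pos h, indicator_of_mem ((mem_piece_iff k ζ).1 h), ← Real.exp_nat_mul,
      Complex.norm_real, Real.norm_of_nonneg (Real.exp_pos _).le]
    congr 1; push_cast; ring
  · rw [if_neg h, indicator_of_notMem (fun h' => h ((mem_piece_iff k ζ).2 h'))]; simp

/-! ### The TT* argument in a Hilbert space. -/

section Hilbert

/-- Fubini's theorem on the triangle `a < s ≤ t ≤ b`, for a continuous bilinear map. -/
theorem integral_bilin_primitive {E F G : Type*} [NormedAddCommGroup E] [NormedSpace ℝ E]
    [CompleteSpace E] [NormedAddCommGroup F] [NormedSpace ℝ F] [CompleteSpace F]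
    [NormedAddCommGroup G] [NormedSpace ℝ G] [CompleteSpace G] (B : E →L[ℝ] F →L[ℝ] G)
    {a b : ℝ} {e : ℝ → E} {g : ℝ → F} (he : IntegrableOn e (Ioc a b))
    (hg : IntegrableOn g (Ioc a b)) :
    ∫ t in Ioc a b, B (e t) (∫ s in Ioc a t, g s) =
      ∫ s in Ioc a b, B (∫ t in Ioc s b, e t) (g s) := by
  set f : ℝ → ℝ → G := fun t s => {z : ℝ × ℝ | z.2 ≤ z.1}.indicator
    (fun z => B (e z.1) (g z.2)) (t, s) with hf
  have hmeas : MeasurableSet {z : ℝ × ℝ | z.2 ≤ z.1} :=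
    measurableSet_le measurable_snd measurable_fst
  have hint : Integrable (Function.uncurry f)
      ((volume.restrict (Ioc a b)).prod (volume.restrict (Ioc a b))) := by
    have h := he.op_fst_snd (op := fun x y => B x y) (by fun_prop) ⟨‖B‖, B.le_opNorm₂⟩ hg
    exact h.indicator hmeas
  have hswap := integral_integral_swap hint
  have e1 : ∀ t ∈ Ioc a b, ∫ s in Ioc a b, f t s = B (e t) (∫ s in Ioc a t, g s) := by
    intro t ht
    have hsub : Ioc a t ⊆ Ioc a b := Ioc_subset_Ioc_right ht.2
    rw [← (B (e t)).integral_comp_comm (hg.mono_set hsub),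
      ← inter_eq_right.2 hsub, ← setIntegral_indicator measurableSet_Ioc]
    refine setIntegral_congr_fun measurableSet_Ioc fun s hs => ?_
    simp only [hf, indicator, mem_ofPred_eq, mem_Ioc, hs.1, true_and]
  have e2 : ∀ s ∈ Ioc a b, ∫ t in Ioc a b, f t s = B (∫ t in Ioc s b, e t) (g s) := by
    intro s hs
    have hsub : Ioc s b ⊆ Ioc a b := Ioc_subset_Ioc_left hs.1.le
    have h1 := (B.flip (g s)).integral_comp_comm (he.mono_set hsub)
    rw [ContinuousLinearMap.flip_apply] at h1
    rw [← h1, ← inter_eq_right.2 hsub, ← setIntegral_indicator measurableSet_Ioc]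
    refine integral_congr_ae ?_
    have : ∀ᵐ t ∂(volume.restrict (Ioc a b)), t ≠ s :=
      ae_restrict_of_ae (Measure.ae_ne _ _)
    filter_upwards [this, ae_restrict_mem measurableSet_Ioc] with t hts ht
    have hlt : s ≤ t ↔ s < t := ⟨fun h => lt_of_le_of_ne h hts.symm, le_of_lt⟩
    simp only [hf, indicator, mem_ofPred_eq, mem_Ioc, ht.2, and_true, hlt]
    rfl
  rw [setIntegral_congr_fun measurableSet_Ioc e1, setIntegral_congr_fun measurableSet_Ioc e2]
    at hswap
  exact hswap

variable {H : Type*} [NormedAddCommGroup H] [InnerProductSpace ℂ H] [CompleteSpace H]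
  [NormedSpace ℝ H]

/-- Almost orthogonality: a curve whose Gram kernel is small has a small integral. -/
theorem norm_setIntegral_le_of_gram {S : Set ℝ} (hS : MeasurableSet S) (hS' : volume S ≠ ∞)
    {E : ℝ → H} (hE : IntegrableOn E S) {κ : ℝ → ℝ} {Λ : ℝ}
    (hκ : ∀ t ∈ S, ∀ t' ∈ S, t ≠ t' → ‖(inner ℂ (E t) (E t') : ℂ)‖ ≤ κ (t - t'))
    (hint : ∀ t ∈ S, IntegrableOn (fun t' => κ (t - t')) S)
    (hΛ : ∀ t ∈ S, ∫ t' in S, κ (t - t') ≤ Λ) :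
    ‖∫ t in S, E t‖ ≤ √((volume S).toReal * Λ) := by
  set I := ∫ t in S, E t with hI
  have h1 : ∀ t ∈ S, ‖(inner ℂ I (E t) : ℂ)‖ ≤ Λ := by
    intro t ht
    rw [← norm_inner_symm, hI, ← integral_inner (𝕜 := ℂ) hE]
    refine (norm_integral_le_of_norm_le (hint t ht) ?_).trans (hΛ t ht)
    -- The kernel bound is unavailable on the diagonal, which is a null set.
    have : ∀ᵐ t' ∂(volume.restrict S), t' ≠ t := ae_restrict_of_ae (Measure.ae_ne _ _)
    filter_upwards [this, ae_restrict_mem hS] with t' h h'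
    exact hκ t ht t' h' h.symm
  -- Schur's test: `‖I‖²` is the integral over `S` of `⟨I, E t⟩`, and each of these is at most `Λ`.
  have h2 : ‖I‖ ^ 2 ≤ (volume S).toReal * Λ := by
    have h3 : ((‖I‖ ^ 2 : ℝ) : ℂ) = ∫ t in S, (inner ℂ I (E t) : ℂ) := by
      rw [integral_inner (𝕜 := ℂ) hE, inner_self_eq_norm_sq_to_K]; simp
    have h4 := congrArg norm h3
    rw [Complex.norm_real, Real.norm_of_nonneg (sq_nonneg _)] at h4
    rw [h4, mul_comm]
    exact norm_setIntegral_le_of_norm_le_const (lt_top_iff_ne_top.2 hS') h1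
  exact Real.le_sqrt_of_sq_le h2

/-- The dual form of the Strichartz estimate with a forcing term. -/
theorem integral_norm_inner_le [IsScalarTower ℝ ℂ H] {a b : ℝ} (hab : a ≤ b) {E k g : ℝ → H}
    (hE : IntegrableOn E (Ioc a b)) (hg : IntegrableOn g (Ioc a b))
    (hk : ∀ t ∈ Ioc a b, k t = k a + ∫ s in Ioc a t, g s)
    {κ : ℝ → ℝ} {Λ : ℝ} (hκ0 : ∀ u, 0 ≤ κ u)
    (hκ : ∀ t t', t ≠ t' → t ∈ Ioc a b → t' ∈ Ioc a b →
      ‖(inner ℂ (E t) (E t') : ℂ)‖ ≤ κ (t - t'))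
    (hint : ∀ t ∈ Ioc a b, IntegrableOn (fun t' => κ (t - t')) (Ioc a b))
    (hΛ : ∀ t ∈ Ioc a b, ∫ t' in Ioc a b, κ (t - t') ≤ Λ) :
    ∫ t in Ioc a b, ‖(inner ℂ (E t) (k t) : ℂ)‖ ≤
      √((b - a) * Λ) * (‖k a‖ + ∫ s in Ioc a b, ‖g s‖) := by
  rcases hab.eq_or_lt with rfl | hlt
  · simp
  have hΛ0 : 0 ≤ Λ :=
    (integral_nonneg fun t' => hκ0 _).trans (hΛ b ⟨hlt, le_rfl⟩)
  -- A continuous representative of `k` on `Ioc a b`, where `k` itself comes with no measurability.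
  set P : ℝ → H := fun t => k a + ∫ s in Ioc a t, g s with hP
  have hPc : ContinuousOn P (Icc a b) :=
    continuousOn_const.add (intervalIntegral.continuousOn_primitive
      (by rwa [integrableOn_Icc_iff_integrableOn_Ioc]))
  have hPm : AEStronglyMeasurable P (volume.restrict (Ioc a b)) :=
    (hPc.mono Ioc_subset_Icc_self).aestronglyMeasurable measurableSet_Ioc
  set w : ℝ → ℂ := fun t => inner ℂ (E t) (P t) with hw
  have hwm : AEStronglyMeasurable w (volume.restrict (Ioc a b)) := hE.1.inner hPm
  -- A phase of modulus at most one (zero where `w` vanishes) that makes `⟨c E, P⟩` equal to `|⟨E,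
  -- P⟩|` and does not spoil the Gram bound.
  set c : ℝ → ℂ := fun t => w t / ‖w t‖ with hc
  have hcm : AEStronglyMeasurable c (volume.restrict (Ioc a b)) :=
    (hwm.aemeasurable.div (Complex.measurable_ofReal.comp_aemeasurable
      hwm.norm.aemeasurable)).aestronglyMeasurable
  have hc1 : ∀ t, ‖c t‖ ≤ 1 := fun t => by
    rw [hc]; simp only [norm_div, Complex.norm_real, norm_norm]; exact div_self_le_one _
  set D : ℝ → H := fun t => c t • E t with hD
  have hDint : IntegrableOn D (Ioc a b) := by
    refine hE.norm.mono' (hcm.smul hE.1) (Eventually.of_forall fun t => ?_)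
    rw [hD]; simp only [norm_smul]
    exact mul_le_of_le_one_left (norm_nonneg _) (hc1 t)
  have hDP : ∀ t, (inner ℂ (D t) (P t) : ℂ) = ‖w t‖ := by
    intro t
    have : (inner ℂ (D t) (P t) : ℂ) = (starRingEnd ℂ) (c t) * w t := inner_smul_left _ _ _
    rw [this, hc]
    by_cases h : w t = 0
    · simp [h]
    · have h' : (‖w t‖ : ℂ) ≠ 0 := by exact_mod_cast norm_ne_zero_iff.2 h
      simp only [map_div₀, Complex.conj_ofReal]
      rw [div_mul_eq_mul_div, mul_comm, Complex.mul_conj', div_eq_iff h', sq]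
  have hDs : ∀ s, a ≤ s → ‖∫ t in Ioc s b, D t‖ ≤ √((b - a) * Λ) := by
    intro s hs
    have hsub : Ioc s b ⊆ Ioc a b := Ioc_subset_Ioc_left hs
    refine (norm_setIntegral_le_of_gram measurableSet_Ioc (by simp) (hDint.mono_set hsub)
      (κ := κ) (Λ := Λ) ?_ (fun t ht => (hint t (hsub ht)).mono_set hsub) ?_).trans ?_
    · intro t ht t' ht' hne
      rw [hD]; simp only
      rw [inner_smul_left, inner_smul_right, norm_mul, norm_mul, RCLike.norm_conj]
      have h := hκ t t' hne (hsub ht) (hsub ht')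
      have h2 : ‖c t'‖ * ‖(inner ℂ (E t) (E t') : ℂ)‖ ≤ κ (t - t') :=
        (mul_le_of_le_one_left (norm_nonneg _) (hc1 _)).trans h
      exact (mul_le_of_le_one_left (by positivity) (hc1 _)).trans h2
    · intro t ht
      refine le_trans ?_ (hΛ t (hsub ht))
      exact setIntegral_mono_set (hint t (hsub ht)) (Eventually.of_forall fun _ => hκ0 _)
        (LE.le.eventuallyLE hsub)
    · refine Real.sqrt_le_sqrt (mul_le_mul_of_nonneg_right ?_ hΛ0)
      rw [Real.volume_Ioc]
      exact ENNReal.toReal_le_of_le_ofReal (by linarith) (ENNReal.ofReal_le_ofReal (by linarith))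
  have hfirst : IntegrableOn (fun t => (inner ℂ (D t) (k a) : ℂ)) (Ioc a b) :=
    hDint.inner_const _
  have hQ : ContinuousOn (fun t => ∫ s in Ioc a t, g s) (Icc a b) :=
    intervalIntegral.continuousOn_primitive (by rwa [integrableOn_Icc_iff_integrableOn_Ioc])
  obtain ⟨Q, hQb⟩ := isCompact_Icc.exists_bound_of_continuousOn hQ
  have hsecond : IntegrableOn (fun t => (inner ℂ (D t) (∫ s in Ioc a t, g s) : ℂ)) (Ioc a b) := by
    refine (hDint.norm.mul_const Q).mono' (hDint.1.inner
      ((hQ.mono Ioc_subset_Icc_self).aestronglyMeasurable measurableSet_Ioc)) ?_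
    filter_upwards [ae_restrict_mem measurableSet_Ioc] with t ht
    exact (norm_inner_le_norm _ _).trans
      (mul_le_mul_of_nonneg_left (hQb t (Ioc_subset_Icc_self ht)) (norm_nonneg _))
  -- Fubini moves the time integral onto `D`: only the tails `∫ D` over `(s, b]` remain, and the
  -- Gram estimate bounds them all by the same constant. The retarded forcing term thus costs no
  -- more than the data term.
  have hsum : ((∫ t in Ioc a b, ‖(inner ℂ (E t) (k t) : ℂ)‖ : ℝ) : ℂ) =
      inner ℂ (∫ t in Ioc a b, D t) (k a) +
      ∫ s in Ioc a b, (inner ℂ (∫ t in Ioc s b, D t) (g s) : ℂ) := by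
    have t1 : ((∫ t in Ioc a b, ‖(inner ℂ (E t) (k t) : ℂ)‖ : ℝ) : ℂ) =
        ∫ t in Ioc a b, ((inner ℂ (D t) (k a) : ℂ) + inner ℂ (D t) (∫ s in Ioc a t, g s)) := by
      rw [← integral_complex_ofReal]
      refine setIntegral_congr_fun measurableSet_Ioc fun t ht => ?_
      rw [← inner_add_right, hk t ht]
      exact (hDP t).symm
    rw [t1, integral_add hfirst hsecond]
    congr 1
    · have := integral_inner (𝕜 := ℂ) hDint (k a)
      have h2 := congrArg (starRingEnd ℂ) this
      rw [← integral_conj] at h2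
      simpa only [inner_conj_symm] using h2
    · exact integral_bilin_primitive
        (isBoundedBilinearMap_inner (𝕜 := ℂ) (E := H)).toContinuousLinearMap hDint hg
  have hn := congrArg norm hsum
  rw [Complex.norm_real, Real.norm_of_nonneg (integral_nonneg fun t => norm_nonneg _)] at hn
  rw [hn]
  refine (norm_add_le _ _).trans ?_
  rw [mul_add]
  gcongr
  · exact (norm_inner_le_norm _ _).trans
      (mul_le_mul_of_nonneg_right (hDs a le_rfl) (norm_nonneg _))
  · rw [← integral_const_mul]
    refine norm_integral_le_of_norm_le (hg.norm.const_mul _) ?_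
    filter_upwards [ae_restrict_mem measurableSet_Ioc] with s hs
    exact (norm_inner_le_norm _ _).trans
      (mul_le_mul_of_nonneg_right (hDs s hs.1.le) (norm_nonneg _))

end Hilbert

/-- Supplies the Schur constant of the dispersive kernel, with `γ = θ/2`. -/
theorem integrableOn_abs_sub_rpow {γ : ℝ} (hγ : 0 < γ) {a b t : ℝ} (ht : t ∈ Icc a b) :
    IntegrableOn (fun t' => |t - t'| ^ (-1 + γ)) (Ioc a b) ∧
      ∫ t' in Ioc a b, |t - t'| ^ (-1 + γ) ≤ 2 * (b - a) ^ γ / γ := by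
  have hr : -1 < -1 + γ := by linarith
  have i0 : ∀ c, IntervalIntegrable (fun x : ℝ => x ^ (-1 + γ)) volume 0 c := fun c =>
    intervalIntegral.intervalIntegrable_rpow' hr
  have l1 : IntervalIntegrable (fun t' => (t - t') ^ (-1 + γ)) volume a t := by
    have := (i0 (t - a)).comp_sub_left t
    simpa using this.symm
  have l2 : IntervalIntegrable (fun t' => (t' - t) ^ (-1 + γ)) volume t b := by
    have := (i0 (b - t)).comp_sub_right t
    simpa using this
  have c1 : ∀ t' ∈ Ioc a t, (t - t') ^ (-1 + γ) = |t - t'| ^ (-1 + γ) := fun t' h => by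
    rw [abs_of_nonneg (by linarith [h.2])]
  have c2 : ∀ t' ∈ Ioc t b, (t' - t) ^ (-1 + γ) = |t - t'| ^ (-1 + γ) := fun t' h => by
    rw [abs_sub_comm, abs_of_nonneg (by linarith [h.1])]
  have i1 : IntervalIntegrable (fun t' => |t - t'| ^ (-1 + γ)) volume a t :=
    l1.congr (by rw [uIoc_of_le ht.1]; exact c1)
  have i2 : IntervalIntegrable (fun t' => |t - t'| ^ (-1 + γ)) volume t b :=
    l2.congr (by rw [uIoc_of_le ht.2]; exact c2)
  have hab : a ≤ b := ht.1.trans ht.2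
  refine ⟨(intervalIntegrable_iff_integrableOn_Ioc_of_le hab).1 (i1.trans i2), ?_⟩
  rw [← intervalIntegral.integral_of_le hab,
    ← intervalIntegral.integral_add_adjacent_intervals i1 i2]
  have v1 : ∫ t' in a..t, |t - t'| ^ (-1 + γ) = (t - a) ^ γ / γ := by
    rw [intervalIntegral.integral_of_le ht.1, ← setIntegral_congr_fun measurableSet_Ioc c1,
      ← intervalIntegral.integral_of_le ht.1,
      intervalIntegral.integral_comp_sub_left (fun x => x ^ (-1 + γ)), integral_rpow (Or.inl hr)]
    simp [Real.zero_rpow hγ.ne']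
  have v2 : ∫ t' in t..b, |t - t'| ^ (-1 + γ) = (b - t) ^ γ / γ := by
    rw [intervalIntegral.integral_of_le ht.2, ← setIntegral_congr_fun measurableSet_Ioc c2,
      ← intervalIntegral.integral_of_le ht.2,
      intervalIntegral.integral_comp_sub_right (fun x => x ^ (-1 + γ)), integral_rpow (Or.inl hr)]
    simp [Real.zero_rpow hγ.ne']
  rw [v1, v2]
  have m1 : (t - a) ^ γ ≤ (b - a) ^ γ :=
    Real.rpow_le_rpow (by linarith [ht.1]) (by linarith [ht.2]) hγ.le
  have m2 : (b - t) ^ γ ≤ (b - a) ^ γ :=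
    Real.rpow_le_rpow (by linarith [ht.2]) (by linarith [ht.1]) hγ.le
  rw [← add_div]
  gcongr
  linarith

/-! ### Duhamel's formula through bounded multipliers. -/

/-- The space `L^∞(ℝ²)`. -/
abbrev LinfPlane : Type := Lp ℂ ∞ (volume : Measure Plane)

open Classical in
/-- The class in `L^∞` of a bounded function (and `0` if the function is not in `L^∞`). -/
noncomputable def toLinf (m : Plane → ℂ) : LinfPlane :=
  if h : MemLp m ∞ volume then h.toLp m else 0

theorem coeFn_toLinf {m : Plane → ℂ} (h : MemLp m ∞ volume) : toLinf m =ᵐ[volume] m := by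
  rw [toLinf, dif_pos h]; exact h.coeFn_toLp

/-- Multiplication of `L²` functions by `L^∞` functions. -/
noncomputable def mulL : LinfPlane →L[ℝ] L2Plane →L[ℝ] L2Plane :=
  ((ContinuousLinearMap.mul ℂ ℂ).holderL volume ∞ 2 2).bilinearRestrictScalars ℝ

theorem coeFn_mulL (f : LinfPlane) (u : L2Plane) :
    mulL f u =ᵐ[volume] fun ζ => f ζ * u ζ :=
  (ContinuousLinearMap.mul ℂ ℂ).coeFn_holder f u

theorem coeFn_mulL_toLinf {m : Plane → ℂ} (h : MemLp m ∞ volume) (u : L2Plane) :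
    mulL (toLinf m) u =ᵐ[volume] fun ζ => m ζ * u ζ := by
  filter_upwards [coeFn_mulL (toLinf m) u, coeFn_toLinf h] with ζ h1 h2
  rw [h1, h2]

theorem norm_Linf_le {f : LinfPlane} {C : ℝ} (hC : 0 ≤ C) (h : ∀ᵐ ζ, ‖f ζ‖ ≤ C) : ‖f‖ ≤ C := by
  rw [Lp.norm_def, eLpNorm_exponent_top]
  exact ENNReal.toReal_le_of_le_ofReal hC (eLpNormEssSup_le_of_ae_bound h)

/-- The symbol `b exp (-i t ω)`, cut off to `S`. -/
noncomputable def phaseMul (S : Set Plane) (b : Plane → ℂ) (t : ℝ) : Plane → ℂ :=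
  S.indicator fun ζ => b ζ * Complex.exp (-(Complex.I * (t * omega ζ : ℝ)))

theorem norm_exp_neg_I_mul (x : ℝ) : ‖Complex.exp (-(Complex.I * (x : ℂ)))‖ = 1 := by
  have : -(Complex.I * (x : ℂ)) = ((-x : ℝ) : ℂ) * Complex.I := by push_cast; ring
  rw [this, Complex.norm_exp_ofReal_mul_I]

theorem measurable_phaseMul {S : Set Plane} (hS : MeasurableSet S) {b : Plane → ℂ}
    (hb : Measurable b) (t : ℝ) : Measurable (phaseMul S b t) :=
  Measurable.indicator (by fun_prop) hS

theorem norm_phaseMul_le {S : Set Plane} {b : Plane → ℂ} {C : ℝ} (hC : 0 ≤ C)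
    (hb : ∀ ζ ∈ S, ‖b ζ‖ ≤ C) (t : ℝ) (ζ : Plane) : ‖phaseMul S b t ζ‖ ≤ C := by
  unfold phaseMul
  by_cases h : ζ ∈ S
  · rw [indicator_of_mem h, norm_mul, norm_exp_neg_I_mul, mul_one]; exact hb ζ h
  · rw [indicator_of_notMem h, norm_zero]; exact hC

theorem memLp_phaseMul {S : Set Plane} (hS : MeasurableSet S) {b : Plane → ℂ}
    (hb : Measurable b) {C : ℝ} (hC : 0 ≤ C) (hbC : ∀ ζ ∈ S, ‖b ζ‖ ≤ C) (t : ℝ) :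
    MemLp (phaseMul S b t) ∞ volume :=
  memLp_top_of_bound (measurable_phaseMul hS hb t).aestronglyMeasurable C
    (Eventually.of_forall (norm_phaseMul_le hC hbC t))

/-- The free evolution with bounded frequencies is differentiable in operator norm. -/
theorem hasDerivAt_toLinf_phaseMul {S : Set Plane} (hS : MeasurableSet S) {b : Plane → ℂ}
    (hb : Measurable b) {C R : ℝ} (hC : 0 ≤ C) (hbC : ∀ ζ ∈ S, ‖b ζ‖ ≤ C)
    (hR : ∀ ζ ∈ S, |omega ζ| ≤ R) (t : ℝ) :
    HasDerivAt (fun t => toLinf (phaseMul S b t))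
      (toLinf (phaseMul S (fun ζ => -(Complex.I * omega ζ) * b ζ) t)) t := by
  -- A point of `S` is needed to know that `R ≥ 0`.
  rcases S.eq_empty_or_nonempty with rfl | ⟨ζ₀, hζ₀⟩
  · have : ∀ (b : Plane → ℂ) t, phaseMul ∅ b t = 0 := fun b t => indicator_empty _
    have h0 : toLinf 0 = 0 := by
      rw [toLinf]; split_ifs with h
      · exact MemLp.toLp_zero h
      · rfl
    simp only [this, h0]
    exact hasDerivAt_const t 0
  have hR0 : 0 ≤ R := (abs_nonneg _).trans (hR ζ₀ hζ₀)
  have hb' : Measurable fun ζ => -(Complex.I * (omega ζ : ℂ)) * b ζ := by fun_prop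
  have hb'C : ∀ ζ ∈ S, ‖-(Complex.I * (omega ζ : ℂ)) * b ζ‖ ≤ R * C := fun ζ h => by
    rw [norm_mul, norm_neg, norm_mul, Complex.norm_I, one_mul, Complex.norm_real]
    exact mul_le_mul (hR ζ h) (hbC ζ h) (norm_nonneg _) hR0
  rw [hasDerivAt_iff_isLittleO_nhds_zero]
  have hO : (fun h => toLinf (phaseMul S b (t + h)) - toLinf (phaseMul S b t) -
      h • toLinf (phaseMul S (fun ζ => -(Complex.I * omega ζ) * b ζ) t)) =O[𝓝 0]
      fun h : ℝ => h ^ 2 := by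
    refine Asymptotics.IsBigO.of_bound (C * R ^ 2) ?_
    have hev : ∀ᶠ h : ℝ in 𝓝 0, |h| * R ≤ 1 := by
      have : Tendsto (fun h : ℝ => |h| * R) (𝓝 0) (𝓝 (|0| * R)) :=
        Continuous.tendsto (by fun_prop) 0
      rw [abs_zero, zero_mul] at this
      exact this.eventually_le_const one_pos
    filter_upwards [hev] with h hh
    refine norm_Linf_le (by positivity) ?_
    filter_upwards [Lp.coeFn_sub (toLinf (phaseMul S b (t + h)) - toLinf (phaseMul S b t))
        (h • toLinf (phaseMul S (fun ζ => -(Complex.I * omega ζ) * b ζ) t)),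
      Lp.coeFn_sub (toLinf (phaseMul S b (t + h))) (toLinf (phaseMul S b t)),
      Lp.coeFn_smul h (toLinf (phaseMul S (fun ζ => -(Complex.I * omega ζ) * b ζ) t)),
      coeFn_toLinf (memLp_phaseMul hS hb hC hbC (t + h)),
      coeFn_toLinf (memLp_phaseMul hS hb hC hbC t),
      coeFn_toLinf (memLp_phaseMul hS hb' (by positivity) hb'C t)] with ζ h1 h2 h3 h4 h5 h6
    rw [h1, Pi.sub_apply, h2, Pi.sub_apply, h3, Pi.smul_apply, h4, h5, h6]
    unfold phaseMul
    by_cases hζ : ζ ∈ S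
    · rw [indicator_of_mem hζ, indicator_of_mem hζ, indicator_of_mem hζ]
      set x : ℂ := -(Complex.I * (h * omega ζ : ℝ)) with hx
      have hxn : ‖x‖ = |h| * |omega ζ| := by
        rw [hx, norm_neg, norm_mul, Complex.norm_I, one_mul, Complex.norm_real, norm_mul]; rfl
      have hx1 : ‖x‖ ≤ |h| * R := by
        rw [hxn]; exact mul_le_mul_of_nonneg_left (hR ζ hζ) (abs_nonneg _)
      have e1 : Complex.exp (-(Complex.I * ((t + h) * omega ζ : ℝ))) =
          Complex.exp (-(Complex.I * (t * omega ζ : ℝ))) * Complex.exp x := by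
        rw [← Complex.exp_add]; congr 1; rw [hx]; push_cast; ring
      have e2 : b ζ * Complex.exp (-(Complex.I * ((t + h) * omega ζ : ℝ))) -
          b ζ * Complex.exp (-(Complex.I * (t * omega ζ : ℝ))) -
          h • (-(Complex.I * omega ζ) * b ζ * Complex.exp (-(Complex.I * (t * omega ζ : ℝ)))) =
          b ζ * (Complex.exp (-(Complex.I * (t * omega ζ : ℝ))) * (Complex.exp x - 1 - x)) := by
        rw [e1, Complex.real_smul]; rw [hx]; push_cast; ring
      rw [e2, norm_mul, norm_mul, norm_exp_neg_I_mul, one_mul, mul_assoc]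
      refine mul_le_mul (hbC ζ hζ) ?_ (norm_nonneg _) hC
      -- The Taylor remainder is at most `(|h| R)²` uniformly in the frequency, once `|h| R ≤ 1`.
      refine (Complex.norm_exp_sub_one_sub_id_le (hx1.trans hh)).trans ?_
      rw [norm_pow, Real.norm_eq_abs, ← mul_pow, mul_comm R]
      exact pow_le_pow_left₀ (norm_nonneg _) hx1 2
    · rw [indicator_of_notMem hζ, indicator_of_notMem hζ, indicator_of_notMem hζ]
      simp only [sub_zero, smul_zero, norm_zero]
      positivity
  refine hO.trans_isLittleO ?_
  exact Asymptotics.isLittleO_pow_id one_lt_two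

theorem continuous_toLinf_phaseMul {S : Set Plane} (hS : MeasurableSet S) {b : Plane → ℂ}
    (hb : Measurable b) {C R : ℝ} (hC : 0 ≤ C) (hbC : ∀ ζ ∈ S, ‖b ζ‖ ≤ C)
    (hR : ∀ ζ ∈ S, |omega ζ| ≤ R) : Continuous fun t => toLinf (phaseMul S b t) :=
  continuous_iff_continuousAt.2 fun t =>
    (hasDerivAt_toLinf_phaseMul hS hb hC hbC hR t).continuousAt

theorem integrableOn_mulL {A : ℝ → LinfPlane} (hA : Continuous A) {a b : ℝ} {g : ℝ → L2Plane}
    (hg : IntegrableOn g (Ioc a b)) : IntegrableOn (fun s => mulL (A s) (g s)) (Ioc a b) := by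
  obtain ⟨Q, hQ⟩ := isCompact_Icc.exists_bound_of_continuousOn (hA.continuousOn (s := Icc a b))
  refine (hg.norm.const_mul (‖mulL‖ * Q)).mono' (mulL.aestronglyMeasurable_comp₂
    hA.aestronglyMeasurable hg.1) ?_
  filter_upwards [ae_restrict_mem measurableSet_Ioc] with s hs
  refine (mulL.le_opNorm₂ _ _).trans ?_
  gcongr
  exact hQ s (Ioc_subset_Icc_self hs)

/-- Duhamel's formula on a bounded set of frequencies. -/
theorem duhamel {a b R : ℝ} {S : Set Plane} (hS : MeasurableSet S) (hR0 : 0 ≤ R)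
    (hR : ∀ ζ ∈ S, |omega ζ| ≤ R) (hξ : ∀ ζ ∈ S, |xi ζ| ≤ R) {V Φ : ℝ → L2Plane}
    (hV : IntegrableOn V (Ioc a b)) (hΦ : IntegrableOn Φ (Ioc a b))
    (heq : ∀ t ∈ Icc a b, V t =ᵐ[volume] fun ζ => V a ζ
      + Complex.I * omega ζ * (∫ s in Ioc a t, V s : L2Plane) ζ
      + Complex.I * xi ζ * (∫ s in Ioc a t, Φ s : L2Plane) ζ) :
    ∀ t ∈ Icc a b, mulL (toLinf (phaseMul S 1 t)) (V t) = mulL (toLinf (phaseMul S 1 a)) (V a) +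
      ∫ s in Ioc a t, mulL (toLinf (phaseMul S (fun ζ => Complex.I * xi ζ) s)) (Φ s) := by
  intro t ht
  have b1 : ∀ ζ ∈ S, ‖(1 : Plane → ℂ) ζ‖ ≤ 1 := fun ζ _ => by simp
  have bω : ∀ ζ ∈ S, ‖Complex.I * (omega ζ : ℂ)‖ ≤ R := fun ζ h => by
    rw [norm_mul, Complex.norm_I, one_mul, Complex.norm_real]; exact hR ζ h
  have bω' : ∀ ζ ∈ S, ‖-(Complex.I * (omega ζ : ℂ)) * (1 : Plane → ℂ) ζ‖ ≤ R := fun ζ h => by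
    rw [Pi.one_apply, mul_one, norm_neg]; exact bω ζ h
  have bξ : ∀ ζ ∈ S, ‖Complex.I * (xi ζ : ℂ)‖ ≤ R := fun ζ h => by
    rw [norm_mul, Complex.norm_I, one_mul, Complex.norm_real]; exact hξ ζ h
  have m1 : Measurable (1 : Plane → ℂ) := measurable_const
  have mω : Measurable fun ζ => Complex.I * (omega ζ : ℂ) := by fun_prop
  have mω' : Measurable fun ζ => -(Complex.I * (omega ζ : ℂ)) * (1 : Plane → ℂ) ζ := by fun_prop
  have mξ : Measurable fun ζ => Complex.I * (xi ζ : ℂ) := by fun_prop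
  set A : ℝ → LinfPlane := fun s => toLinf (phaseMul S 1 s) with hA
  set A' : ℝ → LinfPlane := fun s =>
    toLinf (phaseMul S (fun ζ => -(Complex.I * omega ζ) * (1 : Plane → ℂ) ζ) s) with hA'
  set X : ℝ → LinfPlane := fun s => toLinf (phaseMul S (fun ζ => Complex.I * xi ζ) s) with hX
  set Ω : LinfPlane := toLinf (phaseMul S (fun ζ => Complex.I * omega ζ) 0) with hΩ
  have cA : Continuous A := continuous_toLinf_phaseMul hS m1 zero_le_one b1 hR
  have cA' : Continuous A' := continuous_toLinf_phaseMul hS mω' hR0 bω' hR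
  have cX : Continuous X := continuous_toLinf_phaseMul hS mξ hR0 bξ hR
  -- At time `0` the phase is `1`, so `A 0` is the bare cutoff to `S`; on `S` the unbounded symbols
  -- of the equation become bounded operators.
  set P : ℝ → L2Plane := fun s => mulL (A 0) (V s) with hP
  set g : ℝ → L2Plane := fun s => mulL Ω (V s) + mulL (X 0) (Φ s) with hg
  have hVt : ∀ s ∈ Icc a t, IntegrableOn V (Ioc a s) := fun s hs =>
    hV.mono_set (Ioc_subset_Ioc_right (hs.2.trans ht.2))
  have hΦt : ∀ s ∈ Icc a t, IntegrableOn Φ (Ioc a s) := fun s hs =>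
    hΦ.mono_set (Ioc_subset_Ioc_right (hs.2.trans ht.2))
  have gint : ∀ s ∈ Icc a t, IntegrableOn g (Ioc a s) := fun s hs =>
    ((mulL Ω).integrable_comp (hVt s hs)).add ((mulL (X 0)).integrable_comp (hΦt s hs))
  have coeA : ∀ s u, mulL (A s) u =ᵐ[volume] fun ζ => phaseMul S 1 s ζ * u ζ := fun s u =>
    coeFn_mulL_toLinf (memLp_phaseMul hS m1 zero_le_one b1 s) u
  have coeA' : ∀ s u, mulL (A' s) u =ᵐ[volume] fun ζ =>
      phaseMul S (fun ζ => -(Complex.I * omega ζ) * (1 : Plane → ℂ) ζ) s ζ * u ζ := fun s u =>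
    coeFn_mulL_toLinf (memLp_phaseMul hS mω' hR0 bω' s) u
  have coeX : ∀ s u, mulL (X s) u =ᵐ[volume] fun ζ =>
      phaseMul S (fun ζ => Complex.I * xi ζ) s ζ * u ζ := fun s u =>
    coeFn_mulL_toLinf (memLp_phaseMul hS mξ hR0 bξ s) u
  have coeΩ : ∀ u, mulL Ω u =ᵐ[volume] fun ζ =>
      phaseMul S (fun ζ => Complex.I * omega ζ) 0 ζ * u ζ := fun u =>
    coeFn_mulL_toLinf (memLp_phaseMul hS mω hR0 bω 0) u
  have hPeq : ∀ s ∈ Icc a t, P s = P a + ∫ r in Ioc a s, g r := by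
    intro s hs
    have i1 := (mulL Ω).integral_comp_comm (hVt s hs)
    have i2 := (mulL (X 0)).integral_comp_comm (hΦt s hs)
    rw [hg, integral_add ((mulL Ω).integrable_comp (hVt s hs))
      ((mulL (X 0)).integrable_comp (hΦt s hs)), i1, i2]
    refine Lp.ext ?_
    filter_upwards [heq s ⟨hs.1, hs.2.trans ht.2⟩, coeA 0 (V s), coeA 0 (V a),
      coeΩ (∫ r in Ioc a s, V r), coeX 0 (∫ r in Ioc a s, Φ r),
      Lp.coeFn_add (P a) (mulL Ω (∫ r in Ioc a s, V r) + mulL (X 0) (∫ r in Ioc a s, Φ r)),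
      Lp.coeFn_add (mulL Ω (∫ r in Ioc a s, V r)) (mulL (X 0) (∫ r in Ioc a s, Φ r))]
      with ζ h1 h2 h3 h4 h5 h6 h7
    rw [h6, Pi.add_apply, h7, Pi.add_apply, h4, h5]
    simp only [hP]
    rw [h2, h3, h1]
    unfold phaseMul
    by_cases hζ : ζ ∈ S
    · simp only [indicator_of_mem hζ, Pi.one_apply]; ring
    · simp only [indicator_of_notMem hζ]; ring
  have hta : t ∈ Icc a t := ⟨ht.1, le_rfl⟩
  have haa : a ∈ Icc a t := ⟨le_rfl, ht.1⟩
  have derA : ∀ s, HasDerivAt A (A' s) s :=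
    hasDerivAt_toLinf_phaseMul hS m1 zero_le_one b1 hR
  have intA' : ∀ s, s ≤ t → ∫ r in Ioc s t, A' r = A t - A s := fun s hs => by
    rw [← intervalIntegral.integral_of_le hs]
    exact intervalIntegral.integral_eq_sub_of_hasDerivAt (fun r _ => derA r)
      (cA'.intervalIntegrable _ _)
  have iA' : IntegrableOn A' (Ioc a t) := cA'.integrableOn_Ioc
  have hPc : ContinuousOn P (Icc a t) := by
    have : ContinuousOn (fun s => P a + ∫ r in Ioc a s, g r) (Icc a t) :=
      continuousOn_const.add (intervalIntegral.continuousOn_primitive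
        (by rw [integrableOn_Icc_iff_integrableOn_Ioc]; exact gint t hta))
    exact this.congr hPeq
  have iP : IntegrableOn P (Ioc a t) :=
    (hPc.integrableOn_Icc).mono_set Ioc_subset_Icc_self
  -- Integration by parts in time for `A P`. The forcing is merely integrable, so Fubini on the
  -- triangle replaces the product rule.
  have hF := integral_bilin_primitive mulL iA' (gint t hta)
  have e1 : ∫ s in Ioc a t, mulL (A' s) (∫ r in Ioc a s, g r) =
      (∫ s in Ioc a t, mulL (A' s) (P s)) - (mulL (A t) (P a) - mulL (A a) (P a)) := by
    have h1 : ∫ s in Ioc a t, mulL (A' s) (∫ r in Ioc a s, g r) =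
        ∫ s in Ioc a t, (mulL (A' s) (P s) - mulL (A' s) (P a)) := by
      refine setIntegral_congr_fun measurableSet_Ioc fun s hs => ?_
      rw [← map_sub, hPeq s (Ioc_subset_Icc_self hs), add_sub_cancel_left]
    have h2 : IntegrableOn (fun s => mulL (A' s) (P a)) (Ioc a t) :=
      (mulL.flip (P a)).integrable_comp iA'
    have h3 : ∫ s in Ioc a t, mulL (A' s) (P a) = mulL (A t) (P a) - mulL (A a) (P a) := by
      have := (mulL.flip (P a)).integral_comp_comm iA'
      rw [intA' a ht.1] at this
      simpa using this
    rw [h1, integral_sub (integrableOn_mulL cA' iP) h2, h3]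
  have e2 : ∫ s in Ioc a t, mulL (∫ r in Ioc s t, A' r) (g s) =
      (mulL (A t) (P t) - mulL (A t) (P a)) - ∫ s in Ioc a t, mulL (A s) (g s) := by
    have h1 : ∫ s in Ioc a t, mulL (∫ r in Ioc s t, A' r) (g s) =
        ∫ s in Ioc a t, (mulL (A t) (g s) - mulL (A s) (g s)) := by
      refine setIntegral_congr_fun measurableSet_Ioc fun s hs => ?_
      simp only [intA' s hs.2, map_sub, sub_apply]
    rw [h1, integral_sub ((mulL (A t)).integrable_comp (gint t hta))
      (integrableOn_mulL cA (gint t hta)), (mulL (A t)).integral_comp_comm (gint t hta),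
      hPeq t hta, map_add, add_sub_cancel_left]
  rw [e1, e2] at hF
  -- The `-iω` from differentiating the phase cancels the `iω` of the equation, leaving the forcing
  -- alone.
  have e3 : (∫ s in Ioc a t, mulL (A' s) (P s)) + ∫ s in Ioc a t, mulL (A s) (g s) =
      ∫ s in Ioc a t, mulL (X s) (Φ s) := by
    rw [← integral_add (integrableOn_mulL cA' iP) (integrableOn_mulL cA (gint t hta))]
    refine setIntegral_congr_fun measurableSet_Ioc fun s _ => ?_
    refine Lp.ext ?_
    filter_upwards [Lp.coeFn_add (mulL (A' s) (P s)) (mulL (A s) (g s)), coeA' s (P s),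
      coeA s (g s), coeA 0 (V s), Lp.coeFn_add (mulL Ω (V s)) (mulL (X 0) (Φ s)), coeΩ (V s),
      coeX 0 (Φ s), coeX s (Φ s)] with ζ h1 h2 h3 h4 h5 h6 h7 h8
    rw [h1, Pi.add_apply, h2, h3, h8]
    simp only [hP, hg]
    rw [h4, h5, Pi.add_apply, h6, h7]
    unfold phaseMul
    by_cases hζ : ζ ∈ S
    · simp only [indicator_of_mem hζ, Pi.one_apply, zero_mul, Complex.ofReal_zero, mul_zero,
        neg_zero, Complex.exp_zero]
      ring
    · simp only [indicator_of_notMem hζ]; ring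
  have e4 : ∀ s, mulL (A s) (P s) = mulL (A s) (V s) := by
    intro s
    refine Lp.ext ?_
    filter_upwards [coeA s (P s), coeA s (V s), coeA 0 (V s)] with ζ h1 h2 h3
    rw [h1, h2]
    simp only [hP]
    rw [h3]
    unfold phaseMul
    by_cases hζ : ζ ∈ S
    · simp only [indicator_of_mem hζ, Pi.one_apply, zero_mul, Complex.ofReal_zero, mul_zero,
        neg_zero, Complex.exp_zero, one_mul]
    · simp only [indicator_of_notMem hζ, zero_mul]
  rw [← e4 t, ← e4 a, ← e3]
  have e5 : mulL (A t) (P t) = ((mulL (A t) (P t) - mulL (A t) (P a)) -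
      ∫ s in Ioc a t, mulL (A s) (g s)) + mulL (A t) (P a) +
      ∫ s in Ioc a t, mulL (A s) (g s) := by abel
  rw [e5, ← hF]
  abel

/-! ### The equation on the Fourier side. -/

theorem integrable_L2_mul (u : L2Plane) {h : Plane → ℂ} (hh : MemLp h 2 volume) :
    Integrable (fun ζ => u ζ * h ζ) :=
  (Lp.memLp u).integrable_mul hh

/-- Pairing with a fixed `L²` function is a continuous functional. -/
theorem exists_pairing {h : Plane → ℂ} (hh : MemLp h 2 volume) :
    ∃ L : L2Plane →L[ℝ] ℂ, ∀ u : L2Plane, L u = ∫ ζ, u ζ * h ζ := by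
  refine ⟨(((ContinuousLinearMap.mul ℂ ℂ).lpPairing volume 2 2) (hh.toLp h)).restrictScalars ℝ,
    fun u => ?_⟩
  have h1 := (ContinuousLinearMap.mul ℂ ℂ).lpPairing_eq_integral (μ := volume) (p := 2) (q := 2)
    (hh.toLp h) u
  rw [ContinuousLinearMap.coe_restrictScalars', h1]
  refine integral_congr_ae ?_
  filter_upwards [hh.coeFn_toLp] with ζ hζ
  rw [hζ, ContinuousLinearMap.mul_apply', mul_comm]

/-- The Fourier transform on `L²` is self-adjoint for the bilinear pairing. -/
theorem integral_mul_fourier (u : L2Plane) (ψ : 𝓢(Plane, ℂ)) :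
    ∫ z, u z * (𝓕 ψ) z = ∫ ζ, (𝓕 u : L2Plane) ζ * ψ ζ := by
  have h := congrArg (fun f : 𝓢'(Plane, ℂ) => f ψ) (Lp.fourier_toTemperedDistribution_eq u)
  simp only [TemperedDistribution.fourier_apply, Lp.toTemperedDistribution_apply,
    smul_eq_mul] at h
  simpa only [mul_comm] using h

/-- Multiplication of a Schwartz function by `-iξ`. -/
noncomputable def mulNegIXi (ψ : 𝓢(Plane, ℂ)) : 𝓢(Plane, ℂ) :=
  -(2 * Real.pi * Complex.I) • SchwartzMap.smulLeftCLM ℂ (inner ℝ · ex) ψ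

theorem mulNegIXi_apply (ψ : 𝓢(Plane, ℂ)) (ζ : Plane) :
    mulNegIXi ψ ζ = -(Complex.I * xi ζ) * ψ ζ := by
  have h : (inner ℝ · ex : Plane → ℝ).HasTemperateGrowth :=
    ((innerSL ℝ).flip ex).hasTemperateGrowth
  have h2 : inner ℝ ζ ex = ζ 0 := by simp [ex, EuclideanSpace.inner_single_right]
  unfold mulNegIXi xi
  rw [smul_apply, SchwartzMap.smulLeftCLM_apply_apply h, h2, Complex.real_smul,
    smul_eq_mul]
  push_cast; ring

theorem lineDeriv_fourier (ψ : 𝓢(Plane, ℂ)) : ∂_{ex} (𝓕 ψ) = 𝓕 (mulNegIXi ψ) :=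
  SchwartzMap.lineDerivOp_fourier_eq ψ ex

theorem enorm_eq_multNorm_one (u : L2Plane) : ‖u‖ₑ = multNorm 1 u := by
  have h : ‖u‖ₑ = ‖(𝓕 u : L2Plane)‖ₑ := by
    rw [← ofReal_norm, ← ofReal_norm, Lp.norm_fourier_eq]
  rw [h, Lp.enorm_def, multNorm]
  simp

theorem multNorm_mono {m m' : Plane → ℂ} (h : ∀ ζ, ‖m ζ‖ ≤ ‖m' ζ‖) (u : L2Plane) :
    multNorm m u ≤ multNorm m' u := by
  refine eLpNorm_mono_ae (Eventually.of_forall fun ζ => ?_)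
  rw [norm_mul, norm_mul]
  exact mul_le_mul_of_nonneg_right (h ζ) (norm_nonneg _)

theorem one_le_japanese (ζ : Plane) : 1 ≤ 1 + (|xi ζ| + |eta ζ|) ^ 2 := by
  have := sq_nonneg (|xi ζ| + |eta ζ|); linarith

theorem enorm_le_HNorm {s : ℝ} (hs : 0 ≤ s) (u : L2Plane) : ‖u‖ₑ ≤ HNorm s u := by
  rw [enorm_eq_multNorm_one, HNorm]
  refine multNorm_mono (fun ζ => ?_) u
  rw [Pi.one_apply, norm_one, Complex.norm_real]
  refine le_trans ?_ (le_abs_self _)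
  have h1 : 1 ≤ 1 + |xi ζ|⁻¹ := by have : 0 ≤ |xi ζ|⁻¹ := by positivity
                                   linarith
  have h2 := Real.one_le_rpow (one_le_japanese ζ) (by positivity : 0 ≤ s / 2)
  nlinarith

theorem JxNorm_le_HNorm {s : ℝ} (hs : 0 ≤ s) (u : L2Plane) : JxNorm s u ≤ HNorm s u := by
  refine multNorm_mono (fun ζ => ?_) u
  rw [Complex.norm_real, Complex.norm_real]
  have h1 : 1 ≤ 1 + |xi ζ|⁻¹ := by have : 0 ≤ |xi ζ|⁻¹ := by positivity
                                   linarith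
  have h2 : xi ζ ^ 2 ≤ (|xi ζ| + |eta ζ|) ^ 2 := by
    rw [← sq_abs]
    exact pow_le_pow_left₀ (abs_nonneg _) (by linarith [abs_nonneg (eta ζ)]) 2
  have h3 : (1 + xi ζ ^ 2) ^ (s / 2) ≤ (1 + (|xi ζ| + |eta ζ|) ^ 2) ^ (s / 2) :=
    Real.rpow_le_rpow (by positivity) (by linarith) (by positivity)
  have h4 : 0 ≤ (1 + xi ζ ^ 2) ^ (s / 2) := by positivity
  rw [Real.norm_of_nonneg h4, Real.norm_of_nonneg (mul_nonneg (by linarith) (h4.trans h3))]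
  nlinarith

theorem enorm_le_JxNorm {s : ℝ} (hs : 0 ≤ s) (u : L2Plane) : ‖u‖ₑ ≤ JxNorm s u := by
  rw [enorm_eq_multNorm_one]
  refine multNorm_mono (fun ζ => ?_) u
  rw [Pi.one_apply, norm_one, Complex.norm_real]
  exact (Real.one_le_rpow (by have := sq_nonneg (xi ζ); linarith) (by positivity)).trans
    (le_abs_self _)

/-- The Fourier transform of a multiplier operator on its domain. -/
theorem fourier_mult {m : Plane → ℂ} {u : L2Plane}
    (h : MemLp (fun ζ => m ζ * (𝓕 u : L2Plane) ζ) 2 volume) :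
    (𝓕 (mult m u) : L2Plane) =ᵐ[volume] fun ζ => m ζ * (𝓕 u : L2Plane) ζ := by
  rw [mult, dif_pos h, FourierTransform.fourier_fourierInv_eq]
  exact h.coeFn_toLp

/-- The weight `1 + |ξ|⁻¹` together with two derivatives dominates `η²/|ξ|`. Hence `u` lies in the
domain of the multiplier, and `mult` does not take its default value `0`. -/
theorem fourier_dxInvDyy {u : L2Plane} (hu : MemHInfty u) :
    (𝓕 (dxInvDyy u) : L2Plane) =ᵐ[volume]
      fun ζ => Complex.I * ((eta ζ ^ 2 / xi ζ : ℝ) : ℂ) * (𝓕 u : L2Plane) ζ := by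
  have hsymb : ∀ ζ : Plane, (Complex.I * (eta ζ : ℂ)) ^ 2 / (Complex.I * (xi ζ : ℂ)) =
      Complex.I * ((eta ζ ^ 2 / xi ζ : ℝ) : ℂ) := by
    intro ζ
    push_cast
    rw [mul_pow, Complex.I_sq]
    by_cases h : (xi ζ : ℂ) = 0
    · simp [h]
    · have := Complex.I_ne_zero
      field_simp
      rw [Complex.I_sq]
      ring
  have hmem : MemLp (fun ζ => (Complex.I * (eta ζ : ℂ)) ^ 2 / (Complex.I * (xi ζ : ℂ)) *
      (𝓕 u : L2Plane) ζ) 2 volume := by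
    refine ⟨AEStronglyMeasurable.mul (Measurable.aestronglyMeasurable (by fun_prop))
      (Lp.aestronglyMeasurable _), lt_of_le_of_lt ?_ (hu 2)⟩
    refine multNorm_mono (fun ζ => ?_) u
    rw [hsymb, norm_mul, Complex.norm_I, one_mul, Complex.norm_real, Complex.norm_real,
      Real.norm_eq_abs, abs_div, abs_of_nonneg (sq_nonneg (eta ζ)), div_eq_mul_inv]
    have h0 : 0 ≤ |xi ζ|⁻¹ := by positivity
    have h1 : (1 + (|xi ζ| + |eta ζ|) ^ 2) ^ ((2 : ℝ) / 2) = 1 + (|xi ζ| + |eta ζ|) ^ 2 := by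
      norm_num
    rw [h1, Real.norm_of_nonneg (mul_nonneg (by linarith) (by positivity))]
    have h2 : eta ζ ^ 2 ≤ 1 + (|xi ζ| + |eta ζ|) ^ 2 := by
      rw [← sq_abs (eta ζ)]
      have := pow_le_pow_left₀ (abs_nonneg (eta ζ))
        (by linarith [abs_nonneg (xi ζ)] : |eta ζ| ≤ |xi ζ| + |eta ζ|) 2
      linarith
    calc eta ζ ^ 2 * |xi ζ|⁻¹ ≤ (1 + (|xi ζ| + |eta ζ|) ^ 2) * (1 + |xi ζ|⁻¹) :=
          mul_le_mul h2 (by linarith) h0 (by positivity)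
      _ = _ := mul_comm _ _
  have := fourier_mult hmem
  simp only [hsymb] at this
  simpa only [dxInvDyy, hsymb] using this

theorem continuousOn_of_contHInfty {T : ℝ} {v : ℝ → L2Plane} (hv : ContHInfty T v) :
    ContinuousOn v (Icc 0 T) := by
  intro t₀ ht₀
  rw [ContinuousWithinAt, tendsto_iff_edist_tendsto_0]
  refine tendsto_of_tendsto_of_tendsto_of_le_of_le tendsto_const_nhds (hv.2 0 t₀ ht₀)
    (fun _ => zero_le) fun t => ?_
  simp only
  rw [edist_eq_enorm_sub]
  exact enorm_le_HNorm le_rfl _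

theorem continuous_fourier_L2 : Continuous fun u : L2Plane => (𝓕 u : L2Plane) :=
  (Lp.fourierTransformₗᵢ Plane ℂ).continuous

theorem ae_coord_ne_zero : ∀ᵐ ζ : Plane, ζ 0 ≠ 0 := by
  have h1 : ∀ᵐ z : ℝ × ℝ, z.1 ≠ 0 := by
    rw [Measure.volume_eq_prod]
    exact Measure.quasiMeasurePreserving_fst.ae (Measure.ae_ne volume (0 : ℝ))
  exact measurePreserving_coords.quasiMeasurePreserving.ae h1

theorem xi_ne_zero {ζ : Plane} (h : ζ 0 ≠ 0) : xi ζ ≠ 0 := by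
  unfold xi; have := Real.pi_pos; positivity

theorem continuousAt_omega {ζ : Plane} (h : ζ 0 ≠ 0) : ContinuousAt omega ζ := by
  have h1 : Continuous xi := by unfold xi; fun_prop
  have h2 : Continuous eta := by unfold eta; fun_prop
  exact (h1.continuousAt.pow 3).add ((h2.continuousAt.pow 2).div h1.continuousAt (xi_ne_zero h))

/-- The equation, tested against a function supported away from `ξ = 0` on the Fourier side. -/
theorem fourier_weak_form {T : ℝ} {v F : ℝ → L2Plane} (hv : ContHInfty T v)
    (hsol : IsSolution T v F) (hF : IntegrableOn F (Ioc 0 T)) {t : ℝ} (ht : t ∈ Icc 0 T)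
    {ψ : 𝓢(Plane, ℂ)} (hψ : HasCompactSupport ψ) (hψ0 : tsupport ψ ⊆ {ζ | ζ 0 ≠ 0}) :
    (∫ ζ, (𝓕 (v t) : L2Plane) ζ * ψ ζ) - (∫ ζ, (𝓕 (v 0) : L2Plane) ζ * ψ ζ) =
      (∫ ζ, (∫ s in Ioc 0 t, (𝓕 (v s) : L2Plane) : L2Plane) ζ * (Complex.I * omega ζ * ψ ζ)) +
      ∫ ζ, (∫ s in Ioc 0 t, (𝓕 (F s) : L2Plane) : L2Plane) ζ * (Complex.I * xi ζ * ψ ζ) := by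
  have hsub : Ioc 0 t ⊆ Icc 0 T := fun s hs => ⟨hs.1.le, hs.2.trans ht.2⟩
  -- `ω` is singular on the line `ξ = 0`, which the support of `ψ` avoids.
  have hω : MemLp (fun ζ => Complex.I * omega ζ * ψ ζ) 2 volume := by
    refine Continuous.memLp_of_hasCompactSupport ?_ hψ.mul_left
    refine continuous_of_tsupport fun ζ hζ => ?_
    have h1 : ζ ∈ tsupport ψ :=
      tsupport_mul_subset_right (f := fun ζ => Complex.I * (omega ζ : ℂ)) (g := ψ) hζ
    have h2 := continuousAt_omega (hψ0 h1)
    exact (continuousAt_const.mul (Complex.continuous_ofReal.continuousAt.comp h2)).mul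
      ψ.continuous.continuousAt
  have hξeq : (fun ζ => Complex.I * xi ζ * ψ ζ) = fun ζ => -(mulNegIXi ψ ζ) := by
    funext ζ; rw [mulNegIXi_apply]; ring
  have hξ : MemLp (fun ζ => Complex.I * xi ζ * ψ ζ) 2 volume := by
    rw [hξeq]; exact ((mulNegIXi ψ).memLp 2).neg
  have hξ3eq : (fun ζ => Complex.I * ((xi ζ ^ 3 : ℝ) : ℂ) * ψ ζ) =
      mulNegIXi (mulNegIXi (mulNegIXi ψ)) := by
    funext ζ
    rw [mulNegIXi_apply, mulNegIXi_apply, mulNegIXi_apply]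
    push_cast
    linear_combination (Complex.I * xi ζ ^ 3 * ψ ζ) * Complex.I_sq
  have hξ3 : MemLp (fun ζ => Complex.I * ((xi ζ ^ 3 : ℝ) : ℂ) * ψ ζ) 2 volume := by
    rw [hξ3eq]; exact (mulNegIXi (mulNegIXi (mulNegIXi ψ))).memLp 2
  obtain ⟨Lω, hLω⟩ := exists_pairing hω
  obtain ⟨Lξ, hLξ⟩ := exists_pairing hξ
  have hVc : ContinuousOn (fun s => (𝓕 (v s) : L2Plane)) (Icc 0 T) :=
    continuous_fourier_L2.comp_continuousOn (continuousOn_of_contHInfty hv)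
  have hVi : IntegrableOn (fun s => (𝓕 (v s) : L2Plane)) (Ioc 0 t) :=
    hVc.integrableOn_Icc.mono_set hsub
  have hΦi : IntegrableOn (fun s => (𝓕 (F s) : L2Plane)) (Ioc 0 t) :=
    (Lp.fourierTransformₗᵢ Plane ℂ).toContinuousLinearEquiv.toContinuousLinearMap.integrable_comp
      (hF.mono_set (Ioc_subset_Ioc_right ht.2))
  -- With the test function `𝓕 ψ`, each `∂_x` becomes `-iξ` on `ψ`: three of them give `iξ³`, the
  -- nonlocal term gives `iη²/ξ`, and the forcing gives `iξ`.
  have heq := (hsol (𝓕 ψ)).2 t ht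
  rw [integral_mul_fourier, integral_mul_fourier, intervalIntegral.integral_of_le ht.1] at heq
  rw [heq, ← hLω, ← hLξ, ← Lω.integral_comp_comm hVi, ← Lξ.integral_comp_comm hΦi,
    ← integral_add (Lω.integrable_comp hVi) (Lξ.integrable_comp hΦi)]
  refine setIntegral_congr_fun measurableSet_Ioc fun s hs => ?_
  have hs' := hsub hs
  simp only [lineDeriv_fourier, integral_mul_fourier]
  rw [hLω, hLξ, ← hξ3eq]
  simp only [mulNegIXi_apply]
  have e1 : ∫ ζ, (𝓕 (dxInvDyy (v s)) : L2Plane) ζ * ψ ζ =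
      ∫ ζ, Complex.I * ((eta ζ ^ 2 / xi ζ : ℝ) : ℂ) * (𝓕 (v s) : L2Plane) ζ * ψ ζ := by
    refine integral_congr_ae ?_
    filter_upwards [fourier_dxInvDyy (hv.1 s hs')] with ζ hζ
    rw [hζ]
  have i2 : Integrable fun ζ =>
      Complex.I * ((eta ζ ^ 2 / xi ζ : ℝ) : ℂ) * (𝓕 (v s) : L2Plane) ζ * ψ ζ := by
    refine (integrable_L2_mul (𝓕 (dxInvDyy (v s)) : L2Plane) (ψ.memLp 2)).congr ?_
    filter_upwards [fourier_dxInvDyy (hv.1 s hs')] with ζ hζ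
    rw [hζ]
  rw [e1, ← integral_add (integrable_L2_mul _ hξ3) i2, sub_eq_add_neg]
  congr 1
  · refine integral_congr_ae (Eventually.of_forall fun ζ => ?_)
    simp only [omega]
    push_cast; ring
  · rw [← integral_neg]
    refine integral_congr_ae (Eventually.of_forall fun ζ => ?_)
    simp only
    ring

/-- The equation integrated in time, pointwise almost everywhere on the Fourier side. -/
theorem fourier_solution {T : ℝ} {v F : ℝ → L2Plane} (hv : ContHInfty T v)
    (hsol : IsSolution T v F) (hF : IntegrableOn F (Ioc 0 T)) {t : ℝ} (ht : t ∈ Icc 0 T) :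
    (𝓕 (v t) : L2Plane) =ᵐ[volume] fun ζ => (𝓕 (v 0) : L2Plane) ζ
      + Complex.I * omega ζ * (∫ s in Ioc 0 t, (𝓕 (v s) : L2Plane) : L2Plane) ζ
      + Complex.I * xi ζ * (∫ s in Ioc 0 t, (𝓕 (F s) : L2Plane) : L2Plane) ζ := by
  set P : L2Plane := ∫ s in Ioc 0 t, (𝓕 (v s) : L2Plane) with hP
  set Q : L2Plane := ∫ s in Ioc 0 t, (𝓕 (F s) : L2Plane) with hQ
  set U : Set Plane := {ζ | ζ 0 ≠ 0} with hU
  have hUo : IsOpen U := isOpen_ne_fun (by fun_prop) continuous_const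
  have hloc : ∀ u : L2Plane, LocallyIntegrableOn u U := fun u =>
    ((Lp.memLp u).locallyIntegrable (by norm_num)).locallyIntegrableOn U
  have cω : ContinuousOn (fun ζ => Complex.I * (omega ζ : ℂ)) U := fun ζ hζ =>
    (continuousAt_const.mul (Complex.continuous_ofReal.continuousAt.comp
      (continuousAt_omega hζ))).continuousWithinAt
  have cξ : ContinuousOn (fun ζ => Complex.I * (xi ζ : ℂ)) U := by
    unfold xi; fun_prop
  have hlf : LocallyIntegrableOn (fun ζ => (𝓕 (v t) : L2Plane) ζ - (𝓕 (v 0) : L2Plane) ζ -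
      (Complex.I * omega ζ * P ζ + Complex.I * xi ζ * Q ζ)) U :=
    ((hloc _).sub (hloc _)).sub (((hloc P).continuousOn_mul cω hUo.isLocallyClosed).add
      ((hloc Q).continuousOn_mul cξ hUo.isLocallyClosed))
  -- The fundamental lemma of the calculus of variations on the open set `ξ ≠ 0`, whose complement
  -- is null.
  have key := hUo.ae_eq_zero_of_integral_contDiff_smul_eq_zero hlf ?_
  · filter_upwards [key, ae_coord_ne_zero] with ζ h1 h2
    have := h1 h2
    rw [sub_eq_zero] at this
    rw [add_assoc, ← this]; ring
  · intro g hg hgc hgU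
    have hgC : ContDiff ℝ ((⊤ : ℕ∞) : WithTop ℕ∞) fun ζ => (g ζ : ℂ) := Complex.ofRealCLM.contDiff.comp hg
    have hgcC : HasCompactSupport fun ζ => (g ζ : ℂ) := hgc.comp_left Complex.ofReal_zero
    set ψ : 𝓢(Plane, ℂ) := hgcC.toSchwartzMap hgC with hψ
    have hψa : ∀ ζ, ψ ζ = g ζ := fun ζ => rfl
    have hψs : tsupport ψ ⊆ U := (tsupport_comp_subset Complex.ofReal_zero g).trans hgU
    have hψc : HasCompactSupport ψ := hgcC
    have hw := fourier_weak_form hv hsol hF ht hψc hψs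
    rw [← hP, ← hQ] at hw
    have mω : MemLp (fun ζ => Complex.I * omega ζ * ψ ζ) 2 volume := by
      refine Continuous.memLp_of_hasCompactSupport ?_ hψc.mul_left
      refine continuous_of_tsupport fun ζ hζ => ?_
      have h1 : ζ ∈ tsupport ψ :=
        tsupport_mul_subset_right (f := fun ζ => Complex.I * (omega ζ : ℂ)) (g := ψ) hζ
      exact ((cω ζ (hψs h1)).continuousAt (hUo.mem_nhds (hψs h1))).mul ψ.continuous.continuousAt
    have mξ : MemLp (fun ζ => Complex.I * xi ζ * ψ ζ) 2 volume := by
      refine Continuous.memLp_of_hasCompactSupport ?_ hψc.mul_left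
      have := ψ.continuous
      unfold xi; fun_prop
    have i1 := integrable_L2_mul (𝓕 (v t) : L2Plane) (ψ.memLp 2)
    have i2 := integrable_L2_mul (𝓕 (v 0) : L2Plane) (ψ.memLp 2)
    have i3 := integrable_L2_mul P mω
    have i4 := integrable_L2_mul Q mξ
    have hd := integral_sub (i1.sub i2) (i3.add i4)
    simp only [Pi.sub_apply, Pi.add_apply] at hd
    rw [← integral_sub i1 i2, ← integral_add i3 i4, ← sub_eq_zero, ← hd] at hw
    rw [← hw]
    refine integral_congr_ae (Eventually.of_forall fun ζ => ?_)
    simp only [Complex.real_smul, hψa]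
    ring

/-- The short time intervals start at arbitrary times `a`; subtracting the identities at `t` and `a`
restarts the equation there. -/
theorem fourier_solution_from {T : ℝ} {v F : ℝ → L2Plane} (hv : ContHInfty T v)
    (hsol : IsSolution T v F) (hF : IntegrableOn F (Ioc 0 T)) {a t : ℝ} (ha : 0 ≤ a) (hat : a ≤ t)
    (ht : t ≤ T) :
    (𝓕 (v t) : L2Plane) =ᵐ[volume] fun ζ => (𝓕 (v a) : L2Plane) ζ
      + Complex.I * omega ζ * (∫ s in Ioc a t, (𝓕 (v s) : L2Plane) : L2Plane) ζ
      + Complex.I * xi ζ * (∫ s in Ioc a t, (𝓕 (F s) : L2Plane) : L2Plane) ζ := by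
  have hVc : ContinuousOn (fun s => (𝓕 (v s) : L2Plane)) (Icc 0 T) :=
    continuous_fourier_L2.comp_continuousOn (continuousOn_of_contHInfty hv)
  have hVi : IntegrableOn (fun s => (𝓕 (v s) : L2Plane)) (Ioc 0 T) :=
    hVc.integrableOn_Icc.mono_set Ioc_subset_Icc_self
  have hΦi : IntegrableOn (fun s => (𝓕 (F s) : L2Plane)) (Ioc 0 T) :=
    (Lp.fourierTransformₗᵢ Plane ℂ).toContinuousLinearEquiv.toContinuousLinearMap.integrable_comp
      hF
  have split : ∀ f : ℝ → L2Plane, IntegrableOn f (Ioc 0 T) →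
      ∫ s in Ioc 0 t, f s = (∫ s in Ioc 0 a, f s) + ∫ s in Ioc a t, f s := by
    intro f hf
    rw [← Ioc_union_Ioc_eq_Ioc ha hat]
    exact setIntegral_union (Ioc_disjoint_Ioc_of_le le_rfl) measurableSet_Ioc
      (hf.mono_set (Ioc_subset_Ioc_right (hat.trans ht)))
      (hf.mono_set (Ioc_subset_Ioc ha ht))
  have h1 := fourier_solution hv hsol hF (t := t) ⟨ha.trans hat, ht⟩
  have h2 := fourier_solution hv hsol hF (t := a) ⟨ha, hat.trans ht⟩
  rw [split _ hVi, split _ hΦi] at h1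
  filter_upwards [h1, h2, Lp.coeFn_add (∫ s in Ioc 0 a, (𝓕 (v s) : L2Plane))
    (∫ s in Ioc a t, (𝓕 (v s) : L2Plane)), Lp.coeFn_add (∫ s in Ioc 0 a, (𝓕 (F s) : L2Plane))
    (∫ s in Ioc a t, (𝓕 (F s) : L2Plane))] with ζ e1 e2 e3 e4
  rw [e1, e2, e3, e4, Pi.add_apply, Pi.add_apply]
  ring

/-! ### Test curves and the localized estimate along a path. -/

/-- The oscillating factor `exp (i (2π z·ζ + t ω))`. -/
noncomputable def osc (t : ℝ) (z ζ : Plane) : ℂ :=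
  Complex.exp (Complex.I * ((2 * Real.pi * (z 0 * ζ 0 + z 1 * ζ 1) + t * omega ζ : ℝ) : ℂ))

theorem norm_osc (t : ℝ) (z ζ : Plane) : ‖osc t z ζ‖ = 1 := by
  rw [osc, mul_comm, Complex.norm_exp_ofReal_mul_I]

@[fun_prop]
theorem measurable_osc (t : ℝ) (z : Plane) : Measurable (osc t z) := by
  unfold osc; fun_prop

theorem conj_osc (t : ℝ) (z ζ : Plane) : (starRingEnd ℂ) (osc t z ζ) = osc (-t) (-z) ζ := by
  unfold osc
  rw [← Complex.exp_conj, map_mul, Complex.conj_I, Complex.conj_ofReal]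
  congr 1
  simp only [PiLp.neg_apply]
  push_cast; ring

theorem osc_mul (t t' : ℝ) (z z' ζ : Plane) :
    osc t z ζ * osc t' z' ζ = osc (t + t') (z + z') ζ := by
  unfold osc
  rw [← Complex.exp_add]
  congr 1
  simp only [PiLp.add_apply]
  push_cast; ring

theorem continuous_osc (ζ : Plane) : Continuous fun p : ℝ × Plane => osc p.1 p.2 ζ := by
  unfold osc; fun_prop

theorem weight_nonneg (δ : ℝ) (k : ℕ) (ζ : Plane) : 0 ≤ weight δ k ζ := by
  unfold weight; split_ifs <;> positivity

theorem memLp_weight_osc (k : ℕ) {δ : ℝ} (hδ : 0 < δ) (t : ℝ) (z : Plane) :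
    MemLp (fun ζ => (weight δ k ζ : ℂ) * osc t z ζ) 2 volume := by
  rw [memLp_two_iff_integrable_sq_norm (Measurable.aestronglyMeasurable (by fun_prop))]
  refine (integrable_weight_sq k hδ).congr (Eventually.of_forall fun ζ => ?_)
  simp only [norm_mul, norm_osc, mul_one, Complex.norm_real, Real.norm_eq_abs, sq_abs]

/-- The test curve `w exp (-i (2π z·ζ + t ω))` in `L²`. -/
noncomputable def wave (k : ℕ) {δ : ℝ} (hδ : 0 < δ) (p : ℝ × Plane) : L2Plane :=
  (memLp_weight_osc k hδ (-p.1) (-p.2)).toLp _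

/-- The phases combine, so the Gram matrix is the dispersive kernel at the difference `p - q`. A
bound uniform in space therefore applies along any path. -/
theorem inner_wave (k : ℕ) {δ : ℝ} (hδ : 0 < δ) (p q : ℝ × Plane) :
    (inner ℂ (wave k hδ p) (wave k hδ q) : ℂ) =
      ∫ ζ, ((weight δ k ζ ^ 2 : ℝ) : ℂ) * osc (p.1 - q.1) (p.2 - q.2) ζ := by
  rw [L2.inner_def]
  refine integral_congr_ae ?_
  filter_upwards [(memLp_weight_osc k hδ (-p.1) (-p.2)).coeFn_toLp,
    (memLp_weight_osc k hδ (-q.1) (-q.2)).coeFn_toLp] with ζ h1 h2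
  unfold wave
  rw [h1, h2, RCLike.inner_apply, map_mul, conj_osc, Complex.conj_ofReal, neg_neg, neg_neg,
    sub_eq_neg_add, sub_eq_neg_add, ← osc_mul]
  push_cast; ring

theorem continuous_kernel (k : ℕ) {δ : ℝ} (hδ : 0 < δ) :
    Continuous fun p : ℝ × Plane => ∫ ζ, ((weight δ k ζ ^ 2 : ℝ) : ℂ) * osc p.1 p.2 ζ := by
  refine continuous_of_dominated (bound := fun ζ => weight δ k ζ ^ 2)
    (fun p => Measurable.aestronglyMeasurable (by fun_prop))
    (fun p => Eventually.of_forall fun ζ => ?_) (integrable_weight_sq k hδ)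
    (Eventually.of_forall fun ζ => continuous_const.mul (continuous_osc ζ))
  rw [norm_mul, norm_osc, mul_one, Complex.norm_real, Real.norm_of_nonneg (sq_nonneg _)]

/-- Expanding the square, `‖wave p - wave q‖² = 2 Re K(0) - 2 Re K(p - q)`, so continuity of the
kernel is enough. -/
theorem continuous_wave (k : ℕ) {δ : ℝ} (hδ : 0 < δ) : Continuous (wave k hδ) := by
  refine continuous_iff_continuousAt.2 fun q => ?_
  set K : ℝ × Plane → ℂ := fun p => ∫ ζ, ((weight δ k ζ ^ 2 : ℝ) : ℂ) * osc p.1 p.2 ζ with hK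
  have hn : ∀ p, ‖wave k hδ p‖ ^ 2 = (K 0).re := by
    intro p
    have h := inner_wave k hδ p p
    rw [inner_self_eq_norm_sq_to_K, sub_self, sub_self] at h
    have h2 := congrArg Complex.re h
    rw [hK]
    simp only [Prod.fst_zero, Prod.snd_zero]
    rw [← h2]
    norm_cast
  have hd : ∀ p, ‖wave k hδ p - wave k hδ q‖ ^ 2 = 2 * (K 0).re - 2 * (K (p - q)).re := by
    intro p
    rw [norm_sub_sq (𝕜 := ℂ), hn, hn, inner_wave]
    simp only [hK, Prod.fst_sub, Prod.snd_sub]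
    rw [RCLike.re_eq_complex_re]
    ring
  have hKc : Continuous K := continuous_kernel k hδ
  have h1 : Tendsto (fun p => ‖wave k hδ p - wave k hδ q‖ ^ 2) (𝓝 q) (𝓝 0) := by
    simp only [hd]
    have hc : Continuous fun p => 2 * (K 0).re - 2 * (K (p - q)).re := by fun_prop
    have := hc.tendsto q
    simpa using this
  rw [ContinuousAt, tendsto_iff_norm_sub_tendsto_zero]
  have h2 := h1.sqrt
  simpa using h2

theorem norm_inner_wave_le (k : ℕ) {δ θ : ℝ} (hδ : 0 < δ) (h0 : 0 ≤ θ) (h1 : θ ≤ 1)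
    {p q : ℝ × Plane} (hne : p.1 ≠ q.1) (hle : |p.1 - q.1| ≤ 1) :
    ‖(inner ℂ (wave k hδ p) (wave k hδ q) : ℂ)‖ ≤
      2 * (((2 : ℝ) ^ k) ^ (3 * θ / 2) * |p.1 - q.1| ^ (-1 + θ / 2)) := by
  rw [inner_wave]
  exact norm_kernel_le k hδ (sub_ne_zero.2 hne) hle h0 h1 (p.2 - q.2)

/-- The frequencies of a dyadic range on which `ω` is bounded. -/
def boundedPiece (k : ℕ) (R : ℝ) : Set Plane := {ζ | ζ ∈ piece k ∧ |omega ζ| ≤ R}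

theorem measurableSet_boundedPiece (k : ℕ) (R : ℝ) : MeasurableSet (boundedPiece k R) :=
  (measurableSet_piece k).inter
    (measurableSet_le (continuous_abs.measurable.comp measurable_omega) measurable_const)

theorem abs_xi_le_of_mem_piece {k : ℕ} {ζ : Plane} (h : ζ ∈ piece k) :
    |xi ζ| ≤ 2 * Real.pi * 2 ^ k := by
  have hπ := Real.pi_pos
  rw [xi, abs_mul, abs_of_pos (by positivity : 0 < 2 * Real.pi)]
  exact mul_le_mul_of_nonneg_left h.2.2.le (by positivity)

theorem pow_rpow_le_of_mem_piece {k : ℕ} {ζ : Plane} (h : ζ ∈ piece k) {s : ℝ} (hs : 0 ≤ s) :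
    ((2 : ℝ) ^ k) ^ s ≤ (1 + xi ζ ^ 2) ^ (s / 2) := by
  have h1 : ((2 : ℝ) ^ k) ^ 2 ≤ 1 + xi ζ ^ 2 := by
    by_cases hk : k = 0
    · rw [hk]; have := sq_nonneg (xi ζ); norm_num; exact this
    · have h2 := h.2.1
      rw [dyadicLow, if_neg hk] at h2
      have h3 : (2 : ℝ) ^ k ≤ |xi ζ| := by
        rw [xi, abs_mul, abs_of_pos (by have := Real.pi_pos; positivity : 0 < 2 * Real.pi)]
        have := Real.pi_gt_three
        have h4 : (0 : ℝ) < 2 ^ k := by positivity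
        nlinarith
      rw [← sq_abs (xi ζ)]
      have := pow_le_pow_left₀ (by positivity) h3 2
      linarith
  calc ((2 : ℝ) ^ k) ^ s = (((2 : ℝ) ^ k) ^ 2) ^ (s / 2) := by
        rw [← Real.rpow_natCast _ 2, ← Real.rpow_mul (by positivity)]
        congr 1; push_cast; ring
    _ ≤ _ := Real.rpow_le_rpow (by positivity) h1 (by positivity)

/-- Bernstein-type bound of a frequency-localized multiplier by the `J_x^s` norm. -/
theorem enorm_mulL_phaseMul_le {k : ℕ} {S : Set Plane} (hS : MeasurableSet S) (hSk : S ⊆ piece k)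
    {b : Plane → ℂ} (hb : Measurable b) {C : ℝ} (hC : 0 ≤ C) (hbC : ∀ ζ ∈ S, ‖b ζ‖ ≤ C)
    {s : ℝ} (hs : 0 ≤ s) (t : ℝ) (u : L2Plane) :
    ‖mulL (toLinf (phaseMul S b t)) (𝓕 u : L2Plane)‖ₑ ≤
      ENNReal.ofReal (C * ((2 : ℝ) ^ k) ^ (-s)) * JxNorm s u := by
  rw [Lp.enorm_def, JxNorm, multNorm]
  refine eLpNorm_le_mul_eLpNorm_of_ae_le_mul ?_ 2
  filter_upwards [coeFn_mulL_toLinf (memLp_phaseMul hS hb hC hbC t) (𝓕 u : L2Plane)] with ζ hζ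
  rw [hζ, norm_mul, norm_mul, ← mul_assoc]
  refine mul_le_mul_of_nonneg_right ?_ (norm_nonneg _)
  rw [Complex.norm_real, Real.norm_of_nonneg (by positivity)]
  by_cases h : ζ ∈ S
  · rw [mul_assoc]
    have h2 : 1 ≤ ((2 : ℝ) ^ k) ^ (-s) * (1 + xi ζ ^ 2) ^ (s / 2) := by
      rw [Real.rpow_neg (by positivity), inv_mul_eq_div, one_le_div (by positivity)]
      exact pow_rpow_le_of_mem_piece (hSk h) hs
    have h3 : ‖phaseMul S b t ζ‖ ≤ C := norm_phaseMul_le hC hbC t ζ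
    nlinarith
  · rw [phaseMul, indicator_of_notMem h, norm_zero]; positivity

/-- Cauchy–Schwarz: `(1 + |ζ|²)⁻¹` is in `L²(ℝ²)`, and so is `(1 + |ζ|²) û`. -/
theorem integrable_fourier {u : L2Plane} (hu : MemHInfty u) :
    Integrable (fun ζ => (𝓕 u : L2Plane) ζ) := by
  have h1 : MemLp (fun ζ : Plane => ((1 + ‖ζ‖ ^ 2) ^ (-1 : ℝ) : ℝ)) 2 volume := by
    rw [memLp_two_iff_integrable_sq (Continuous.aestronglyMeasurable
      ((by fun_prop : Continuous fun ζ : Plane => 1 + ‖ζ‖ ^ 2).rpow_const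
        fun ζ => Or.inl (by positivity)))]
    have := integrable_rpow_neg_one_add_norm_sq (E := Plane) (μ := volume) (r := 4)
      (by simp; norm_num)
    refine this.congr (Eventually.of_forall fun ζ => ?_)
    simp only
    rw [← Real.rpow_natCast ((1 + ‖ζ‖ ^ 2) ^ (-1 : ℝ)) 2, ← Real.rpow_mul (by positivity)]
    norm_num
  have h2 : MemLp (fun ζ => ((1 + ‖ζ‖ ^ 2 : ℝ) : ℂ) * (𝓕 u : L2Plane) ζ) 2 volume := by
    refine ⟨(Continuous.aestronglyMeasurable (by fun_prop)).mul (Lp.aestronglyMeasurable _),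
      lt_of_le_of_lt ?_ (hu 2)⟩
    refine multNorm_mono (fun ζ => ?_) u
    have h0 : 0 ≤ |xi ζ|⁻¹ := by positivity
    have h1 : (1 + (|xi ζ| + |eta ζ|) ^ 2) ^ ((2 : ℝ) / 2) = 1 + (|xi ζ| + |eta ζ|) ^ 2 := by
      norm_num
    rw [h1, Complex.norm_real, Complex.norm_real, Real.norm_of_nonneg (by positivity),
      Real.norm_of_nonneg (mul_nonneg (by linarith) (by positivity))]
    have h3 : ‖ζ‖ ^ 2 ≤ (|xi ζ| + |eta ζ|) ^ 2 := by
      rw [EuclideanSpace.norm_sq_eq, Fin.sum_univ_two, Real.norm_eq_abs, Real.norm_eq_abs]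
      have hπ := Real.pi_gt_three
      have e1 : |ζ 0| ≤ |xi ζ| := by
        rw [xi, abs_mul, abs_of_pos (by linarith : 0 < 2 * Real.pi)]
        nlinarith [abs_nonneg (ζ 0)]
      have e2 : |ζ 1| ≤ |eta ζ| := by
        rw [eta, abs_mul, abs_of_pos (by linarith : 0 < 2 * Real.pi)]
        nlinarith [abs_nonneg (ζ 1)]
      nlinarith [abs_nonneg (ζ 0), abs_nonneg (ζ 1)]
    nlinarith [sq_nonneg (|xi ζ| + |eta ζ|)]
  have h3 := h1.ofReal (K := ℂ) |>.integrable_mul h2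
  refine h3.congr (Eventually.of_forall fun ζ => ?_)
  simp only [Pi.mul_apply]
  rw [← mul_assoc]
  have : (((1 + ‖ζ‖ ^ 2) ^ (-1 : ℝ) : ℝ) : ℂ) * ((1 + ‖ζ‖ ^ 2 : ℝ) : ℂ) = 1 := by
    rw [← Complex.ofReal_mul, Real.rpow_neg_one, inv_mul_cancel₀ (by positivity),
      Complex.ofReal_one]
  erw [this, one_mul]

/-- The frequency-localized part of `u`, as a pointwise defined function. -/
noncomputable def localPart (k : ℕ) (u : L2Plane) (z : Plane) : ℂ :=
  ∫ ζ in piece k, osc 0 z ζ * (𝓕 u : L2Plane) ζ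

/-- The factors `exp (± i t ω)` of the test curve and of the profile cancel, leaving a regularized
inverse Fourier transform at `z`. -/
theorem inner_wave_mulL (k : ℕ) {δ : ℝ} (hδ : 0 < δ) (R : ℝ) (t : ℝ) (z : Plane) (u : L2Plane) :
    (inner ℂ (wave k hδ (t, z)) (mulL (toLinf (phaseMul (boundedPiece k R) 1 t)) u) : ℂ) =
      ∫ ζ, (boundedPiece k R).indicator (fun ζ => (weight δ k ζ : ℂ) * (osc 0 z ζ * u ζ)) ζ := by
  rw [L2.inner_def]
  refine integral_congr_ae ?_
  filter_upwards [(memLp_weight_osc k hδ (-t) (-z)).coeFn_toLp,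
    coeFn_mulL_toLinf (memLp_phaseMul (measurableSet_boundedPiece k R) (b := 1) measurable_const
      zero_le_one (fun ζ _ => by simp) t) u] with ζ h1 h2
  rw [h2]
  unfold wave
  rw [h1, RCLike.inner_apply, map_mul, conj_osc, Complex.conj_ofReal, neg_neg, neg_neg]
  unfold phaseMul
  by_cases h : ζ ∈ boundedPiece k R
  · rw [indicator_of_mem h, indicator_of_mem h, Pi.one_apply, one_mul]
    have : osc t z ζ = osc 0 z ζ * Complex.exp (Complex.I * (t * omega ζ : ℝ)) := by
      unfold osc
      rw [← Complex.exp_add]; congr 1; push_cast; ring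
    rw [this]
    have h3 : Complex.exp (-(Complex.I * (t * omega ζ : ℝ))) *
        Complex.exp (Complex.I * (t * omega ζ : ℝ)) = 1 := by
      rw [← Complex.exp_add, neg_add_cancel, Complex.exp_zero]
    linear_combination ((weight δ k ζ : ℂ) * osc 0 z ζ * u ζ) * h3
  · rw [indicator_of_notMem h, indicator_of_notMem h]; ring

/-- Removes both regularizations at once, by dominated convergence against `|û|`. The summand `2π
2^k` in the cutoff makes it also bound `|ξ|`, as `duhamel` requires. -/
theorem tendsto_inner_wave_mulL (k : ℕ) (t : ℝ) (z : Plane) {u : L2Plane} (hu : MemHInfty u) :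
    Tendsto (fun n : ℕ => (inner ℂ (wave k (by positivity : (0 : ℝ) < 1 / (n + 1)) (t, z))
      (mulL (toLinf (phaseMul (boundedPiece k (n + 2 * Real.pi * 2 ^ k)) 1 t))
        (𝓕 u : L2Plane)) : ℂ)) atTop (𝓝 (localPart k u z)) := by
  simp only [inner_wave_mulL]
  rw [localPart, ← integral_indicator (measurableSet_piece k)]
  have hint := integrable_fourier hu
  refine tendsto_integral_of_dominated_convergence (fun ζ => ‖(𝓕 u : L2Plane) ζ‖) (fun n => ?_)
    hint.norm (fun n => Eventually.of_forall fun ζ => ?_) (Eventually.of_forall fun ζ => ?_)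
  · refine AEStronglyMeasurable.indicator ?_ (measurableSet_boundedPiece _ _)
    refine (Measurable.aestronglyMeasurable (by fun_prop)).mul
      ((Measurable.aestronglyMeasurable (by fun_prop)).mul (Lp.aestronglyMeasurable _))
  · refine (norm_indicator_le_norm_self _ _).trans ?_
    rw [norm_mul, norm_mul, norm_osc, one_mul, Complex.norm_real]
    refine mul_le_of_le_one_left (norm_nonneg _) ?_
    rw [Real.norm_of_nonneg (weight_nonneg _ _ _), weight]
    split_ifs
    · rw [Real.exp_le_one_iff, neg_nonpos]
      have := Real.pi_pos
      positivity
    · exact zero_le_one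
  · by_cases h : ζ ∈ piece k
    · rw [indicator_of_mem h]
      have hπ := Real.pi_pos
      have hw : Tendsto (fun n : ℕ => (weight (1 / (n + 1)) k ζ : ℂ)) atTop (𝓝 1) := by
        rw [← Complex.ofReal_one]
        refine (Complex.continuous_ofReal.tendsto 1).comp ?_
        simp only [weight, if_pos h]
        have hc : Continuous fun d : ℝ => Real.exp (-(Real.pi * d * ζ 1 ^ 2 / |ζ 0|)) := by
          fun_prop
        have := (hc.tendsto 0).comp (tendsto_one_div_add_atTop_nhds_zero_nat (𝕜 := ℝ))
        simpa [Function.comp_def] using this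
      have h2 := hw.mul_const (osc 0 z ζ * (𝓕 u : L2Plane) ζ)
      rw [one_mul] at h2
      refine h2.congr' ?_
      obtain ⟨N, hN⟩ := exists_nat_ge |omega ζ|
      filter_upwards [eventually_ge_atTop N] with n hn
      have hmem : ζ ∈ boundedPiece k (n + 2 * Real.pi * 2 ^ k) := by
        refine ⟨h, hN.trans ?_⟩
        have : (N : ℝ) ≤ n := by exact_mod_cast hn
        have h3 : 0 ≤ 2 * Real.pi * 2 ^ k := by positivity
        linarith
      rw [indicator_of_mem hmem]
    · rw [indicator_of_notMem h]
      have : ∀ n : ℕ, ζ ∉ boundedPiece k (n + 2 * Real.pi * 2 ^ k) := fun n hn => h hn.1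
      simp only [indicator_of_notMem (this _)]
      exact tendsto_const_nhds

theorem continuousOn_mulL_phaseMul {T : ℝ} {v : ℝ → L2Plane} (hv : ContHInfty T v) (k : ℕ) (R : ℝ) :
    ContinuousOn (fun t => mulL (toLinf (phaseMul (boundedPiece k R) 1 t)) (𝓕 (v t) : L2Plane))
      (Icc 0 T) := by
  have hA : Continuous fun t => toLinf (phaseMul (boundedPiece k R) 1 t) :=
    continuous_toLinf_phaseMul (measurableSet_boundedPiece k R) measurable_const zero_le_one
      (fun ζ _ => by simp) (R := R) fun ζ h => h.2
  have hV : ContinuousOn (fun s => (𝓕 (v s) : L2Plane)) (Icc 0 T) :=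
    continuous_fourier_L2.comp_continuousOn (continuousOn_of_contHInfty hv)
  exact (mulL.continuous.comp hA).continuousOn.clm_apply hV

theorem norm_wave_eq (k : ℕ) {δ : ℝ} (hδ : 0 < δ) (p : ℝ × Plane) :
    ‖wave k hδ p‖ = ‖wave k hδ 0‖ := by
  have h : ∀ p, ((‖wave k hδ p‖ : ℂ)) ^ 2 =
      ∫ ζ, ((weight δ k ζ ^ 2 : ℝ) : ℂ) * osc 0 0 ζ := fun p => by
    have := inner_wave k hδ p p
    rw [inner_self_eq_norm_sq_to_K, sub_self, sub_self] at this
    exact this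
  have h2 : ‖wave k hδ p‖ ^ 2 = ‖wave k hδ 0‖ ^ 2 := by
    have := (h p).trans (h 0).symm
    exact_mod_cast this
  exact (pow_left_inj₀ (norm_nonneg _) (norm_nonneg _) two_ne_zero).1 h2

/-- The frequency-localized estimate on a short time interval, along a measurable path, before
removing the regularization. -/
theorem lintegral_inner_wave_le (k : ℕ) {θ s T : ℝ} (hθ : 0 < θ) (hθ1 : θ ≤ 1) (hs : 0 ≤ s)
    {v F : ℝ → L2Plane} (hv : ContHInfty T v) (hsol : IsSolution T v F)
    (hF : IntegrableOn F (Ioc 0 T)) {a b : ℝ} (ha : 0 ≤ a) (hab : a ≤ b) (hb : b ≤ T)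
    (hlen : b - a ≤ ((2 : ℝ) ^ k)⁻¹) {z : ℝ → Plane} (hz : Measurable z) {δ : ℝ} (hδ : 0 < δ)
    {R : ℝ} (hR : 2 * Real.pi * 2 ^ k ≤ R) :
    AEStronglyMeasurable (fun t => (inner ℂ (wave k hδ (t, z t))
      (mulL (toLinf (phaseMul (boundedPiece k R) 1 t)) (𝓕 (v t) : L2Plane)) : ℂ))
      (volume.restrict (Ioc a b)) ∧
    ∫⁻ t in Ioc a b, ‖(inner ℂ (wave k hδ (t, z t))
      (mulL (toLinf (phaseMul (boundedPiece k R) 1 t)) (𝓕 (v t) : L2Plane)) : ℂ)‖ₑ ≤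
      ENNReal.ofReal (√(8 / θ) * ((2 : ℝ) ^ k) ^ ((θ - 1) / 2)) *
        (ENNReal.ofReal (((2 : ℝ) ^ k) ^ (-s)) * JxNorm s (v a) +
          ENNReal.ofReal (2 * Real.pi * 2 ^ k * ((2 : ℝ) ^ k) ^ (-s)) *
            ∫⁻ t in Ioc a b, JxNorm s (F t)) := by
  set β : ℝ := 2 ^ k with hβ
  have hβ1 : 1 ≤ β := one_le_pow₀ (by norm_num)
  have hβ0 : 0 < β := by positivity
  have hπ := Real.pi_pos
  set S := boundedPiece k R with hS
  have hSm : MeasurableSet S := measurableSet_boundedPiece k R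
  have hSk : S ⊆ piece k := fun ζ h => h.1
  have hR0 : 0 ≤ R := le_trans (by positivity) hR
  have hsubT : Icc a b ⊆ Icc 0 T := Icc_subset_Icc ha hb
  have hsubF : Ioc a b ⊆ Ioc 0 T := Ioc_subset_Ioc ha hb
  set E : ℝ → L2Plane := fun t => wave k hδ (t, z t) with hE
  set f : ℝ → L2Plane := fun t => mulL (toLinf (phaseMul S 1 t)) (𝓕 (v t) : L2Plane) with hf
  set g : ℝ → L2Plane := fun t =>
    mulL (toLinf (phaseMul S (fun ζ => Complex.I * xi ζ) t)) (𝓕 (F t) : L2Plane) with hg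
  have mξ : Measurable fun ζ => Complex.I * (xi ζ : ℂ) := by fun_prop
  have bξ : ∀ ζ ∈ S, ‖Complex.I * (xi ζ : ℂ)‖ ≤ 2 * Real.pi * β := fun ζ h => by
    rw [norm_mul, Complex.norm_I, one_mul, Complex.norm_real]
    exact abs_xi_le_of_mem_piece (hSk h)
  have hEm : StronglyMeasurable E :=
    (continuous_wave k hδ).comp_stronglyMeasurable
      (measurable_id.prodMk hz).stronglyMeasurable
  have hEi : IntegrableOn E (Ioc a b) :=
    Measure.integrableOn_of_bounded (M := ‖wave k hδ 0‖) (by simp) hEm.aestronglyMeasurable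
      (Eventually.of_forall fun t => (norm_wave_eq k hδ _).le)
  have hVi : IntegrableOn (fun s => (𝓕 (v s) : L2Plane)) (Ioc a b) :=
    ((continuous_fourier_L2.comp_continuousOn
      (continuousOn_of_contHInfty hv)).integrableOn_Icc).mono_set (Ioc_subset_Icc_self.trans hsubT)
  have hΦi : IntegrableOn (fun s => (𝓕 (F s) : L2Plane)) (Ioc a b) :=
    (Lp.fourierTransformₗᵢ Plane ℂ).toContinuousLinearEquiv.toContinuousLinearMap.integrable_comp
      (hF.mono_set hsubF)
  have hgi : IntegrableOn g (Ioc a b) :=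
    integrableOn_mulL (continuous_toLinf_phaseMul hSm mξ (by positivity) bξ
      (R := R) fun ζ h => h.2) hΦi
  have hduh := duhamel (a := a) (b := b) hSm hR0 (fun ζ h => h.2)
    (fun ζ h => (abs_xi_le_of_mem_piece (hSk h)).trans hR) hVi hΦi
    (fun t ht => fourier_solution_from hv hsol hF ha ht.1 (ht.2.trans hb))
  have hfc : ContinuousOn f (Icc a b) := (continuousOn_mulL_phaseMul hv k R).mono hsubT
  have hfm : AEStronglyMeasurable f (volume.restrict (Ioc a b)) :=
    (hfc.mono Ioc_subset_Icc_self).aestronglyMeasurable measurableSet_Ioc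
  have him : AEStronglyMeasurable (fun t => (inner ℂ (E t) (f t) : ℂ))
      (volume.restrict (Ioc a b)) := hEi.1.inner hfm
  refine ⟨him, ?_⟩
  obtain ⟨Q, hQ⟩ := isCompact_Icc.exists_bound_of_continuousOn hfc
  have hii : IntegrableOn (fun t => (inner ℂ (E t) (f t) : ℂ)) (Ioc a b) := by
    refine Integrable.mono' (g := fun _ => ‖wave k hδ 0‖ * Q) (integrable_const _) him ?_
    filter_upwards [ae_restrict_mem measurableSet_Ioc] with t ht
    refine (norm_inner_le_norm _ _).trans ?_
    rw [hE]; simp only; rw [norm_wave_eq k hδ]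
    exact mul_le_mul_of_nonneg_left (hQ t (Ioc_subset_Icc_self ht)) (norm_nonneg _)
  have hba0 : 0 ≤ b - a := sub_nonneg.2 hab
  set Λ : ℝ := 2 * β ^ (3 * θ / 2) * (2 * (b - a) ^ (θ / 2) / (θ / 2)) with hΛ
  have hlen1 : b - a ≤ 1 := hlen.trans (inv_le_one_of_one_le₀ hβ1)
  have main := integral_norm_inner_le hab hEi hgi
    (fun t ht => hduh t (Ioc_subset_Icc_self ht))
    (κ := fun u => 2 * β ^ (3 * θ / 2) * |u| ^ (-1 + θ / 2)) (Λ := Λ)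
    (fun u => by positivity)
    (fun t t' hne ht ht' => by
      refine (norm_inner_wave_le k hδ hθ.le hθ1 hne ?_).trans (le_of_eq (by ring))
      simp only
      rw [abs_le]; constructor <;> linarith [ht.1, ht.2, ht'.1, ht'.2])
    (fun t ht => by
      have h := (integrableOn_abs_sub_rpow (by positivity : 0 < θ / 2)
        (Ioc_subset_Icc_self ht)).1
      exact Integrable.const_mul h (2 * β ^ (3 * θ / 2)))
    (fun t ht => by
      rw [integral_const_mul, hΛ]
      exact mul_le_mul_of_nonneg_left (integrableOn_abs_sub_rpow (by positivity : 0 < θ / 2)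
        (Ioc_subset_Icc_self ht)).2 (by positivity))
  -- With `b - a ≤ β⁻¹` the powers are `-1 + 3θ/2 - θ/2 = θ - 1`, halved by the square root.
  have hA : √((b - a) * Λ) ≤ √(8 / θ) * β ^ ((θ - 1) / 2) := by
    have h1 : (b - a) * Λ ≤ 8 / θ * β ^ (θ - 1) := by
      have h2 : (b - a) ^ (θ / 2) ≤ (β⁻¹) ^ (θ / 2) := Real.rpow_le_rpow hba0 hlen (by positivity)
      calc (b - a) * Λ ≤ β⁻¹ * (2 * β ^ (3 * θ / 2) * (2 * (β⁻¹) ^ (θ / 2) / (θ / 2))) := by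
            rw [hΛ]; gcongr
        _ = 8 / θ * (β⁻¹ * β ^ (3 * θ / 2) * (β⁻¹) ^ (θ / 2)) := by field_simp; ring
        _ = 8 / θ * β ^ (θ - 1) := by
            rw [Real.inv_rpow hβ0.le, ← Real.rpow_neg hβ0.le, ← Real.rpow_neg_one,
              ← Real.rpow_add hβ0, ← Real.rpow_add hβ0]
            congr 2; ring
    refine (Real.sqrt_le_sqrt h1).trans (le_of_eq ?_)
    rw [Real.sqrt_mul (by positivity)]
    congr 1
    rw [Real.sqrt_eq_rpow, ← Real.rpow_mul hβ0.le]
    congr 1; ring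
  have hcalc : ∫⁻ t in Ioc a b, ‖(inner ℂ (E t) (f t) : ℂ)‖ₑ ≤
      ENNReal.ofReal (√((b - a) * Λ)) * (‖f a‖ₑ + ∫⁻ t in Ioc a b, ‖g t‖ₑ) := by
    rw [← ofReal_integral_norm_eq_lintegral_enorm hii,
      ← ofReal_integral_norm_eq_lintegral_enorm hgi, ← ofReal_norm,
      ← ENNReal.ofReal_add (norm_nonneg _) (integral_nonneg fun _ => norm_nonneg _),
      ← ENNReal.ofReal_mul (Real.sqrt_nonneg _)]
    exact ENNReal.ofReal_le_ofReal main
  refine hcalc.trans ?_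
  refine mul_le_mul' (ENNReal.ofReal_le_ofReal hA) (add_le_add ?_ ?_)
  · have := enorm_mulL_phaseMul_le hSm hSk (b := 1) measurable_const zero_le_one
      (fun ζ _ => by simp) hs a (v a)
    rwa [one_mul] at this
  · rw [← lintegral_const_mul' _ _ ENNReal.ofReal_ne_top]
    exact lintegral_mono fun t => enorm_mulL_phaseMul_le hSm hSk mξ (by positivity) bξ hs t (F t)

/-- The regularized bound depends neither on `δ` nor on `R`, so Fatou's lemma passes it to the
limit. -/
theorem lintegral_localPart_path_le (k : ℕ) {θ s T : ℝ} (hθ : 0 < θ) (hθ1 : θ ≤ 1) (hs : 0 ≤ s)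
    {v F : ℝ → L2Plane} (hv : ContHInfty T v) (hsol : IsSolution T v F)
    (hF : IntegrableOn F (Ioc 0 T)) {a b : ℝ} (ha : 0 ≤ a) (hab : a ≤ b) (hb : b ≤ T)
    (hlen : b - a ≤ ((2 : ℝ) ^ k)⁻¹) {z : ℝ → Plane} (hz : Measurable z) :
    ∫⁻ t in Ioc a b, ‖localPart k (v t) (z t)‖ₑ ≤
      ENNReal.ofReal (√(8 / θ) * ((2 : ℝ) ^ k) ^ ((θ - 1) / 2)) *
        (ENNReal.ofReal (((2 : ℝ) ^ k) ^ (-s)) * JxNorm s (v a) +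
          ENNReal.ofReal (2 * Real.pi * 2 ^ k * ((2 : ℝ) ^ k) ^ (-s)) *
            ∫⁻ t in Ioc a b, JxNorm s (F t)) := by
  have hmain := fun n : ℕ => lintegral_inner_wave_le k hθ hθ1 hs hv hsol hF ha hab hb hlen hz
    (by positivity : (0 : ℝ) < 1 / (n + 1)) (R := n + 2 * Real.pi * 2 ^ k)
    (by have : (0 : ℝ) ≤ n := n.cast_nonneg
        linarith)
  have hlim : ∀ t ∈ Ioc a b, ‖localPart k (v t) (z t)‖ₑ = liminf (fun n : ℕ =>
      ‖(inner ℂ (wave k (by positivity : (0 : ℝ) < 1 / (n + 1)) (t, z t))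
      (mulL (toLinf (phaseMul (boundedPiece k (n + 2 * Real.pi * 2 ^ k)) 1 t))
        (𝓕 (v t) : L2Plane)) : ℂ)‖ₑ) atTop := by
    intro t ht
    exact ((tendsto_inner_wave_mulL k t (z t)
      (hv.1 t ⟨ha.trans ht.1.le, ht.2.trans hb⟩)).enorm.liminf_eq).symm
  rw [setLIntegral_congr_fun measurableSet_Ioc hlim]
  refine (lintegral_liminf_le' fun n => (hmain n).1.enorm).trans ?_
  refine liminf_le_of_le (by isBoundedDefault) fun c hc => ?_
  obtain ⟨n, hn⟩ := hc.exists
  exact hn.trans (hmain n).2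

/-! ### From measurable paths to the supremum in space. -/

/-- A supremum of countably many functions can be linearized by measurable selections. -/
theorem lintegral_iSup_le_of_selection {μ : Measure ℝ} {f : ℕ → ℝ → ℝ≥0∞}
    (hf : ∀ n, Measurable (f n)) {B : ℝ≥0∞}
    (h : ∀ φ : ℝ → ℕ, Measurable φ → ∫⁻ t, f (φ t) t ∂μ ≤ B) : ∫⁻ t, ⨆ n, f n t ∂μ ≤ B := by
  have hcomp : ∀ φ : ℝ → ℕ, Measurable φ → Measurable fun t => f (φ t) t := fun φ hφ =>
    (measurable_from_prod_countable_right (f := fun p : ℕ × ℝ => f p.1 p.2) hf).comp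
      (hφ.prodMk measurable_id)
  -- `φ M t` is an index in `{0, …, M}` maximizing `f · t`, updated one index at a time; monotone
  -- convergence then reaches the full supremum.
  let φ : ℕ → ℝ → ℕ := fun M => Nat.rec (fun _ => 0)
    (fun M φM t => if f (φM t) t < f (M + 1) t then M + 1 else φM t) M
  have hφs : ∀ M t, φ (M + 1) t = if f (φ M t) t < f (M + 1) t then M + 1 else φ M t :=
    fun M t => rfl
  have hφm : ∀ M, Measurable (φ M) := by
    intro M
    induction M with
    | zero => exact measurable_const
    | succ M ih =>
      have : φ (M + 1) = fun t => if f (φ M t) t < f (M + 1) t then M + 1 else φ M t :=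
        funext (hφs M)
      rw [this]
      exact Measurable.ite (measurableSet_lt (hcomp _ ih) (hf _)) measurable_const ih
  have hstep : ∀ M t, f (φ M t) t ≤ f (φ (M + 1) t) t ∧ f (M + 1) t ≤ f (φ (M + 1) t) t := by
    intro M t
    rw [hφs]
    split_ifs with h1
    · exact ⟨h1.le, le_rfl⟩
    · exact ⟨le_rfl, not_lt.1 h1⟩
  have hmono : Monotone fun M t => f (φ M t) t :=
    monotone_nat_of_le_succ fun M t => (hstep M t).1
  have hle : ∀ n t, f n t ≤ f (φ n t) t := by
    intro n t
    cases n with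
    | zero => exact le_rfl
    | succ n => exact (hstep n t).2
  calc ∫⁻ t, ⨆ n, f n t ∂μ ≤ ∫⁻ t, ⨆ M, f (φ M t) t ∂μ :=
        lintegral_mono fun t => iSup_mono fun n => hle n t
    _ = ⨆ M, ∫⁻ t, f (φ M t) t ∂μ := lintegral_iSup (fun M => hcomp _ (hφm M)) hmono
    _ ≤ B := iSup_le fun M => h _ (hφm M)

open Classical in
/-- The values of the `k`-th frequency piece along a dense sequence, extended by `0` in time. -/
noncomputable def sampled (T : ℝ) (v : ℝ → L2Plane) (k n : ℕ) (t : ℝ) : ℝ≥0∞ :=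
  ‖(Icc 0 T).indicator (fun t => localPart k (v t) (TopologicalSpace.denseSeq Plane n)) t‖ₑ

theorem measurable_sampled {T : ℝ} {v : ℝ → L2Plane} (hv : ContHInfty T v) (k n : ℕ) :
    Measurable (sampled T v k n) := by
  set z := TopologicalSpace.denseSeq Plane n
  refine Measurable.enorm ?_
  refine measurable_of_tendsto_metrizable (f := fun m : ℕ => (Icc 0 T).indicator fun t =>
    (inner ℂ (wave k (by positivity : (0 : ℝ) < 1 / (m + 1)) (t, z))
      (mulL (toLinf (phaseMul (boundedPiece k (m + 2 * Real.pi * 2 ^ k)) 1 t))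
        (𝓕 (v t) : L2Plane)) : ℂ)) (fun m => ?_) ?_
  · classical
    rw [← piecewise_eq_indicator]
    refine ContinuousOn.measurable_piecewise ?_ continuousOn_const measurableSet_Icc
    refine ContinuousOn.inner (𝕜 := ℂ) ?_ (continuousOn_mulL_phaseMul hv k _)
    exact ((continuous_wave k _).comp (by fun_prop)).continuousOn
  · rw [tendsto_pi_nhds]
    intro t
    by_cases ht : t ∈ Icc 0 T
    · simp only [indicator_of_mem ht]
      exact tendsto_inner_wave_mulL k t z (hv.1 t ht)
    · simp only [indicator_of_notMem ht]
      exact tendsto_const_nhds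

theorem lintegral_iSup_sampled_interval_le (k : ℕ) {θ s T : ℝ} (hθ : 0 < θ) (hθ1 : θ ≤ 1)
    (hs : 0 ≤ s) {v F : ℝ → L2Plane} (hv : ContHInfty T v) (hsol : IsSolution T v F)
    (hF : IntegrableOn F (Ioc 0 T)) {a b : ℝ} (ha : 0 ≤ a) (hab : a ≤ b) (hb : b ≤ T)
    (hlen : b - a ≤ ((2 : ℝ) ^ k)⁻¹) :
    ∫⁻ t in Ioc a b, ⨆ n, sampled T v k n t ≤
      ENNReal.ofReal (√(8 / θ) * ((2 : ℝ) ^ k) ^ ((θ - 1) / 2)) *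
        (ENNReal.ofReal (((2 : ℝ) ^ k) ^ (-s)) * JxNorm s (v a) +
          ENNReal.ofReal (2 * Real.pi * 2 ^ k * ((2 : ℝ) ^ k) ^ (-s)) *
            ∫⁻ t in Ioc a b, JxNorm s (F t)) := by
  refine lintegral_iSup_le_of_selection (measurable_sampled hv k) fun φ hφ => ?_
  refine le_trans (le_of_eq ?_) (lintegral_localPart_path_le k hθ hθ1 hs hv hsol hF ha hab hb hlen
    (z := fun t => TopologicalSpace.denseSeq Plane (φ t)) (measurable_from_nat.comp hφ))
  refine setLIntegral_congr_fun measurableSet_Ioc fun t ht => ?_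
  have : t ∈ Icc 0 T := ⟨ha.trans ht.1.le, ht.2.trans hb⟩
  simp only [sampled, indicator_of_mem this]

/-! ### Fourier inversion and reassembly of the dyadic pieces. -/

theorem osc_zero_eq (z ζ : Plane) :
    osc 0 z ζ = Complex.exp (((2 * Real.pi * inner ℝ ζ z : ℝ) : ℂ) * Complex.I) := by
  unfold osc
  rw [PiLp.inner_apply, Fin.sum_univ_two]
  simp only [RCLike.inner_apply, conj_trivial, zero_mul, add_zero]
  rw [mul_comm]

/-- Fourier inversion for an `L²` function with integrable Fourier transform. -/
theorem ae_eq_integral_osc {u : L2Plane} (hu : Integrable fun ζ => (𝓕 u : L2Plane) ζ) :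
    u =ᵐ[volume] fun z => ∫ ζ, osc 0 z ζ * (𝓕 u : L2Plane) ζ := by
  set V : Plane → ℂ := fun ζ => (𝓕 u : L2Plane) ζ with hV
  have hw : (fun z => ∫ ζ, osc 0 z ζ * V ζ) = 𝓕⁻ V := by
    funext z
    rw [Real.fourierInv_eq']
    simp only [osc_zero_eq, smul_eq_mul]
  rw [hw]
  have hcL : Continuous fun p : Plane × Plane => (-innerₗ Plane) p.1 p.2 := by
    simp only [LinearMap.neg_apply, innerₗ_apply_apply]
    fun_prop
  have hcont : Continuous (𝓕⁻ V) :=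
    VectorFourier.fourierIntegral_continuous (L := -innerₗ Plane) Real.continuous_fourierChar hcL hu
  refine ae_eq_of_integral_contDiff_smul_eq ((Lp.memLp u).locallyIntegrable (by norm_num))
    hcont.locallyIntegrable fun g hg hgc => ?_
  have hgC : ContDiff ℝ ((⊤ : ℕ∞) : WithTop ℕ∞) fun ζ => (g ζ : ℂ) :=
    Complex.ofRealCLM.contDiff.comp hg
  have hgcC : HasCompactSupport fun ζ => (g ζ : ℂ) := hgc.comp_left Complex.ofReal_zero
  set G : 𝓢(Plane, ℂ) := hgcC.toSchwartzMap hgC with hG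
  have hGa : ∀ ζ, G ζ = g ζ := fun ζ => rfl
  -- Tested against `G`, both sides equal the pairing of `û` with `𝓕⁻ G`: one by the `L²` theory,
  -- the other by Fubini for the integrable `û`.
  have h1 := integral_mul_fourier u (𝓕⁻ G)
  rw [FourierTransform.fourier_fourierInv_eq] at h1
  have h2 : ∫ z, 𝓕⁻ V z • G z = ∫ ζ, V ζ • 𝓕⁻ (G : Plane → ℂ) ζ := by
    have h3 := VectorFourier.integral_fourierIntegral_smul_eq_flip (μ := volume) (ν := volume)
      (L := -innerₗ Plane) Real.continuous_fourierChar hcL hu G.integrable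
    have h4 : (-innerₗ Plane).flip = -innerₗ Plane := by
      ext x y
      simp [real_inner_comm]
    rw [h4] at h3
    exact h3
  rw [← SchwartzMap.fourierInv_coe] at h2
  calc ∫ z, g z • u z = ∫ z, u z * G z := by
        congr 1; funext z; rw [hGa, Complex.real_smul, mul_comm]
    _ = ∫ z, 𝓕⁻ V z • G z := by rw [h1, h2]; rfl
    _ = ∫ z, g z • 𝓕⁻ V z := by
        congr 1; funext z; rw [hGa, Complex.real_smul, smul_eq_mul, mul_comm]

theorem exists_mem_piece {ζ : Plane} (h : ζ 0 ≠ 0) : ∃ k, ζ ∈ piece k := by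
  have h0 : 0 < |ζ 0| := abs_pos.2 h
  rcases lt_or_ge |ζ 0| 1 with h1 | h1
  · exact ⟨0, h0, by rw [dyadicLow, if_pos rfl]; exact h0.le, by rwa [pow_zero]⟩
  · obtain ⟨n, hn1, hn2⟩ := exists_nat_pow_near h1 (one_lt_two : (1 : ℝ) < 2)
    refine ⟨n + 1, h0, ?_, hn2⟩
    rw [dyadicLow, if_neg n.succ_ne_zero, pow_succ]
    linarith

theorem pairwise_disjoint_piece : Pairwise (Function.onFun Disjoint piece) := by
  have h : ∀ i j, i < j → Disjoint (piece i) (piece j) := by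
    intro i j hij
    rw [Set.disjoint_left]
    intro ζ hi hj
    have h1 := hj.2.1
    rw [dyadicLow, if_neg (by omega)] at h1
    have h2 : (2 : ℝ) ^ (i + 1) ≤ 2 ^ j := pow_le_pow_right₀ (by norm_num) hij
    rw [pow_succ] at h2
    have := hi.2.2
    linarith
  intro i j hij
  rcases lt_or_gt_of_ne hij with h1 | h1
  · exact h i j h1
  · exact (h j i h1).symm

theorem integrable_osc_mul {u : L2Plane} (hu : MemHInfty u) (z : Plane) :
    Integrable fun ζ => osc 0 z ζ * (𝓕 u : L2Plane) ζ := by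
  refine (integrable_fourier hu).bdd_mul (c := 1) (measurable_osc 0 z).aestronglyMeasurable ?_
  exact Eventually.of_forall fun ζ => (norm_osc 0 z ζ).le

/-- The pieces partition the plane up to the null line `ζ 0 = 0`; integrability of `û` allows
splitting the inversion integral. -/
theorem enorm_le_tsum_localPart {u : L2Plane} (hu : MemHInfty u) :
    ∀ᵐ z, ‖u z‖ₑ ≤ ∑' k, ‖localPart k u z‖ₑ := by
  filter_upwards [ae_eq_integral_osc (integrable_fourier hu)] with z hz
  have hs := hasSum_integral_iUnion (s := piece) measurableSet_piece pairwise_disjoint_piece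
    (integrable_osc_mul hu z).integrableOn
  have huniv : (⋃ k, piece k) =ᵐ[volume] (univ : Set Plane) := by
    rw [ae_eq_univ, ← nonpos_iff_eq_zero]
    refine le_trans (measure_mono fun ζ hζ => ?_) (le_of_eq (ae_iff.1 ae_coord_ne_zero))
    simp only [mem_compl_iff, mem_iUnion] at hζ
    exact fun h => hζ (exists_mem_piece h)
  rw [setIntegral_congr_set huniv, setIntegral_univ] at hs
  rw [hz, ← hs.tsum_eq]
  exact enorm_tsum_le_tsum_enorm

theorem continuous_localPart (k : ℕ) {u : L2Plane} (hu : MemHInfty u) :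
    Continuous (localPart k u) := by
  refine continuous_of_dominated (bound := fun ζ => ‖(𝓕 u : L2Plane) ζ‖) (fun z => ?_)
    (fun z => Eventually.of_forall fun ζ => ?_) (integrable_fourier hu).norm.integrableOn
    (Eventually.of_forall fun ζ => ?_)
  · exact (integrable_osc_mul hu z).1.restrict
  · rw [norm_mul, norm_osc, one_mul]
  · exact ((continuous_osc ζ).comp (by fun_prop : Continuous fun z : Plane => ((0 : ℝ), z))).mul
      continuous_const

/-- A localized piece is continuous in `z`, so its values on a dense sequence control it everywhere.
This reduces the spatial supremum to a countable one. -/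
theorem enorm_localPart_le_iSup_sampled {T : ℝ} {v : ℝ → L2Plane} (hv : ContHInfty T v) {t : ℝ}
    (ht : t ∈ Icc 0 T) (k : ℕ) (z : Plane) :
    ‖localPart k (v t) z‖ₑ ≤ ⨆ n, sampled T v k n t := by
  have hcl : IsClosed {z | ‖localPart k (v t) z‖ₑ ≤ ⨆ n, sampled T v k n t} :=
    isClosed_le (continuous_localPart k (hv.1 t ht)).enorm continuous_const
  have hd := TopologicalSpace.denseRange_denseSeq Plane
  refine hd.induction_on (p := fun z => ‖localPart k (v t) z‖ₑ ≤ ⨆ n, sampled T v k n t) z hcl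
    fun n => ?_
  refine le_trans (le_of_eq ?_) (le_iSup _ n)
  simp only [sampled, indicator_of_mem ht]

theorem eLpNorm_top_le_tsum {T : ℝ} {v : ℝ → L2Plane} (hv : ContHInfty T v) {t : ℝ}
    (ht : t ∈ Icc 0 T) : eLpNorm (v t) ∞ volume ≤ ∑' k, ⨆ n, sampled T v k n t := by
  rw [eLpNorm_exponent_top]
  refine eLpNormEssSup_le_of_ae_enorm_bound ?_
  filter_upwards [enorm_le_tsum_localPart (hv.1 t ht)] with z hz
  exact hz.trans (ENNReal.tsum_le_tsum fun k => enorm_localPart_le_iSup_sampled hv ht k z)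

/-! ### Summation over time intervals and dyadic ranges. -/

theorem JxNorm_add_le (s : ℝ) (u w : L2Plane) : JxNorm s (u + w) ≤ JxNorm s u + JxNorm s w := by
  unfold JxNorm multNorm
  refine le_trans (le_of_eq ?_) (eLpNorm_add_le ?_ ?_ (by norm_num))
  · refine eLpNorm_congr_ae ?_
    have h : (𝓕 (u + w) : L2Plane) = 𝓕 u + 𝓕 w := (Lp.fourierTransformₗᵢ Plane ℂ).map_add u w
    rw [h]
    filter_upwards [Lp.coeFn_add (𝓕 u : L2Plane) (𝓕 w : L2Plane)] with ζ hζ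
    rw [hζ, Pi.add_apply, Pi.add_apply, mul_add]
  · exact AEStronglyMeasurable.mul (Measurable.aestronglyMeasurable (by fun_prop))
      (Lp.aestronglyMeasurable _)
  · exact AEStronglyMeasurable.mul (Measurable.aestronglyMeasurable (by fun_prop))
      (Lp.aestronglyMeasurable _)

theorem JxNorm_sub_comm (s : ℝ) (u w : L2Plane) : JxNorm s (u - w) = JxNorm s (w - u) := by
  unfold JxNorm multNorm
  have h : (𝓕 (u - w) : L2Plane) = -𝓕 (w - u) := by
    have h1 := (Lp.fourierTransformₗᵢ Plane ℂ).map_neg (w - u)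
    rw [neg_sub] at h1
    exact h1
  rw [h]
  refine eLpNorm_congr_norm_ae ?_
  filter_upwards [Lp.coeFn_neg (𝓕 (w - u) : L2Plane)] with ζ hζ
  rw [hζ, Pi.neg_apply, mul_neg, norm_neg]

/-- By continuity in time, the essential supremum bounds the norm at every time. -/
theorem JxNorm_le_normJxLinftyL2 {s T : ℝ} (hs : 0 ≤ s) (hT : 0 < T) {v : ℝ → L2Plane}
    (hv : ContHInfty T v) {a : ℝ} (ha : a ∈ Icc 0 T) : JxNorm s (v a) ≤ normJxLinftyL2 s T v := by
  set J := normJxLinftyL2 s T v with hJ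
  have hae : ∀ᵐ t ∂(volume.restrict (Icc 0 T)), JxNorm s (v t) ≤ J := ae_le_essSup
  -- Otherwise the bound would fail on a nonempty open interval inside `[0,T]`, which has positive
  -- measure; this is where `0 < T` enters.
  have hfreq : ∃ᶠ t in 𝓝[Icc 0 T] a, JxNorm s (v t) ≤ J := by
    intro hev
    rw [eventually_nhdsWithin_iff, Metric.eventually_nhds_iff] at hev
    obtain ⟨d, hd, hbad⟩ := hev
    rw [ae_restrict_iff' measurableSet_Icc, ae_iff] at hae
    have hsub : Ioo (max 0 (a - d)) (min T (a + d)) ⊆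
        {t | ¬(t ∈ Icc 0 T → JxNorm s (v t) ≤ J)} := by
      intro t ht
      have h1 := max_lt_iff.1 ht.1
      have h2 := lt_min_iff.1 ht.2
      have h3 : t ∈ Icc 0 T := ⟨h1.1.le, h2.1.le⟩
      refine fun h => hbad ?_ h3 (h h3)
      rw [Real.dist_eq, abs_lt]
      constructor <;> linarith [h1.2, h2.2]
    have h0 := measure_mono_null hsub hae
    rw [Real.volume_Ioo, ENNReal.ofReal_eq_zero, sub_nonpos] at h0
    have : max 0 (a - d) < min T (a + d) := by
      rw [max_lt_iff, lt_min_iff, lt_min_iff]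
      exact ⟨⟨hT, by linarith [ha.1]⟩, by linarith [ha.2], by linarith⟩
    exact absurd h0 (not_le.2 this)
  have htend : Tendsto (fun t => J + HNorm s (v t - v a)) (𝓝[Icc 0 T] a) (𝓝 J) := by
    have := (hv.2 s a ha).const_add J
    rwa [add_zero] at this
  refine ge_of_tendsto_of_frequently htend (hfreq.mono fun t ht => ?_)
  calc JxNorm s (v a) = JxNorm s (v t + (v a - v t)) := by rw [add_sub_cancel]
    _ ≤ JxNorm s (v t) + JxNorm s (v a - v t) := JxNorm_add_le _ _ _
    _ ≤ J + HNorm s (v t - v a) := by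
        rw [JxNorm_sub_comm]
        exact add_le_add ht (JxNorm_le_HNorm hs _)

/-- Each short interval contributes the data at its left endpoint, at most `J`, so these terms are
multiplied by the number of intervals. The forcing integrals simply add up. -/
theorem lintegral_iSup_sampled_le (k : ℕ) {θ s T : ℝ} (hθ : 0 < θ) (hθ1 : θ ≤ 1)
    (hs : 0 ≤ s) (hT : 0 ≤ T) {v F : ℝ → L2Plane} (hv : ContHInfty T v) (hsol : IsSolution T v F)
    (hF : IntegrableOn F (Ioc 0 T)) {J : ℝ≥0∞} (hJ : ∀ a ∈ Icc 0 T, JxNorm s (v a) ≤ J) :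
    ∫⁻ t in Ioc 0 T, ⨆ n, sampled T v k n t ≤
      ENNReal.ofReal (√(8 / θ) * ((2 : ℝ) ^ k) ^ ((θ - 1) / 2)) *
        (ENNReal.ofReal ((1 + T) * 2 ^ k * ((2 : ℝ) ^ k) ^ (-s)) * J +
          ENNReal.ofReal (2 * Real.pi * 2 ^ k * ((2 : ℝ) ^ k) ^ (-s)) *
            ∫⁻ t in Ioc 0 T, JxNorm s (F t)) := by
  set β : ℝ := 2 ^ k with hβ
  have hβ1 : 1 ≤ β := one_le_pow₀ (by norm_num)
  have hβ0 : 0 < β := by positivity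
  -- Enough intervals for the length `T / n` to be at most `β⁻¹`, and at most `(1 + T) β` of them
  -- because `β ≥ 1`.
  set n : ℕ := ⌊T * β⌋₊ + 1 with hn
  have hn0 : (0 : ℝ) < n := by rw [hn]; positivity
  have hnT : T * β ≤ n := by rw [hn]; push_cast; exact (Nat.lt_floor_add_one _).le
  have hnle : (n : ℝ) ≤ (1 + T) * β := by
    rw [hn]; push_cast
    have := Nat.floor_le (mul_nonneg hT hβ0.le)
    linarith
  set A := ENNReal.ofReal (√(8 / θ) * β ^ ((θ - 1) / 2)) with hA
  set P := ENNReal.ofReal (β ^ (-s)) with hP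
  set Q := ENNReal.ofReal (2 * Real.pi * β * β ^ (-s)) with hQ
  have hind : ∀ m : ℕ, m ≤ n → ∫⁻ t in Ioc 0 (m * (T / n)), ⨆ n, sampled T v k n t ≤
      A * (m * (P * J) + Q * ∫⁻ t in Ioc 0 (m * (T / n)), JxNorm s (F t)) := by
    intro m
    induction m with
    | zero => intro _; simp
    | succ m ih =>
      intro hm
      have hTn : 0 ≤ T / n := by positivity
      set a := (m : ℝ) * (T / n) with ha
      set b := ((m + 1 : ℕ) : ℝ) * (T / n) with hb
      have hba : b - a = T / n := by rw [ha, hb]; push_cast; ring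
      have ha0 : 0 ≤ a := by positivity
      have hab : a ≤ b := by linarith
      have hbT : b ≤ T := by
        have h1 : ((m + 1 : ℕ) : ℝ) ≤ n := by exact_mod_cast hm
        calc b ≤ n * (T / n) := mul_le_mul_of_nonneg_right h1 hTn
          _ = T := by field_simp
      have hlen : b - a ≤ β⁻¹ := by
        rw [hba, inv_eq_one_div, div_le_div_iff₀ hn0 hβ0, one_mul]; exact hnT
      have hstep := lintegral_iSup_sampled_interval_le k hθ hθ1 hs hv hsol hF ha0 hab hbT hlen
      have hJa : JxNorm s (v a) ≤ J := hJ a ⟨ha0, hab.trans hbT⟩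
      rw [← Ioc_union_Ioc_eq_Ioc ha0 hab,
        lintegral_union measurableSet_Ioc (Ioc_disjoint_Ioc_of_le le_rfl),
        lintegral_union measurableSet_Ioc (Ioc_disjoint_Ioc_of_le le_rfl)]
      refine (add_le_add (ih (by omega)) (hstep.trans
        (mul_le_mul_right (add_le_add_left (mul_le_mul_right hJa P) _) A))).trans (le_of_eq ?_)
      push_cast
      ring
  have hfin := hind n le_rfl
  have hnn : (n : ℝ) * (T / n) = T := by field_simp
  rw [hnn] at hfin
  refine hfin.trans (mul_le_mul' le_rfl (add_le_add ?_ le_rfl))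
  rw [← mul_assoc]
  refine mul_le_mul' ?_ le_rfl
  rw [hP, ← ENNReal.ofReal_natCast, ← ENNReal.ofReal_mul (by positivity)]
  exact ENNReal.ofReal_le_ofReal (mul_le_mul_of_nonneg_right hnle (by positivity))

/-- Both terms carry `β` to the power `(θ - 1)/2 + 1 - (1/2 + ε) = θ/2 - ε ≤ -ε/2`, which is
geometric decay in `k`. -/
theorem lintegral_iSup_sampled_le_geometric (k : ℕ) {ε θ T : ℝ} (hε : 0 < ε) (hθ : 0 < θ)
    (hθ1 : θ ≤ 1) (hθε : θ ≤ ε) (hT : 0 ≤ T) {v F : ℝ → L2Plane} (hv : ContHInfty T v)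
    (hsol : IsSolution T v F) (hF : IntegrableOn F (Ioc 0 T)) {J : ℝ≥0∞}
    (hJ : ∀ a ∈ Icc 0 T, JxNorm (1 / 2 + ε) (v a) ≤ J) :
    ∫⁻ t in Ioc 0 T, ⨆ n, sampled T v k n t ≤
      ENNReal.ofReal (√(8 / θ) * (2 * Real.pi) * ((2 : ℝ) ^ (-(ε / 2))) ^ k) *
        (ENNReal.ofReal (1 + T) * J + ∫⁻ t in Ioc 0 T, JxNorm (1 / 2 + ε) (F t)) := by
  have hπ := Real.pi_gt_three
  refine (lintegral_iSup_sampled_le k hθ hθ1 (by positivity) hT hv hsol hF hJ).trans ?_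
  set β : ℝ := 2 ^ k with hβ
  have hβ1 : 1 ≤ β := one_le_pow₀ (by norm_num)
  have hβ0 : 0 < β := by positivity
  have hexp : β ^ ((θ - 1) / 2) * (β * β ^ (-(1 / 2 + ε))) ≤ ((2 : ℝ) ^ (-(ε / 2))) ^ k := by
    have e1 : ((2 : ℝ) ^ (-(ε / 2))) ^ k = β ^ (-(ε / 2)) := by
      rw [hβ, ← Real.rpow_natCast, ← Real.rpow_mul (by norm_num), ← Real.rpow_natCast 2 k,
        ← Real.rpow_mul (by norm_num), mul_comm]
    have e2 : β ^ ((θ - 1) / 2) * (β * β ^ (-(1 / 2 + ε))) = β ^ (θ / 2 - ε) := by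
      nth_rewrite 2 [← Real.rpow_one β]
      rw [← Real.rpow_add hβ0, ← Real.rpow_add hβ0]
      congr 1; ring
    rw [e1, e2]
    exact Real.rpow_le_rpow_of_exponent_le hβ1 (by linarith)
  set A := √(8 / θ) with hA
  have hA0 : 0 ≤ A := Real.sqrt_nonneg _
  set x := β ^ ((θ - 1) / 2) with hx
  set y := β ^ (-(1 / 2 + ε)) with hy
  set r := ((2 : ℝ) ^ (-(ε / 2))) ^ k with hr
  have hx0 : 0 ≤ x := by positivity
  have hy0 : 0 ≤ y := by positivity
  rw [mul_add, mul_add, ← mul_assoc, ← mul_assoc, ← mul_assoc,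
    ← ENNReal.ofReal_mul (by positivity), ← ENNReal.ofReal_mul (by positivity),
    ← ENNReal.ofReal_mul (by positivity)]
  refine add_le_add (mul_le_mul' (ENNReal.ofReal_le_ofReal ?_) le_rfl)
    (mul_le_mul' (ENNReal.ofReal_le_ofReal ?_) le_rfl)
  · calc A * x * ((1 + T) * β * y) = A * (1 + T) * (x * (β * y)) := by ring
      _ ≤ A * (1 + T) * (2 * Real.pi * r) := by
          refine mul_le_mul_of_nonneg_left (hexp.trans ?_) (by positivity)
          have : 0 ≤ r := by positivity
          nlinarith
      _ = _ := by ring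
  · calc A * x * (2 * Real.pi * β * y) = A * (2 * Real.pi) * (x * (β * y)) := by ring
      _ ≤ _ := by gcongr

end KP

theorem mainTheorem4 (ε : ℝ) (hε : 0 < ε) :
    ∃ C : ℝ≥0, ∀ (T : ℝ) (v F : ℝ → L2Plane),
      0 ≤ T →
      AEStronglyMeasurable F (volume.restrict (Set.Icc 0 T)) →
      KP.ContHInfty T v →
      KP.IsSolution T v F →
      KP.normL1Linfty T v ≤
        C * ENNReal.ofReal (1 + T) * KP.normJxLinftyL2 (1 / 2 + ε) T v
          + C * KP.normJxL1L2 (1 / 2 + ε) T F := by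
  have hπ := Real.pi_pos
  -- `θ ≤ 1` is required for the interpolation and `θ ≤ ε` for the summation over `k`.
  set θ := min ε 1 with hθ
  have hθ0 : 0 < θ := lt_min hε one_pos
  set r : ℝ := (2 : ℝ) ^ (-(ε / 2)) with hr
  have hr0 : 0 < r := by positivity
  have hr1 : r < 1 := Real.rpow_lt_one_of_one_lt_of_neg (by norm_num) (by linarith)
  set c : ℝ := √(8 / θ) * (2 * Real.pi) with hc
  have hc0 : 0 < c := by positivity
  set C : ℝ := ∑' k : ℕ, c * r ^ k with hC
  have hsumm : Summable fun k : ℕ => c * r ^ k :=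
    (summable_geometric_of_lt_one hr0.le hr1).mul_left c
  -- Strict positivity matters when the norm of `F` is infinite, since `0 * ∞ = 0` in `ℝ≥0∞`.
  have hCpos : 0 < C := hsumm.tsum_pos (fun k => by positivity) 0 (by positivity)
  refine ⟨C.toNNReal, fun T v F hT hFm hv hsol => ?_⟩
  have hCe : ((C.toNNReal : ℝ≥0) : ℝ≥0∞) = ENNReal.ofReal C := rfl
  rw [hCe]
  set K := KP.normJxL1L2 (1 / 2 + ε) T F with hK
  set J := KP.normJxLinftyL2 (1 / 2 + ε) T v with hJ
  rcases hT.eq_or_lt with rfl | hTpos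
  · unfold KP.normL1Linfty
    rw [Icc_self, Measure.restrict_eq_zero.2 Real.volume_singleton, lintegral_zero_measure]
    exact zero_le
  by_cases hKtop : K = ∞
  · rw [hKtop, ENNReal.mul_top (by simpa using hCpos), add_top]
    exact le_top
  have hres : volume.restrict (Icc 0 T) = volume.restrict (Ioc 0 T) :=
    (Measure.restrict_congr_set Ioc_ae_eq_Icc).symm
  -- Finiteness of the `J_x` norm makes `F` Bochner integrable in `L²`, so the time integrals in
  -- Duhamel's formula are not default values.
  have hF : IntegrableOn F (Ioc 0 T) := by
    rw [hres] at hFm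
    refine ⟨hFm, ?_⟩
    rw [hasFiniteIntegral_iff_enorm]
    refine lt_of_le_of_lt (lintegral_mono fun t => KP.enorm_le_JxNorm
      (by positivity : 0 ≤ 1 / 2 + ε) (F t)) ?_
    rw [← hres]
    exact lt_top_iff_ne_top.2 hKtop
  have hKeq : K = ∫⁻ t in Ioc 0 T, KP.JxNorm (1 / 2 + ε) (F t) := by
    rw [hK, KP.normJxL1L2, hres]
  have hJa : ∀ a ∈ Icc 0 T, KP.JxNorm (1 / 2 + ε) (v a) ≤ J := fun a ha =>
    KP.JxNorm_le_normJxLinftyL2 (by positivity) hTpos hv ha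
  have hk := fun k => KP.lintegral_iSup_sampled_le_geometric k hε hθ0 (min_le_right _ _)
    (min_le_left _ _) hT hv hsol hF hJa
  calc KP.normL1Linfty T v = ∫⁻ t in Ioc 0 T, eLpNorm (v t) ∞ volume := by
        rw [KP.normL1Linfty, hres]
    _ ≤ ∫⁻ t in Ioc 0 T, ∑' k, ⨆ n, KP.sampled T v k n t :=
        setLIntegral_mono_ae' measurableSet_Ioc (Eventually.of_forall fun t ht =>
          KP.eLpNorm_top_le_tsum hv (Ioc_subset_Icc_self ht))
    _ = ∑' k, ∫⁻ t in Ioc 0 T, ⨆ n, KP.sampled T v k n t :=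
        lintegral_tsum fun k => (Measurable.iSup fun n => KP.measurable_sampled hv k n).aemeasurable
    _ ≤ ∑' k : ℕ, ENNReal.ofReal (c * r ^ k) * (ENNReal.ofReal (1 + T) * J + K) := by
        refine ENNReal.tsum_le_tsum fun k => ?_
        rw [hKeq]
        exact hk k
    _ = ENNReal.ofReal C * (ENNReal.ofReal (1 + T) * J + K) := by
        rw [ENNReal.tsum_mul_right, hC, ENNReal.ofReal_tsum_of_nonneg (fun k => by positivity) hsumm]
    _ = _ := by rw [mul_add, mul_assoc]
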